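/- Identify the Heisenberg group $\mathbb{H}^1$ with $\mathbb{R}^3$, with group law $x\cdot y=\big(x_1+y_1,\,x_2+y_2,\,x_3+y_3+\tfrac12(x_1y_2-x_2y_1)\big)$, inverse $x^{-1}=-x$, and Lebesgue measure. Let $\Gamma(t)=(t,\alpha(t),\beta(t))$, $t\in\mathbb{R}$, be a continuous odd curve in $\mathbb{H}^1$ with $\alpha'(0)=0$ that is $C^3$ on $(0,\infty)$. Put $$h_2=t\alpha'-\alpha,\quad \bar\beta(t)=\beta(t)-\tfrac12\int_0^t h_2,\quad \bar h_\beta=t\bar\beta'-\bar\beta,\quad D_2=\alpha'',\quad \bar h_3=\frac{1}{D_2}\det\begin{pmatrix} t&\alpha&\bar\beta\\ 1&\alpha'&\bar\beta'\\ 0&\alpha''&\bar\beta''\end{pmatrix},$$ $$\bar D_3=\alpha''\bar\beta'''-\alpha'''\bar\beta'',\qquad \hat D_3=\alpha''(\bar\beta'''+2\alpha'')-\alpha'''(\bar\beta''+\alpha'),$$ $$\hat{\hat D}_3=\alpha''(\bar\beta'''-\alpha'')-\alpha'''(\bar\beta''-\alpha'),\qquad \hat{\hat{\hat D}}_3=\alpha''(\bar\beta'''-\alpha'')-\alpha'''\big(\bar\beta''-\alpha'+\tfrac{\alpha}{t}\big).$$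 Assume that $D_2,\bar D_3,\hat D_3,\hat{\hat D}_3,\hat{\hat{\hat D}}_3>0$ on $(0,\infty)$ and that there is a constant $c>0$ such that, for all $t>0$, $$h_2'(t)\ge c\,\frac{h_2(t)}{t},\qquad \bar h_3'(t)\ge c\,\frac{\bar h_3(t)}{t},\qquad \bar h_3(t)\ge c\int_0^t h_2 .$$ For $j\in\mathbb{N}=\{0,1,2,\dots\}$ put $t_j=2^{-j}$ and $$\widetilde A_j=\begin{pmatrix} t_j&0&0\\ \alpha(t_j)&h_2(t_j)&0\\ \bar\beta(t_j)&\bar h_\beta(t_j)&t_jh_2(t_j)+\bar h_3(t_j)\end{pmatrix},\qquad S_j=\det\widetilde A_j .$$ Let $\varsigma_0:\mathbb{R}^3\to\mathbb{C}$ be $C^\infty$, supported in $[-1,1]^3$, with $\int\varsigma_0=1$, and for $j\ge1$ let $\varsigma_j(y)=\varsigma_0(y)-\frac{S_j}{S_{j-1}}\varsigma_0(\widetilde A_{j-1}^{-1}\widetilde A_jy)$. Define $$\mathcal{D}_jf(x)=\frac1{S_j}\int f(x\cdot y^{-1})\,\varsigma_j(\widetilde A_j^{-1}y)\,dy,$$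 and let $\mathcal{D}_j^*$ be its adjoint, that is, convolution in the same sense with the kernel $y\mapsto\overline{K_j(y^{-1})}$, where $K_j(y)=S_j^{-1}\varsigma_j(\widetilde A_j^{-1}y)$. Then for every $1<p<\infty$ there is a constant $C<\infty$ such that for all $f\in L^p(\mathbb{H}^1)$ the two square functions below belong to $L^p(\mathbb{H}^1)$ and $$\Big\|\Big(\sum_{j=0}^\infty|\mathcal{D}_jf|^2\Big)^{1/2}\Big\|_p\le C\|f\|_p,\qquad \Big\|\Big(\sum_{j=0}^\infty|\mathcal{D}_j^*f|^2\Big)^{1/2}\Big\|_p\le C\|f\|_p .$$ -/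

import Mathlib

open MeasureTheory Set
open scoped ENNReal NNReal Matrix ComplexConjugate

noncomputable section

namespace HeisenbergLP

/-! ### The Heisenberg group -/

/-- The group law of `ℍ¹`, identified with `ℝ³`. Haar measure is Lebesgue measure `volume`. -/
def heisMul (x y : Fin 3 → ℝ) : Fin 3 → ℝ :=
  ![x 0 + y 0, x 1 + y 1, x 2 + y 2 + (1 / 2) * (x 0 * y 1 - x 1 * y 0)]

/-- The group inverse of `ℍ¹`. -/
def heisInv (x : Fin 3 → ℝ) : Fin 3 → ℝ := ![-x 0, -x 1, -x 2]

theorem heisMul_assoc (x y z : Fin 3 → ℝ) :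
    heisMul (heisMul x y) z = heisMul x (heisMul y z) := by
  ext i; fin_cases i <;> simp [heisMul] <;> ring

theorem heisMul_heisInv (x : Fin 3 → ℝ) : heisMul x (heisInv x) = 0 := by
  ext i; fin_cases i <;> simp [heisMul, heisInv]; ring

/-! ### The curve `(t, α t, β t)` and the functions attached to it -/

section Curve

variable (α β : ℝ → ℝ)

/-- `h₂(t) = t α'(t) - α(t)`. -/
def h2 (t : ℝ) : ℝ := t * deriv α t - α t

/-- `β̄(t) = β(t) - ½ ∫₀ᵗ h₂`. -/
def betaBar (t : ℝ) : ℝ := β t - (1 / 2) * ∫ s in (0 : ℝ)..t, h2 α s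

/-- `D₂(t) = α''(t)`. -/
def D2 (t : ℝ) : ℝ := iteratedDeriv 2 α t

/-- `N̄₃(t)`. -/
def N3Bar (t : ℝ) : ℝ :=
  Matrix.det
    !![t, α t, betaBar α β t;
       1, deriv α t, deriv (betaBar α β) t;
       0, iteratedDeriv 2 α t, iteratedDeriv 2 (betaBar α β) t]

/-- `h̄₃(t) = N̄₃(t) / D₂(t)`. -/
def h3Bar (t : ℝ) : ℝ := N3Bar α β t / D2 α t

/-- `h̄_β(t) = t β̄'(t) - β̄(t)`. -/
def hBetaBar (t : ℝ) : ℝ := t * deriv (betaBar α β) t - betaBar α β t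

def D3Bar (t : ℝ) : ℝ :=
  iteratedDeriv 2 α t * iteratedDeriv 3 (betaBar α β) t
    - iteratedDeriv 3 α t * iteratedDeriv 2 (betaBar α β) t

def D3Hat (t : ℝ) : ℝ :=
  iteratedDeriv 2 α t * (iteratedDeriv 3 (betaBar α β) t + 2 * iteratedDeriv 2 α t)
    - iteratedDeriv 3 α t * (iteratedDeriv 2 (betaBar α β) t + deriv α t)

def D3DoubleHat (t : ℝ) : ℝ :=
  iteratedDeriv 2 α t * (iteratedDeriv 3 (betaBar α β) t - iteratedDeriv 2 α t)
    - iteratedDeriv 3 α t * (iteratedDeriv 2 (betaBar α β) t - deriv α t)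

def D3TripleHat (t : ℝ) : ℝ :=
  iteratedDeriv 2 α t * (iteratedDeriv 3 (betaBar α β) t - iteratedDeriv 2 α t)
    - iteratedDeriv 3 α t * (iteratedDeriv 2 (betaBar α β) t - deriv α t + α t / t)

/-- The standing hypotheses on the flat odd curve `Γ(t) = (t, α(t), β(t))` in `ℍ¹`. -/
structure IsAdmissibleCurve : Prop where
  continuous_fst : Continuous α
  continuous_snd : Continuous β
  odd_fst : ∀ t, α (-t) = -α t
  odd_snd : ∀ t, β (-t) = -β t
  hasDerivAt_zero : HasDerivAt α 0 0
  contDiffOn_fst : ContDiffOn ℝ 3 α (Ioi 0)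
  contDiffOn_snd : ContDiffOn ℝ 3 β (Ioi 0)
  D2_pos : ∀ t, 0 < t → 0 < D2 α t
  D3Bar_pos : ∀ t, 0 < t → 0 < D3Bar α β t
  D3Hat_pos : ∀ t, 0 < t → 0 < D3Hat α β t
  D3DoubleHat_pos : ∀ t, 0 < t → 0 < D3DoubleHat α β t
  D3TripleHat_pos : ∀ t, 0 < t → 0 < D3TripleHat α β t
  deriv_h2_ge : ∃ c : ℝ, 0 < c ∧ ∀ t, 0 < t → c * (h2 α t / t) ≤ deriv (h2 α) t
  deriv_h3Bar_ge : ∃ c : ℝ, 0 < c ∧ ∀ t, 0 < t →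
    c * (h3Bar α β t / t) ≤ deriv (h3Bar α β) t
  h3Bar_ge : ∃ c : ℝ, 0 < c ∧ ∀ t, 0 < t →
    c * (∫ s in (0 : ℝ)..t, h2 α s) ≤ h3Bar α β t

/-- The matrix `Ã(t)`. -/
def ATilde (t : ℝ) : Matrix (Fin 3) (Fin 3) ℝ :=
  !![t, 0, 0;
     α t, h2 α t, 0;
     betaBar α β t, hBetaBar α β t, t * h2 α t + h3Bar α β t]

/-- The dyadic matrix `Ã_j = Ã(2⁻ʲ)`. -/
def ATildeDyadic (j : ℕ) : Matrix (Fin 3) (Fin 3) ℝ := ATilde α β ((2 : ℝ)⁻¹ ^ j)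

/-- `S_j = 2⁻ʲ h₂(2⁻ʲ) (2⁻ʲ h₂(2⁻ʲ) + h̄₃(2⁻ʲ))`. -/
def SDyadic (j : ℕ) : ℝ :=
  (2 : ℝ)⁻¹ ^ j * h2 α ((2 : ℝ)⁻¹ ^ j)
    * ((2 : ℝ)⁻¹ ^ j * h2 α ((2 : ℝ)⁻¹ ^ j) + h3Bar α β ((2 : ℝ)⁻¹ ^ j))

theorem det_ATildeDyadic (j : ℕ) : (ATildeDyadic α β j).det = SDyadic α β j := by
  simp [ATildeDyadic, ATilde, SDyadic, Matrix.det_fin_three]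

/-! ### The Littlewood-Paley operators -/

/-- The functions `ς_j` built from `ς₀`. -/
def sigmaFn (ς : (Fin 3 → ℝ) → ℂ) : ℕ → (Fin 3 → ℝ) → ℂ
  | 0, y => ς y
  | j + 1, y => ς y - ((SDyadic α β (j + 1) / SDyadic α β j : ℝ) : ℂ)
      * ς ((ATildeDyadic α β j)⁻¹ *ᵥ (ATildeDyadic α β (j + 1) *ᵥ y))

/-- The convolution kernel `S_j⁻¹ ς_j(Ã_j⁻¹ y)` of `𝒟_j`. -/
def kernelD (ς : (Fin 3 → ℝ) → ℂ) (j : ℕ) (y : Fin 3 → ℝ) : ℂ :=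
  (((SDyadic α β j)⁻¹ : ℝ) : ℂ) * sigmaFn α β ς j ((ATildeDyadic α β j)⁻¹ *ᵥ y)

end Curve

/-- The convolution operator `f ↦ ∫ f(x · y⁻¹) K(y) dy` on `ℍ¹`. -/
def heisConv (K f : (Fin 3 → ℝ) → ℂ) (x : Fin 3 → ℝ) : ℂ :=
  ∫ y, f (heisMul x (heisInv y)) * K y

/-- The kernel of the adjoint operator (see `integral_heisConv_mul_conj` below). -/
def adjKernel (K : (Fin 3 → ℝ) → ℂ) (y : Fin 3 → ℝ) : ℂ := conj (K (heisInv y))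

/-- `𝒟_j f`. -/
def opD (α β : ℝ → ℝ) (ς : (Fin 3 → ℝ) → ℂ) (j : ℕ) (f : (Fin 3 → ℝ) → ℂ) :
    (Fin 3 → ℝ) → ℂ :=
  heisConv (kernelD α β ς j) f

/-- `𝒟_j^* f`. -/
def opDAdj (α β : ℝ → ℝ) (ς : (Fin 3 → ℝ) → ℂ) (j : ℕ) (f : (Fin 3 → ℝ) → ℂ) :
    (Fin 3 → ℝ) → ℂ :=
  heisConv (adjKernel (kernelD α β ς j)) f

/-- `(∑_j |F_j(x)|²)^{1/2}`, with values in `[0, ∞]`. -/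
def squareFn (F : ℕ → (Fin 3 → ℝ) → ℂ) (x : Fin 3 → ℝ) : ℝ≥0∞ :=
  (∑' j, ‖F j x‖ₑ ^ 2) ^ (1 / 2 : ℝ)

/-! ### `heisConv (adjKernel K)` is the adjoint of `heisConv K` -/

theorem measurePreserving_heisInv : MeasurePreserving heisInv volume volume := by
  have h : heisInv = fun x => -x := by
    ext x i; fin_cases i <;> simp [heisInv]
  rw [h]
  exact Measure.measurePreserving_neg _

theorem measurable_heisMul : Measurable (fun q : (Fin 3 → ℝ) × (Fin 3 → ℝ) => heisMul q.1 q.2) := by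
  refine measurable_pi_lambda _ fun i => ?_
  fin_cases i <;> simp [heisMul] <;> fun_prop

theorem measurePreserving_heisMul_right (y : Fin 3 → ℝ) :
    MeasurePreserving (fun x => heisMul x y) volume volume := by
  set M : Matrix (Fin 3) (Fin 3) ℝ := !![1, 0, 0; 0, 1, 0; y 1 / 2, -(y 0) / 2, 1] with hM
  have hdet : M.det = 1 := by simp [hM, Matrix.det_fin_three]
  have h1 : MeasurePreserving (Matrix.toLin' M) volume volume := by
    refine ⟨(Matrix.toLin' M).continuous_of_finiteDimensional.measurable, ?_⟩
    rw [Real.map_matrix_volume_pi_eq_smul_volume_pi (by simp [hdet]), hdet]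
    simp
  have h2 := (measurePreserving_add_right volume y).comp h1
  convert h2 using 1
  ext x i
  fin_cases i <;>
    simp [heisMul, hM, dotProduct, Fin.sum_univ_three]
  ring

theorem heisMul_heisMul_heisInv (x y : Fin 3 → ℝ) : heisMul (heisMul x y) (heisInv y) = x := by
  ext i; fin_cases i <;> simp [heisMul, heisInv]; ring

theorem heisInv_heisInv (x : Fin 3 → ℝ) : heisInv (heisInv x) = x := by
  ext i; fin_cases i <;> simp [heisInv]

/-- Right translation as a measurable equivalence. -/
def heisRightEquiv (y : Fin 3 → ℝ) : (Fin 3 → ℝ) ≃ᵐ (Fin 3 → ℝ) where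
  toFun x := heisMul x y
  invFun x := heisMul x (heisInv y)
  left_inv x := heisMul_heisMul_heisInv x y
  right_inv x := by
    have h := heisMul_heisMul_heisInv x (heisInv y)
    rwa [heisInv_heisInv] at h
  measurable_toFun := (measurePreserving_heisMul_right y).measurable
  measurable_invFun := (measurePreserving_heisMul_right (heisInv y)).measurable

/-- Inversion as a measurable equivalence. -/
def heisInvEquiv : (Fin 3 → ℝ) ≃ᵐ (Fin 3 → ℝ) where
  toFun := heisInv
  invFun := heisInv
  left_inv := heisInv_heisInv
  right_inv := heisInv_heisInv
  measurable_toFun := measurePreserving_heisInv.measurable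
  measurable_invFun := measurePreserving_heisInv.measurable

theorem measurePreserving_heisMul_skew :
    MeasurePreserving (fun q : (Fin 3 → ℝ) × (Fin 3 → ℝ) => (heisMul q.1 q.2, q.2))
      (volume.prod volume) (volume.prod volume) := by
  have h := (MeasurePreserving.id (volume : Measure (Fin 3 → ℝ))).skew_product
    (μc := (volume : Measure (Fin 3 → ℝ))) (μd := (volume : Measure (Fin 3 → ℝ)))
    (g := fun y x => heisMul x y) (measurable_heisMul.comp measurable_swap)
    (ae_of_all _ fun y => (measurePreserving_heisMul_right y).map_eq)
  exact Measure.measurePreserving_swap.comp (h.comp Measure.measurePreserving_swap)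

theorem integral_norm_mul_conj_le {p q : ℝ≥0∞} [hpq : ENNReal.HolderConjugate p q]
    {f g : (Fin 3 → ℝ) → ℂ} (hf : MemLp f p) (hg : MemLp g q) (y : Fin 3 → ℝ) :
    ∫ x, ‖f x * conj (g (heisMul x y))‖ ≤ (eLpNorm f p).toReal * (eLpNorm g q).toReal := by
  have hcg : MemLp (fun x => conj (g x)) q := hg.star
  have hgy : MemLp (fun x => conj (g (heisMul x y))) q :=
    hcg.comp_measurePreserving (measurePreserving_heisMul_right y)
  have e1 : ∫ x, ‖f x * conj (g (heisMul x y))‖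
      = (eLpNorm (fun x => f x * conj (g (heisMul x y))) 1).toReal := by
    rw [eLpNorm_one_eq_lintegral_enorm]
    exact integral_norm_eq_lintegral_enorm (hf.1.mul hgy.1)
  have e2 : eLpNorm (fun x => conj (g (heisMul x y))) q = eLpNorm g q := by
    rw [show (fun x => conj (g (heisMul x y)))
      = (fun x => conj (g x)) ∘ fun x => heisMul x y from rfl,
      eLpNorm_comp_measurePreserving hcg.1 (measurePreserving_heisMul_right y)]
    exact eLpNorm_congr_norm_ae (ae_of_all _ fun x => by simp)
  have e3 := eLpNorm_smul_le_mul_eLpNorm (p := p) (q := q) (r := 1) hgy.1 hf.1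
  rw [e1, ← ENNReal.toReal_mul, ← e2]
  exact ENNReal.toReal_mono (ENNReal.mul_ne_top hf.2.ne hgy.2.ne) e3

/-- The duality `⟨K-convolution of f, g⟩ = ⟨f, adjKernel K-convolution of g⟩` for `f ∈ L^p`,
`g ∈ L^q`, `1/p + 1/q = 1`. -/
theorem integral_heisConv_mul_conj {K : (Fin 3 → ℝ) → ℂ} (hK : Integrable K)
    {p q : ℝ≥0∞} [hpq : ENNReal.HolderConjugate p q] {f g : (Fin 3 → ℝ) → ℂ}
    (hf : MemLp f p) (hg : MemLp g q) :
    ∫ x, heisConv K f x * conj (g x) = ∫ x, f x * conj (heisConv (adjKernel K) g x) := by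
  have hcg : MemLp (fun x => conj (g x)) q := hg.star
  have hgy : ∀ y, MemLp (fun x => conj (g (heisMul x y))) q := fun y =>
    hcg.comp_measurePreserving (measurePreserving_heisMul_right y)
  -- integrability on the product
  have hmeas : AEStronglyMeasurable (fun w : (Fin 3 → ℝ) × (Fin 3 → ℝ) =>
      f w.1 * K w.2 * conj (g (heisMul w.1 w.2))) (volume.prod volume) := by
    refine (hf.1.comp_fst.mul hK.1.comp_snd).mul ?_
    exact (hcg.1.comp_fst (ν := volume)).comp_measurePreserving measurePreserving_heisMul_skew
  have hG : Integrable (fun w : (Fin 3 → ℝ) × (Fin 3 → ℝ) =>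
      f w.1 * K w.2 * conj (g (heisMul w.1 w.2))) (volume.prod volume) := by
    rw [integrable_prod_iff' hmeas]
    have hint : ∀ y, Integrable (fun x => f x * conj (g (heisMul x y))) := fun y =>
      hf.integrable_mul (hgy y)
    refine ⟨ae_of_all _ fun y => ?_, ?_⟩
    · have := (hint y).const_mul (K y)
      refine this.congr (ae_of_all _ fun x => ?_)
      simp only; ring
    · have hmn := hmeas.norm.prod_swap.integral_prod_right'
      refine Integrable.mono'
        (hK.norm.mul_const ((eLpNorm f p).toReal * (eLpNorm g q).toReal)) hmn
        (ae_of_all _ fun y => ?_)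
      have h1 : ∫ x, ‖f x * K y * conj (g (heisMul x y))‖
          = ‖K y‖ * ∫ x, ‖f x * conj (g (heisMul x y))‖ := by
        rw [← integral_const_mul]
        congr 1; ext x; simp only [norm_mul]; ring
      have h2 := integral_norm_mul_conj_le hf hg y
      change ‖∫ x, ‖f x * K y * conj (g (heisMul x y))‖‖ ≤ _
      rw [Real.norm_of_nonneg (integral_nonneg fun x => norm_nonneg _), h1]
      exact mul_le_mul_of_nonneg_left h2 (norm_nonneg _)
  have hF : Integrable (fun w : (Fin 3 → ℝ) × (Fin 3 → ℝ) =>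
      f (heisMul w.1 (heisInv w.2)) * K w.2 * conj (g w.1)) (volume.prod volume) := by
    have hJ : MeasurePreserving
        (fun w : (Fin 3 → ℝ) × (Fin 3 → ℝ) => (heisMul w.1 (heisInv w.2), w.2))
        (volume.prod volume) (volume.prod volume) := by
      have hi := (MeasurePreserving.id (volume : Measure (Fin 3 → ℝ))).prod
        measurePreserving_heisInv
      have h := hi.comp (measurePreserving_heisMul_skew.comp hi)
      convert h using 1
      ext w i <;> simp [heisInv_heisInv]
    have h := hJ.integrable_comp_of_integrable hG
    refine h.congr (ae_of_all _ fun w => ?_)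
    have e : heisMul (heisMul w.1 (heisInv w.2)) w.2 = w.1 := by
      have h' := heisMul_heisMul_heisInv w.1 (heisInv w.2)
      rwa [heisInv_heisInv] at h'
    simp [Function.comp, e]
  calc ∫ x, heisConv K f x * conj (g x)
      = ∫ x, ∫ y, f (heisMul x (heisInv y)) * K y * conj (g x) := by
        congr 1; ext x; rw [heisConv, ← integral_mul_const]
    _ = ∫ y, ∫ x, f (heisMul x (heisInv y)) * K y * conj (g x) := integral_integral_swap hF
    _ = ∫ y, ∫ x, f x * K y * conj (g (heisMul x y)) := by
        congr 1; ext y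
        rw [← (show MeasurePreserving (heisRightEquiv y) volume volume from
          measurePreserving_heisMul_right y).integral_comp']
        congr 1; ext x
        simp [heisRightEquiv, heisMul_heisMul_heisInv]
    _ = ∫ x, ∫ y, f x * K y * conj (g (heisMul x y)) := (integral_integral_swap hG).symm
    _ = ∫ x, f x * conj (heisConv (adjKernel K) g x) := by
        congr 1; ext x
        rw [heisConv, ← integral_conj, ← integral_const_mul,
          ← (show MeasurePreserving heisInvEquiv volume volume from
            measurePreserving_heisInv).integral_comp']
        congr 1; ext y
        simp [heisInvEquiv, adjKernel]
        ring

end HeisenbergLP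

end

/-!
The kernel of `𝒟_{j+1}` telescopes: it is `φ_{j+1} - φ_j`, where `φ_j` (`bump`) is `ς` rescaled by
the matrix `Ã(2⁻ʲ)` and normalized in `L¹` (`kernelD_succ`). The kernels of the adjoint operators have
the same form, with `ς` replaced by `u ↦ conj (ς (-u))` (`adjKernel_kernelD`). It is therefore enough
to bound the first square function, for every Lipschitz function `ς` supported in the unit cube; the
mean of `ς` plays no role, since the `φ_j` all have the same one.

*Geometry.* The coordinates given by `Ã(t)` turn the Heisenberg product into the same product with
structure constant `κ(t) ∈ [0, 1]` (`heisMul_mulVec`), so that `N_t(x) = |Ã(t)⁻¹x|` (`scaleNorm`)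
behaves like a quasi-norm, uniformly in `t`. The transition matrix `Ã(t)⁻¹Ã(s)`, `s ≤ t`, is lower
triangular with diagonal `O((s/t)^c)`, but its other entries are only bounded. A product of three
such matrices is small in all entries, because strictly lower triangular `3 × 3` matrices are
nilpotent of order three; this gives `N_t ≤ 10 (s/t)^ε N_s` (`exists_scaleNorm_le`). Together with the
`L¹` modulus of continuity of a bump (`exists_bump_modulus`) it carries all further estimates.

*The case `p = 2`.* For `k > j` the kernel of `𝒟_k` has mean zero and lives at scale `2⁻ᵏ`, at which
the kernel of `𝒟_j^*` is almost constant. So `‖𝒟_k 𝒟_j^*‖ = O(2^{-ε(k-j)})` on `L²`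
(`exists_almost_orthogonal`). Expanding `‖∑_j 𝒟_j^* F_j‖²` shows that the adjoint of the
vector-valued operator `T f = (𝒟_j f)_j` is bounded from `L²(ℓ²)` to `L²`, hence `T` is bounded.

*The case `1 < p < 2`.* The kernel of `T` satisfies Hörmander's condition at every scale
(`exists_hormander`), and so does that of `T*`. The Calderón–Zygmund argument is complicated by the
fact that the balls of consecutive dyadic scales may have very different volumes. It uses instead
scales `τ_k`, `k ∈ ℤ`, with `det Ã(τ_k) = 2^k` (`exists_normLadder`). Volumes then double from one
step to the next, but a ball enlarged by a constant factor need not lie in a ball a bounded number of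
steps further. A stopping-time argument avoids such inclusions: the Vitali covering lemma selects
disjoint balls among the largest balls with average above a given height, each point of the bad set
is attached to a selected ball whose index is not smaller than its own stopping index, and the
enlarged ball is cut into boundedly many small pieces, each of which lies in a ball one step up
around any of its points, where the average is below the height (`exists_pieces`). This gives weak
type `(1,1)` for `T` and `T*` (`weak_type`); interpolation with `L²` does the rest.

*The case `p > 2`* follows from the bound for `T*` on the dual exponent
(`eLpNorm_analysis_le_of_synthesis`). All bounds are proved for finitely many `j`, uniformly in their
number, and monotone convergence yields the square function (`exists_eLpNorm_squareFn_le`).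
-/


noncomputable section

namespace HeisenbergLP

/-! ### The functions attached to the curve -/

section CurveFacts

variable {α β : ℝ → ℝ}

namespace IsAdmissibleCurve

theorem fst_zero (hΓ : IsAdmissibleCurve α β) : α 0 = 0 := by
  have := hΓ.odd_fst 0
  simp only [neg_zero] at this
  linarith

theorem hasDerivAt_fst (hΓ : IsAdmissibleCurve α β) {t : ℝ} (ht : 0 < t) :
    HasDerivAt α (deriv α t) t :=
  ((hΓ.contDiffOn_fst.contDiffAt (Ioi_mem_nhds ht)).differentiableAt (by norm_num)).hasDerivAt

theorem hasDerivAt_deriv_fst (hΓ : IsAdmissibleCurve α β) {t : ℝ} (ht : 0 < t) :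
    HasDerivAt (deriv α) (iteratedDeriv 2 α t) t := by
  have h : ContDiffOn ℝ 2 (deriv α) (Ioi 0) :=
    ((contDiffOn_succ_iff_deriv_of_isOpen (n := 2) isOpen_Ioi).1 hΓ.contDiffOn_fst).2.2
  have := ((h.contDiffAt (Ioi_mem_nhds ht)).differentiableAt (by norm_num)).hasDerivAt
  simpa [iteratedDeriv_succ, iteratedDeriv_one] using this

theorem hasDerivAt_h2 (hΓ : IsAdmissibleCurve α β) {t : ℝ} (ht : 0 < t) :
    HasDerivAt (h2 α) (t * iteratedDeriv 2 α t) t := by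
  have := ((hasDerivAt_id t).mul (hΓ.hasDerivAt_deriv_fst ht)).sub (hΓ.hasDerivAt_fst ht)
  exact HasDerivAt.congr_deriv (f := h2 α) this (by simp)

/-- Positivity of `h₂` is strict convexity of `α` on `[0, ∞)` together with `α(0) = 0`. -/
theorem h2_pos (hΓ : IsAdmissibleCurve α β) {t : ℝ} (ht : 0 < t) : 0 < h2 α t := by
  have hc : StrictConvexOn ℝ (Ici 0) α := by
    refine strictConvexOn_of_deriv2_pos (convex_Ici 0) hΓ.continuous_fst.continuousOn ?_
    intro x hx
    rw [interior_Ici] at hx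
    rw [← iteratedDeriv_eq_iterate]
    exact hΓ.D2_pos x hx
  have := hc.slope_lt_deriv (mem_Ici.2 le_rfl) (mem_Ici.2 ht.le) ht
    (hΓ.hasDerivAt_fst ht).differentiableAt
  rw [slope_def_field, hΓ.fst_zero, div_lt_iff₀ (by linarith)] at this
  unfold h2
  linarith

theorem h2_zero (hΓ : IsAdmissibleCurve α β) : h2 α 0 = 0 := by
  simp [h2, hΓ.fst_zero]

theorem monotoneOn_h2 (hΓ : IsAdmissibleCurve α β) : MonotoneOn (h2 α) (Ici 0) := by
  have hpos : MonotoneOn (h2 α) (Ioi 0) := by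
    refine monotoneOn_of_deriv_nonneg (convex_Ioi 0)
      (fun t ht => (hΓ.hasDerivAt_h2 ht).continuousAt.continuousWithinAt)
      (fun t ht => (hΓ.hasDerivAt_h2 (interior_subset ht)).differentiableAt.differentiableWithinAt)
      fun t ht => ?_
    have ht' : 0 < t := interior_subset ht
    rw [(hΓ.hasDerivAt_h2 ht').deriv]
    exact (mul_pos ht' (hΓ.D2_pos t ht')).le
  intro s hs t ht hst
  rcases (mem_Ici.1 hs).eq_or_lt with rfl | hs'
  · rcases (mem_Ici.1 ht).eq_or_lt with rfl | ht'
    · exact le_rfl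
    · rw [hΓ.h2_zero]; exact (hΓ.h2_pos ht').le
  · exact hpos hs' (lt_of_lt_of_le hs' hst) hst

theorem intervalIntegrable_h2 (hΓ : IsAdmissibleCurve α β) {t : ℝ} (ht : 0 ≤ t) :
    IntervalIntegrable (h2 α) volume 0 t := by
  refine MonotoneOn.intervalIntegrable (hΓ.monotoneOn_h2.mono ?_)
  rw [uIcc_of_le ht]
  exact fun x hx => hx.1

theorem hasDerivAt_betaBar (hΓ : IsAdmissibleCurve α β) {t : ℝ} (ht : 0 < t) :
    HasDerivAt (betaBar α β) (deriv β t - 1 / 2 * h2 α t) t := by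
  have hc : ContinuousOn (h2 α) (Ioi 0) := fun t ht =>
    (hΓ.hasDerivAt_h2 ht).continuousAt.continuousWithinAt
  have h1 := intervalIntegral.integral_hasDerivAt_right (hΓ.intervalIntegrable_h2 ht.le)
    (hc.stronglyMeasurableAtFilter isOpen_Ioi t ht) (hΓ.hasDerivAt_h2 ht).continuousAt
  exact (((hΓ.contDiffOn_snd.contDiffAt (Ioi_mem_nhds ht)).differentiableAt
    (by norm_num)).hasDerivAt).sub (h1.const_mul (1 / 2))

theorem hasDerivAt_deriv_betaBar (hΓ : IsAdmissibleCurve α β) {t : ℝ} (ht : 0 < t) :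
    HasDerivAt (deriv (betaBar α β)) (iteratedDeriv 2 (betaBar α β) t) t := by
  have h : ContDiffOn ℝ 2 (deriv β) (Ioi 0) :=
    ((contDiffOn_succ_iff_deriv_of_isOpen (n := 2) isOpen_Ioi).1 hΓ.contDiffOn_snd).2.2
  have h1 := ((h.contDiffAt (Ioi_mem_nhds ht)).differentiableAt (by norm_num)).hasDerivAt
  have h2' := h1.sub ((hΓ.hasDerivAt_h2 ht).const_mul (1 / 2))
  have h3 : deriv (betaBar α β) =ᶠ[nhds t] fun s => deriv β s - 1 / 2 * h2 α s := by
    filter_upwards [Ioi_mem_nhds ht] with s hs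
    exact (hΓ.hasDerivAt_betaBar hs).deriv
  have h4 := (h2'.congr_of_eventuallyEq h3).differentiableAt.hasDerivAt
  simpa [iteratedDeriv_succ, iteratedDeriv_one] using h4

theorem hasDerivAt_hBetaBar (hΓ : IsAdmissibleCurve α β) {t : ℝ} (ht : 0 < t) :
    HasDerivAt (hBetaBar α β) (t * iteratedDeriv 2 (betaBar α β) t) t := by
  have h0 := (hΓ.hasDerivAt_betaBar ht).differentiableAt.hasDerivAt
  have := ((hasDerivAt_id t).mul (hΓ.hasDerivAt_deriv_betaBar ht)).sub h0
  exact HasDerivAt.congr_deriv (f := hBetaBar α β) this (by simp)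

/-- The expansion of the determinant defining `h̄₃`. It makes `h̄₃` the numerator of the derivative
of `h̄_β / h₂`. -/
theorem h3Bar_mul (hΓ : IsAdmissibleCurve α β) {t : ℝ} (ht : 0 < t) :
    h3Bar α β t * iteratedDeriv 2 α t
      = iteratedDeriv 2 (betaBar α β) t * h2 α t - hBetaBar α β t * iteratedDeriv 2 α t := by
  have h0 : D2 α t ≠ 0 := (hΓ.D2_pos t ht).ne'
  have h1 : h3Bar α β t * iteratedDeriv 2 α t = N3Bar α β t := div_mul_cancel₀ _ h0
  rw [h1]
  simp [N3Bar, Matrix.det_fin_three, h2, hBetaBar]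
  ring

theorem h3Bar_pos (hΓ : IsAdmissibleCurve α β) {t : ℝ} (ht : 0 < t) : 0 < h3Bar α β t := by
  obtain ⟨c, hc, h⟩ := hΓ.h3Bar_ge
  refine lt_of_lt_of_le (mul_pos hc ?_) (h t ht)
  exact intervalIntegral.intervalIntegral_pos_of_pos_on (hΓ.intervalIntegrable_h2 ht.le)
    (fun x hx => hΓ.h2_pos hx.1) ht

theorem deriv_h3Bar_pos (hΓ : IsAdmissibleCurve α β) {t : ℝ} (ht : 0 < t) :
    0 < deriv (h3Bar α β) t := by
  obtain ⟨c, hc, h⟩ := hΓ.deriv_h3Bar_ge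
  exact lt_of_lt_of_le (mul_pos hc (div_pos (hΓ.h3Bar_pos ht) ht)) (h t ht)

/-- The function `h̄₃` is differentiable because `deriv` vanishes where it is not. -/
theorem differentiableAt_h3Bar (hΓ : IsAdmissibleCurve α β) {t : ℝ} (ht : 0 < t) :
    DifferentiableAt ℝ (h3Bar α β) t :=
  differentiableAt_of_deriv_ne_zero (hΓ.deriv_h3Bar_pos ht).ne'

end IsAdmissibleCurve

/-- A positive function with `f' ≥ c f / t` grows at least like `t ^ c`. -/
theorem div_le_rpow_of_deriv_ge {f : ℝ → ℝ} {c : ℝ} (hpos : ∀ t, 0 < t → 0 < f t)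
    (hd : ∀ t, 0 < t → DifferentiableAt ℝ f t)
    (h : ∀ t, 0 < t → c * (f t / t) ≤ deriv f t) {s t : ℝ} (hs : 0 < s) (hst : s ≤ t) :
    f s / f t ≤ (s / t) ^ c := by
  have ht : 0 < t := hs.trans_le hst
  have hder : ∀ u, 0 < u →
      HasDerivAt (fun u => f u * u ^ (-c))
        (deriv f u * u ^ (-c) + f u * (-c * u ^ (-c - 1))) u := by
    intro u hu
    exact (hd u hu).hasDerivAt.mul (Real.hasDerivAt_rpow_const (Or.inl hu.ne'))
  have hm : MonotoneOn (fun u => f u * u ^ (-c)) (Ioi 0) := by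
    refine monotoneOn_of_deriv_nonneg (convex_Ioi 0)
      (fun t ht => (hder t ht).continuousAt.continuousWithinAt)
      (fun t ht => (hder t (interior_subset ht)).differentiableAt.differentiableWithinAt)
      fun u hu => ?_
    have hu' : 0 < u := interior_subset hu
    rw [(hder u hu').deriv, Real.rpow_sub_one hu'.ne']
    have h1 := mul_le_mul_of_nonneg_right (h u hu') (Real.rpow_pos_of_pos hu' (-c)).le
    have e : f u * (-c * (u ^ (-c) / u)) = -(c * (f u / u) * u ^ (-c)) := by ring
    rw [e]
    linarith
  have h1 : f s * s ^ (-c) ≤ f t * t ^ (-c) := hm hs ht hst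
  rw [Real.rpow_neg hs.le, Real.rpow_neg ht.le, ← div_eq_mul_inv, ← div_eq_mul_inv] at h1
  have hsc := Real.rpow_pos_of_pos hs c
  have htc := Real.rpow_pos_of_pos ht c
  rw [Real.div_rpow hs.le ht.le, div_le_div_iff₀ (hpos t ht) htc]
  rw [div_le_div_iff₀ hsc htc] at h1
  linarith

namespace IsAdmissibleCurve

/-- A common growth exponent, at most `1`, for `t`, `h₂` and `t h₂ + h̄₃`. -/
theorem exists_growth (hΓ : IsAdmissibleCurve α β) :
    ∃ c : ℝ, 0 < c ∧ ∀ s t : ℝ, 0 < s → s ≤ t → s / t ≤ (s / t) ^ c ∧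
      h2 α s / h2 α t ≤ (s / t) ^ c ∧
      (s * h2 α s + h3Bar α β s) / (t * h2 α t + h3Bar α β t) ≤ (s / t) ^ c := by
  obtain ⟨c₁, hc₁, h₁⟩ := hΓ.deriv_h2_ge
  obtain ⟨c₂, hc₂, h₂⟩ := hΓ.deriv_h3Bar_ge
  refine ⟨min 1 (min c₁ c₂), by positivity, fun s t hs hst => ?_⟩
  have ht : 0 < t := hs.trans_le hst
  have hq0 : 0 < s / t := by positivity
  have hq1 : s / t ≤ 1 := (div_le_one ht).2 hst
  have e1 := (div_le_rpow_of_deriv_ge (fun u hu => hΓ.h2_pos hu)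
    (fun u hu => (hΓ.hasDerivAt_h2 hu).differentiableAt) h₁ hs hst).trans
    (Real.rpow_le_rpow_of_exponent_ge hq0 hq1
      ((min_le_right 1 (min c₁ c₂)).trans (min_le_left _ _)))
  have e2 := (div_le_rpow_of_deriv_ge (fun u hu => hΓ.h3Bar_pos hu)
    (fun u hu => hΓ.differentiableAt_h3Bar hu) h₂ hs hst).trans
    (Real.rpow_le_rpow_of_exponent_ge hq0 hq1
      ((min_le_right 1 (min c₁ c₂)).trans (min_le_right _ _)))
  have e0 : s / t ≤ (s / t) ^ (min 1 (min c₁ c₂)) := by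
    conv_lhs => rw [← Real.rpow_one (s / t)]
    exact Real.rpow_le_rpow_of_exponent_ge hq0 hq1 (min_le_left _ _)
  refine ⟨e0, e1, ?_⟩
  have p1 := hΓ.h2_pos ht
  have p1s := hΓ.h2_pos hs
  have p2 := hΓ.h3Bar_pos ht
  rw [div_le_iff₀ (by positivity)]
  rw [div_le_iff₀ p1] at e1
  rw [div_le_iff₀ p2] at e2
  have := mul_le_mul hst e1 p1s.le ht.le
  nlinarith

theorem hasDerivAt_fst_div (hΓ : IsAdmissibleCurve α β) {t : ℝ} (ht : 0 < t) :
    HasDerivAt (fun u => α u / u) (h2 α t / t ^ 2) t := by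
  have := (hΓ.hasDerivAt_fst ht).div (hasDerivAt_id t) ht.ne'
  exact HasDerivAt.congr_deriv (f := fun u => α u / u) this (by simp [h2, mul_comm])

theorem hasDerivAt_betaBar_div (hΓ : IsAdmissibleCurve α β) {t : ℝ} (ht : 0 < t) :
    HasDerivAt (fun u => betaBar α β u / u) (hBetaBar α β t / t ^ 2) t := by
  have := (hΓ.hasDerivAt_betaBar ht).differentiableAt.hasDerivAt.div (hasDerivAt_id t) ht.ne'
  exact HasDerivAt.congr_deriv (f := fun u => betaBar α β u / u) this
    (by simp [hBetaBar, mul_comm])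

theorem hasDerivAt_hBetaBar_div_h2 (hΓ : IsAdmissibleCurve α β) {t : ℝ} (ht : 0 < t) :
    HasDerivAt (fun u => hBetaBar α β u / h2 α u)
      (t * iteratedDeriv 2 α t * h3Bar α β t / h2 α t ^ 2) t := by
  have := (hΓ.hasDerivAt_hBetaBar ht).div (hΓ.hasDerivAt_h2 ht) (hΓ.h2_pos ht).ne'
  refine HasDerivAt.congr_deriv (f := fun u => hBetaBar α β u / h2 α u) this ?_
  congr 1
  linear_combination -t * hΓ.h3Bar_mul ht

theorem h3Bar_mono (hΓ : IsAdmissibleCurve α β) {s t : ℝ} (hs : 0 < s) (hst : s ≤ t) :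
    h3Bar α β s ≤ h3Bar α β t := by
  refine monotoneOn_of_deriv_nonneg (convex_Ioi 0)
    (fun t ht => (hΓ.differentiableAt_h3Bar ht).continuousAt.continuousWithinAt)
    (fun t ht => (hΓ.differentiableAt_h3Bar (interior_subset ht)).differentiableWithinAt)
    (fun u hu => ?_) hs (hs.trans_le hst) hst
  exact (hΓ.deriv_h3Bar_pos (interior_subset hu : (0:ℝ) < u)).le

end IsAdmissibleCurve

/-- If `0 ≤ f' ≤ g'` on `[s, t]` then the increments of `f` are between `0` and those of `g`. -/
theorem increment_bounds {f g f' g' : ℝ → ℝ} {s t : ℝ} (hst : s ≤ t)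
    (hf : ∀ u ∈ Icc s t, HasDerivAt f (f' u) u) (hg : ∀ u ∈ Icc s t, HasDerivAt g (g' u) u)
    (h0 : ∀ u ∈ Icc s t, 0 ≤ f' u) (h1 : ∀ u ∈ Icc s t, f' u ≤ g' u) :
    0 ≤ f t - f s ∧ f t - f s ≤ g t - g s := by
  have key : ∀ {k k' : ℝ → ℝ}, (∀ u ∈ Icc s t, HasDerivAt k (k' u) u) →
      (∀ u ∈ Icc s t, 0 ≤ k' u) → k s ≤ k t := by
    intro k k' hk hk0
    refine monotoneOn_of_deriv_nonneg (convex_Icc s t)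
      (fun u hu => (hk u hu).continuousAt.continuousWithinAt)
      (fun u hu => (hk u (interior_subset hu)).differentiableAt.differentiableWithinAt)
      (fun u hu => ?_) (left_mem_Icc.2 hst) (right_mem_Icc.2 hst) hst
    rw [(hk u (interior_subset hu)).deriv]
    exact hk0 u (interior_subset hu)
  have a := key hf h0
  have b := key (fun u hu => (hg u hu).sub (hf u hu)) fun u hu => sub_nonneg.2 (h1 u hu)
  simp only [Pi.sub_apply] at b
  constructor <;> linarith

namespace IsAdmissibleCurve

/-- The increment of `α(t) / t` is the `(2,1)` entry of the transition matrix up to scaling; the bound is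
`h₂(t) / s` times `1 - s / t`. -/
theorem fst_div_increment (hΓ : IsAdmissibleCurve α β) {s t : ℝ} (hs : 0 < s) (hst : s ≤ t) :
    0 ≤ α t / t - α s / s ∧ α t / t - α s / s ≤ h2 α t * (1 / s - 1 / t) := by
  have hpos : ∀ u ∈ Icc s t, 0 < u := fun u hu => hs.trans_le hu.1
  have := increment_bounds (g := fun u => h2 α t * (-u⁻¹)) hst
    (fun u hu => hΓ.hasDerivAt_fst_div (hpos u hu))
    (fun u hu => (hasDerivAt_inv (hpos u hu).ne').neg.const_mul (h2 α t))
    (fun u hu => div_nonneg (hΓ.h2_pos (hpos u hu)).le (sq_nonneg u))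
    (fun u hu => by
      have := hΓ.monotoneOn_h2 (hpos u hu).le (hs.trans_le hst).le hu.2
      have h2 := (hpos u hu)
      rw [neg_neg, div_eq_mul_inv]
      exact mul_le_mul_of_nonneg_right this (by positivity))
  refine ⟨this.1, this.2.trans (le_of_eq ?_)⟩
  simp only [one_div]
  ring

/-- The increment of `h̄_β / h₂`, which determines the `(3,2)` entry of the transition matrix. -/
theorem hBetaBar_div_h2_increment (hΓ : IsAdmissibleCurve α β) {s t : ℝ} (hs : 0 < s)
    (hst : s ≤ t) :
    0 ≤ hBetaBar α β t / h2 α t - hBetaBar α β s / h2 α s ∧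
      hBetaBar α β t / h2 α t - hBetaBar α β s / h2 α s
        ≤ h3Bar α β t * (1 / h2 α s - 1 / h2 α t) := by
  have hpos : ∀ u ∈ Icc s t, 0 < u := fun u hu => hs.trans_le hu.1
  have := increment_bounds (g := fun u => h3Bar α β t * (-(h2 α u)⁻¹)) hst
    (fun u hu => hΓ.hasDerivAt_hBetaBar_div_h2 (hpos u hu))
    (fun u hu => ((hΓ.hasDerivAt_h2 (hpos u hu)).fun_inv
      (hΓ.h2_pos (hpos u hu)).ne').fun_neg.const_mul (h3Bar α β t))
    (fun u hu => by
      have h1 := hpos u hu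
      have h2 : 0 < iteratedDeriv 2 α u := hΓ.D2_pos u h1
      have h3 := hΓ.h3Bar_pos h1
      positivity)
    (fun u hu => by
      have h1 := hpos u hu
      have h2' : 0 < iteratedDeriv 2 α u := hΓ.D2_pos u h1
      have h3 := hΓ.h3Bar_mono h1 hu.2
      have h4 := hΓ.h2_pos h1
      have e : h3Bar α β t * -(-(u * iteratedDeriv 2 α u) / h2 α u ^ 2)
        = u * iteratedDeriv 2 α u * h3Bar α β t / h2 α u ^ 2 := by ring
      rw [e]
      gcongr)
  refine ⟨this.1, this.2.trans (le_of_eq ?_)⟩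
  simp only [one_div]
  ring

/-- The `(3,1)` entry of the transition matrix up to scaling: the increment of `β̄(t) / t`, corrected by
that of `α(t) / t` with the slope `h̄_β(t) / h₂(t)` frozen at the right end point. -/
theorem betaBar_div_increment (hΓ : IsAdmissibleCurve α β) {s t : ℝ} (hs : 0 < s)
    (hst : s ≤ t) :
    0 ≤ hBetaBar α β t / h2 α t * (α t / t - α s / s)
          - (betaBar α β t / t - betaBar α β s / s) ∧
      hBetaBar α β t / h2 α t * (α t / t - α s / s)
          - (betaBar α β t / t - betaBar α β s / s) ≤ h3Bar α β t * (1 / s - 1 / t) := by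
  have hpos : ∀ u ∈ Icc s t, 0 < u := fun u hu => hs.trans_le hu.1
  set r := hBetaBar α β t / h2 α t with hr
  have e : ∀ u ∈ Icc s t, r * (h2 α u / u ^ 2) - hBetaBar α β u / u ^ 2
      = h2 α u * (r - hBetaBar α β u / h2 α u) / u ^ 2 := by
    intro u hu
    have h1 := (hΓ.h2_pos (hpos u hu)).ne'
    field_simp
  have hb : ∀ u ∈ Icc s t, 0 ≤ h2 α u * (r - hBetaBar α β u / h2 α u) ∧
      h2 α u * (r - hBetaBar α β u / h2 α u) ≤ h3Bar α β t := by
    intro u hu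
    have h1 := hΓ.h2_pos (hpos u hu)
    have h2' := hΓ.h2_pos (hs.trans_le hst)
    have h3 := hΓ.h3Bar_pos (hs.trans_le hst)
    obtain ⟨k1, k2⟩ := hΓ.hBetaBar_div_h2_increment (hpos u hu) hu.2
    refine ⟨mul_nonneg h1.le k1, (mul_le_mul_of_nonneg_left k2 h1.le).trans ?_⟩
    have : h2 α u * (h3Bar α β t * (1 / h2 α u - 1 / h2 α t))
        = h3Bar α β t - h3Bar α β t * (h2 α u / h2 α t) := by field_simp
    rw [this]
    have : 0 < h3Bar α β t * (h2 α u / h2 α t) := by positivity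
    linarith
  have := increment_bounds (g := fun u => h3Bar α β t * (-u⁻¹)) hst
    (fun u hu => ((hΓ.hasDerivAt_fst_div (hpos u hu)).const_mul r).sub
      (hΓ.hasDerivAt_betaBar_div (hpos u hu)))
    (fun u hu => (hasDerivAt_inv (hpos u hu).ne').neg.const_mul (h3Bar α β t))
    (fun u hu => by
      rw [e u hu]
      exact div_nonneg (hb u hu).1 (sq_nonneg u))
    (fun u hu => by
      rw [e u hu, neg_neg, div_eq_mul_inv]
      exact mul_le_mul_of_nonneg_right (hb u hu).2 (by positivity))
  simp only [Pi.sub_apply] at this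
  refine ⟨this.1.trans (le_of_eq (by ring)),
    le_trans (le_of_eq (by ring)) (this.2.trans (le_of_eq ?_))⟩
  simp only [one_div]
  ring

end IsAdmissibleCurve

end CurveFacts

/-! ### The group law in rescaled coordinates -/

/-- The Heisenberg product with structure constant `κ`. It is `heisMul` for `κ = 1`, and the matrices
`Ã(t)` conjugate `heisMul` to it, with `κ` between `0` and `1`. -/
def twist (κ : ℝ) (a b : Fin 3 → ℝ) : Fin 3 → ℝ :=
  ![a 0 + b 0, a 1 + b 1, a 2 + b 2 + κ / 2 * (a 0 * b 1 - a 1 * b 0)]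

theorem heisMul_eq_twist (a b : Fin 3 → ℝ) : heisMul a b = twist 1 a b := by
  ext i; fin_cases i <;> simp [heisMul, twist]

theorem heisInv_eq_neg (x : Fin 3 → ℝ) : heisInv x = -x := by
  ext i; fin_cases i <;> simp [heisInv]

theorem twist_neg_twist (κ : ℝ) (a b : Fin 3 → ℝ) : twist κ (-a) (twist κ a b) = b := by
  ext i; fin_cases i <;> simp [twist]
  ring

theorem twist_swap (κ : ℝ) (a b : Fin 3 → ℝ) : twist κ a b = twist (-κ) b a := by
  ext i; fin_cases i <;> simp [twist] <;> ring

theorem norm_twist_sub_right_le {κ : ℝ} (hκ : |κ| ≤ 1) (a b : Fin 3 → ℝ) :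
    ‖twist κ a b - b‖ ≤ ‖a‖ + ‖a‖ * ‖b‖ := by
  have e : twist κ a b - b = a + ![0, 0, κ / 2 * (a 0 * b 1 - a 1 * b 0)] := by
    ext i; fin_cases i <;> simp [twist]
    ring
  rw [e]
  refine (norm_add_le _ _).trans (add_le_add le_rfl ?_)
  have ha := norm_nonneg a
  have hb := norm_nonneg b
  have hab : 0 ≤ ‖a‖ * ‖b‖ := mul_nonneg ha hb
  have h1 : ∀ i j, |a i * b j| ≤ ‖a‖ * ‖b‖ := fun i j => by
    rw [abs_mul]
    exact mul_le_mul (norm_le_pi_norm a i) (norm_le_pi_norm b j) (abs_nonneg _) ha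
  refine (pi_norm_le_iff_of_nonneg hab).2 fun i => ?_
  fin_cases i
  · simpa using hab
  · simpa using hab
  · have h2 : |a 0 * b 1 - a 1 * b 0| ≤ 2 * (‖a‖ * ‖b‖) :=
      (abs_sub _ _).trans (by linarith [h1 0 1, h1 1 0])
    have h3 : |κ / 2| ≤ 1 / 2 := by rw [abs_div, abs_two]; linarith
    have := mul_le_mul h3 h2 (abs_nonneg _) (by norm_num)
    rw [← abs_mul] at this
    simp only [Fin.reduceFinMk, Matrix.cons_val, Real.norm_eq_abs]
    linarith

theorem norm_twist_le {κ : ℝ} (hκ : |κ| ≤ 1) (a b : Fin 3 → ℝ) :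
    ‖twist κ a b‖ ≤ ‖a‖ + ‖b‖ + ‖a‖ * ‖b‖ := by
  have h := norm_add_le (twist κ a b - b) b
  rw [sub_add_cancel] at h
  linarith [norm_twist_sub_right_le hκ a b]

/-- Nearby points stay nearby after translating one of them to the origin. -/
theorem norm_twist_neg_le {κ : ℝ} (hκ : |κ| ≤ 1) (a b : Fin 3 → ℝ) :
    ‖twist κ (-a) b‖ ≤ ‖b - a‖ + ‖a‖ * ‖b - a‖ := by
  have e : twist κ (-a) b = twist κ (b - a) a - a := by
    ext i; fin_cases i <;> simp [twist] <;> ring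
  rw [e, mul_comm ‖a‖]
  exact norm_twist_sub_right_le hκ _ _

theorem measurePreserving_twist_left (κ : ℝ) (y : Fin 3 → ℝ) :
    MeasurePreserving (fun x => twist κ y x) volume volume := by
  set M : Matrix (Fin 3) (Fin 3) ℝ := !![1, 0, 0; 0, 1, 0; -κ / 2 * y 1, κ / 2 * y 0, 1] with hM
  have hdet : M.det = 1 := by simp [hM, Matrix.det_fin_three]
  have h1 : MeasurePreserving (Matrix.toLin' M) volume volume := by
    refine ⟨(Matrix.toLin' M).continuous_of_finiteDimensional.measurable, ?_⟩
    rw [Real.map_matrix_volume_pi_eq_smul_volume_pi (by simp [hdet]), hdet]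
    simp
  have h2 := (measurePreserving_add_right volume y).comp h1
  convert h2 using 1
  ext x i
  fin_cases i <;>
    simp [twist, hM, dotProduct, Fin.sum_univ_three] <;> ring

theorem measurePreserving_heisMul_left (y : Fin 3 → ℝ) :
    MeasurePreserving (fun x => heisMul y x) volume volume := by
  simpa only [heisMul_eq_twist] using measurePreserving_twist_left 1 y

/-! ### The matrices `Ã(t)` -/

section Scale

variable {α β : ℝ → ℝ}

theorem det_ATilde (t : ℝ) : (ATilde α β t).det = t * h2 α t * (t * h2 α t + h3Bar α β t) := by
  simp [ATilde, Matrix.det_fin_three]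

theorem IsAdmissibleCurve.det_pos (hΓ : IsAdmissibleCurve α β) {t : ℝ} (ht : 0 < t) :
    0 < (ATilde α β t).det := by
  have h1 := hΓ.h2_pos ht
  have h2 := hΓ.h3Bar_pos ht
  rw [det_ATilde]
  positivity

theorem IsAdmissibleCurve.inv_mulVec_mulVec (hΓ : IsAdmissibleCurve α β) {t : ℝ} (ht : 0 < t)
    (v : Fin 3 → ℝ) : (ATilde α β t)⁻¹ *ᵥ (ATilde α β t *ᵥ v) = v := by
  rw [Matrix.mulVec_mulVec, Matrix.nonsing_inv_mul _ (hΓ.det_pos ht).ne'.isUnit, Matrix.one_mulVec]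

theorem IsAdmissibleCurve.mulVec_inv_mulVec (hΓ : IsAdmissibleCurve α β) {t : ℝ} (ht : 0 < t)
    (v : Fin 3 → ℝ) : ATilde α β t *ᵥ ((ATilde α β t)⁻¹ *ᵥ v) = v := by
  rw [Matrix.mulVec_mulVec, Matrix.mul_nonsing_inv _ (hΓ.det_pos ht).ne'.isUnit, Matrix.one_mulVec]

/-- The structure constant of the group law in the coordinates given by `Ã(t)`. -/
def kappa (α β : ℝ → ℝ) (t : ℝ) : ℝ := t * h2 α t / (t * h2 α t + h3Bar α β t)

theorem IsAdmissibleCurve.abs_kappa_le (hΓ : IsAdmissibleCurve α β) {t : ℝ} (ht : 0 < t) :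
    |kappa α β t| ≤ 1 := by
  have h1 := hΓ.h2_pos ht
  have h2 := hΓ.h3Bar_pos ht
  rw [kappa, abs_of_nonneg (by positivity), div_le_one (by positivity)]
  linarith

/-- Conjugation by `Ã(t)` preserves the group law up to its structure constant. -/
theorem IsAdmissibleCurve.heisMul_mulVec (hΓ : IsAdmissibleCurve α β) {t : ℝ} (ht : 0 < t)
    (a b : Fin 3 → ℝ) : heisMul (ATilde α β t *ᵥ a) (ATilde α β t *ᵥ b)
      = ATilde α β t *ᵥ twist (kappa α β t) a b := by
  have p1 := hΓ.h2_pos ht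
  have p2 := hΓ.h3Bar_pos ht
  have h3 : t * h2 α t + h3Bar α β t ≠ 0 := by positivity
  ext i; fin_cases i
  · simp [heisMul, ATilde, twist, Matrix.mulVec, dotProduct, Fin.sum_univ_three]; ring
  · simp [heisMul, ATilde, twist, Matrix.mulVec, dotProduct, Fin.sum_univ_three]; ring
  · simp [heisMul, ATilde, twist, Matrix.mulVec, dotProduct, Fin.sum_univ_three, kappa]
    field_simp
    ring

theorem IsAdmissibleCurve.inv_mulVec_heisMul (hΓ : IsAdmissibleCurve α β) {t : ℝ} (ht : 0 < t)
    (x y : Fin 3 → ℝ) : (ATilde α β t)⁻¹ *ᵥ heisMul x y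
      = twist (kappa α β t) ((ATilde α β t)⁻¹ *ᵥ x) ((ATilde α β t)⁻¹ *ᵥ y) := by
  rw [← hΓ.inv_mulVec_mulVec ht (twist _ _ _), ← hΓ.heisMul_mulVec ht, hΓ.mulVec_inv_mulVec ht,
    hΓ.mulVec_inv_mulVec ht]

/-- The size of `x` at scale `t`: the sup norm of its coordinates with respect to `Ã(t)`. -/
def scaleNorm (α β : ℝ → ℝ) (t : ℝ) (x : Fin 3 → ℝ) : ℝ := ‖(ATilde α β t)⁻¹ *ᵥ x‖

theorem scaleNorm_nonneg (t : ℝ) (x : Fin 3 → ℝ) : 0 ≤ scaleNorm α β t x := norm_nonneg _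

theorem scaleNorm_heisInv (t : ℝ) (x : Fin 3 → ℝ) :
    scaleNorm α β t (heisInv x) = scaleNorm α β t x := by
  rw [scaleNorm, heisInv_eq_neg, Matrix.mulVec_neg, norm_neg, scaleNorm]

theorem continuous_scaleNorm (t : ℝ) : Continuous (scaleNorm α β t) :=
  (Continuous.matrix_mulVec continuous_const continuous_id).norm

theorem IsAdmissibleCurve.scaleNorm_heisMul_le (hΓ : IsAdmissibleCurve α β) {t : ℝ} (ht : 0 < t)
    (x y : Fin 3 → ℝ) : scaleNorm α β t (heisMul x y)
      ≤ scaleNorm α β t x + scaleNorm α β t y + scaleNorm α β t x * scaleNorm α β t y := by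
  rw [scaleNorm, hΓ.inv_mulVec_heisMul ht]
  exact norm_twist_le (hΓ.abs_kappa_le ht) _ _

theorem IsAdmissibleCurve.map_inv_mulVec (hΓ : IsAdmissibleCurve α β) {t : ℝ} (ht : 0 < t) :
    Measure.map (fun x => (ATilde α β t)⁻¹ *ᵥ x) volume
      = ENNReal.ofReal (ATilde α β t).det • volume := by
  have hd := hΓ.det_pos ht
  have hd' : ((ATilde α β t)⁻¹).det = ((ATilde α β t).det)⁻¹ := by
    rw [Matrix.det_nonsing_inv, Ring.inverse_eq_inv']
  have := Real.map_matrix_volume_pi_eq_smul_volume_pi (M := (ATilde α β t)⁻¹)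
    (by rw [hd']; exact inv_ne_zero hd.ne')
  rw [hd', inv_inv, abs_of_pos hd] at this
  exact this

theorem measurable_inv_mulVec (t : ℝ) : Measurable fun x => (ATilde α β t)⁻¹ *ᵥ x :=
  (Continuous.matrix_mulVec continuous_const continuous_id).measurable

theorem IsAdmissibleCurve.lintegral_comp_inv_mulVec (hΓ : IsAdmissibleCurve α β) {t : ℝ}
    (ht : 0 < t) {g : (Fin 3 → ℝ) → ℝ≥0∞} (hg : Measurable g) :
    ∫⁻ x, g ((ATilde α β t)⁻¹ *ᵥ x) = ENNReal.ofReal (ATilde α β t).det * ∫⁻ u, g u := by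
  rw [← lintegral_map hg (measurable_inv_mulVec t), hΓ.map_inv_mulVec ht, lintegral_smul_measure,
    smul_eq_mul]

theorem IsAdmissibleCurve.volume_scaleNorm_le (hΓ : IsAdmissibleCurve α β) {t : ℝ} (ht : 0 < t)
    {r : ℝ} (hr : 0 ≤ r) : volume {x | scaleNorm α β t x ≤ r}
      = ENNReal.ofReal ((ATilde α β t).det * (2 * r) ^ 3) := by
  have h : {x | scaleNorm α β t x ≤ r}
      = (fun x => (ATilde α β t)⁻¹ *ᵥ x) ⁻¹' Metric.closedBall 0 r := by
    ext x; simp [scaleNorm]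
  rw [h, ← Measure.map_apply (measurable_inv_mulVec t) measurableSet_closedBall,
    hΓ.map_inv_mulVec ht, Measure.smul_apply, Real.volume_pi_closedBall _ hr, smul_eq_mul,
    ← ENNReal.ofReal_mul (hΓ.det_pos ht).le]
  simp

/-- The transition matrix `Ã(t)⁻¹ Ã(s)` is lower triangular, its diagonal entries decay and its
other entries are bounded by `1`. -/
theorem IsAdmissibleCurve.exists_transition (hΓ : IsAdmissibleCurve α β) :
    ∃ c : ℝ, 0 < c ∧ ∀ s t : ℝ, 0 < s → s ≤ t → ∃ d₁ d₂ d₃ x y z : ℝ,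
      ATilde α β t * !![d₁, 0, 0; x, d₂, 0; y, z, d₃] = ATilde α β s ∧
      |d₁| ≤ (s / t) ^ c ∧ |d₂| ≤ (s / t) ^ c ∧ |d₃| ≤ (s / t) ^ c ∧
      |x| ≤ 1 ∧ |y| ≤ 1 ∧ |z| ≤ 1 := by
  obtain ⟨c, hc, hgrow⟩ := hΓ.exists_growth
  refine ⟨c, hc, fun s t hs hst => ?_⟩
  have ht : 0 < t := hs.trans_le hst
  obtain ⟨g1, g2, g3⟩ := hgrow s t hs hst
  have a1 := hΓ.h2_pos hs
  have a2 := hΓ.h2_pos ht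
  have a3 := hΓ.h3Bar_pos hs
  have a4 := hΓ.h3Bar_pos ht
  have hH : 0 < t * h2 α t + h3Bar α β t := by positivity
  have hHs : 0 < s * h2 α s + h3Bar α β s := by positivity
  obtain ⟨x1, x2⟩ := hΓ.fst_div_increment hs hst
  obtain ⟨z1, z2⟩ := hΓ.hBetaBar_div_h2_increment hs hst
  obtain ⟨y1, y2⟩ := hΓ.betaBar_div_increment hs hst
  have bound : ∀ {m D u h : ℝ}, 0 < m → 0 ≤ D → 0 < h → 0 < u → D ≤ h * (1 / m - 1 / u) →
      m * D ≤ h := by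
    intro m D u h hm hD hh hu hDle
    have h1 := mul_le_mul_of_nonneg_left hDle hm.le
    have h2 : m * (h * (1 / m - 1 / u)) = h - h * (m / u) := by field_simp
    have h3 : 0 < h * (m / u) := by positivity
    linarith
  refine ⟨s / t, h2 α s / h2 α t, (s * h2 α s + h3Bar α β s) / (t * h2 α t + h3Bar α β t),
    -(s * (α t / t - α s / s)) / h2 α t,
    s * (hBetaBar α β t / h2 α t * (α t / t - α s / s)
          - (betaBar α β t / t - betaBar α β s / s)) / (t * h2 α t + h3Bar α β t),
    -(h2 α s * (hBetaBar α β t / h2 α t - hBetaBar α β s / h2 α s))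
      / (t * h2 α t + h3Bar α β t), ?_, ?_, ?_, ?_, ?_, ?_, ?_⟩
  · ext i j
    fin_cases i <;> fin_cases j <;>
      simp [ATilde, Matrix.mul_apply, Fin.sum_univ_three] <;> field_simp <;> ring
  · rwa [abs_of_pos (by positivity)]
  · rwa [abs_of_pos (by positivity)]
  · rwa [abs_of_pos (by positivity)]
  · rw [neg_div, abs_neg, abs_of_nonneg (by positivity), div_le_one a2]
    exact bound hs x1 a2 ht x2
  · rw [abs_of_nonneg (by positivity), div_le_one hH]
    have := bound hs y1 a4 ht y2
    linarith [mul_pos ht a2]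
  · rw [neg_div, abs_neg, abs_of_nonneg (by positivity), div_le_one hH]
    have := bound a1 z1 a4 a2 z2
    linarith [mul_pos ht a2]

/-- The transition estimate in coordinates: each coordinate contracts, up to multiples of the preceding
ones. -/
theorem IsAdmissibleCurve.abs_coord_le (hΓ : IsAdmissibleCurve α β) :
    ∃ c : ℝ, 0 < c ∧ ∀ s t : ℝ, 0 < s → s ≤ t → ∀ w : Fin 3 → ℝ,
      |((ATilde α β t)⁻¹ *ᵥ w) 0| ≤ (s / t) ^ c * |((ATilde α β s)⁻¹ *ᵥ w) 0| ∧
      |((ATilde α β t)⁻¹ *ᵥ w) 1| ≤ |((ATilde α β s)⁻¹ *ᵥ w) 0|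
        + (s / t) ^ c * |((ATilde α β s)⁻¹ *ᵥ w) 1| ∧
      |((ATilde α β t)⁻¹ *ᵥ w) 2| ≤ |((ATilde α β s)⁻¹ *ᵥ w) 0| + |((ATilde α β s)⁻¹ *ᵥ w) 1|
        + (s / t) ^ c * |((ATilde α β s)⁻¹ *ᵥ w) 2| := by
  obtain ⟨c, hc, htrans⟩ := hΓ.exists_transition
  refine ⟨c, hc, fun s t hs hst w => ?_⟩
  have ht : 0 < t := hs.trans_le hst
  obtain ⟨d₁, d₂, d₃, x, y, z, hA, h1, h2, h3, hx, hy, hz⟩ := htrans s t hs hst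
  set v := (ATilde α β s)⁻¹ *ᵥ w with hv
  have hw : w = ATilde α β t *ᵥ (!![d₁, 0, 0; x, d₂, 0; y, z, d₃] *ᵥ v) := by
    rw [Matrix.mulVec_mulVec, hA, hv, hΓ.mulVec_inv_mulVec hs]
  rw [hw, hΓ.inv_mulVec_mulVec ht]
  have e0 : (!![d₁, 0, 0; x, d₂, 0; y, z, d₃] *ᵥ v) 0 = d₁ * v 0 := by
    simp [Matrix.mulVec, dotProduct, Fin.sum_univ_three]
  have e1 : (!![d₁, 0, 0; x, d₂, 0; y, z, d₃] *ᵥ v) 1 = x * v 0 + d₂ * v 1 := by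
    simp [Matrix.mulVec, dotProduct, Fin.sum_univ_three]
  have e2 : (!![d₁, 0, 0; x, d₂, 0; y, z, d₃] *ᵥ v) 2 = y * v 0 + z * v 1 + d₃ * v 2 := by
    simp [Matrix.mulVec, dotProduct, Fin.sum_univ_three]
  have m : ∀ {a b : ℝ} (u : ℝ), |a| ≤ b → |a * u| ≤ b * |u| := fun u h => by
    rw [abs_mul]; exact mul_le_mul_of_nonneg_right h (abs_nonneg u)
  rw [e0, e1, e2]
  refine ⟨m _ h1, ?_, ?_⟩
  · refine (abs_add_le _ _).trans ?_
    have := m (v 0) hx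
    have := m (v 1) h2
    linarith
  · refine (abs_add_le _ _).trans ?_
    have := m (v 0) hy
    have := m (v 1) hz
    have := m (v 2) h3
    have := abs_add_le (y * v 0) (z * v 1)
    linarith

/-- The contraction property of the dilations `Ã(t)`. The interval `[s, t]` is cut into three pieces
of equal ratio: the strictly lower triangular parts of the three transition matrices have vanishing
product, so every term of the product of the transition matrices contains a small diagonal part. -/
theorem IsAdmissibleCurve.exists_scaleNorm_le (hΓ : IsAdmissibleCurve α β) :
    ∃ ε : ℝ, 0 < ε ∧ ∀ s t : ℝ, 0 < s → s ≤ t → ∀ w : Fin 3 → ℝ,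
      scaleNorm α β t w ≤ 10 * (s / t) ^ ε * scaleNorm α β s w := by
  obtain ⟨c, hc, hcoord⟩ := hΓ.abs_coord_le
  refine ⟨c / 3, by positivity, fun s t hs hst w => ?_⟩
  have ht : 0 < t := hs.trans_le hst
  set q := s / t with hq
  have hq0 : 0 < q := by positivity
  have hq1 : q ≤ 1 := (div_le_one ht).2 hst
  set p := q ^ (1 / 3 : ℝ) with hp
  have hp0 : 0 < p := by positivity
  have hp1 : p ≤ 1 := Real.rpow_le_one hq0.le hq1 (by norm_num)
  have hp3 : p * p * p = q := by
    have : p ^ 3 = q := by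
      rw [hp, ← Real.rpow_natCast, ← Real.rpow_mul hq0.le]; norm_num
    rw [← this]; ring
  have hs' : s = t * p * p * p := by
    have : s = t * q := by rw [hq]; field_simp
    rw [this, ← hp3]; ring
  set δ := q ^ (c / 3) with hδ
  have hδp : p ^ c = δ := by
    rw [hp, ← Real.rpow_mul hq0.le, hδ]; congr 1; ring
  have hδ0 : 0 < δ := by positivity
  have hδ1 : δ ≤ 1 := Real.rpow_le_one hq0.le hq1 (by positivity)
  have step : ∀ u, 0 < u → (u * p) / u = p := fun u hu => by field_simp
  have t1 : 0 < t * p := by positivity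
  have t2 : 0 < t * p * p := by positivity
  obtain ⟨a0, a1, a2⟩ := hcoord (t * p) t t1 (mul_le_of_le_one_right ht.le hp1) w
  obtain ⟨b0, b1, b2⟩ := hcoord (t * p * p) (t * p) t2 (mul_le_of_le_one_right t1.le hp1) w
  obtain ⟨c0, c1, c2⟩ := hcoord (t * p * p * p) (t * p * p) (by positivity)
    (mul_le_of_le_one_right t2.le hp1) w
  rw [step _ ht, hδp] at a0 a1 a2
  rw [step _ t1, hδp] at b0 b1 b2
  rw [step _ t2, hδp, ← hs'] at c0 c1 c2
  set M := scaleNorm α β s w with hM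
  have hM0 : 0 ≤ M := scaleNorm_nonneg _ _
  have n : ∀ i, |((ATilde α β s)⁻¹ *ᵥ w) i| ≤ M := fun i =>
    norm_le_pi_norm ((ATilde α β s)⁻¹ *ᵥ w) i
  have hδM : δ * M ≤ M := mul_le_of_le_one_left hM0 hδ1
  have hδM0 : 0 ≤ δ * M := by positivity
  have mono : ∀ {a b : ℝ}, a ≤ b → δ * a ≤ δ * b := fun h => mul_le_mul_of_nonneg_left h hδ0.le
  have shr : ∀ {a : ℝ}, 0 ≤ a → δ * a ≤ a := fun h => mul_le_of_le_one_left h hδ1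
  -- after one step the coordinates are at most `δ M`, `2 M`, `3 M`
  have c0' := c0.trans (mono (n 0))
  have c1' := c1.trans (add_le_add (n 0) ((mono (n 1)).trans hδM))
  have c2' := c2.trans (add_le_add (add_le_add (n 0) (n 1)) ((mono (n 2)).trans hδM))
  -- after two steps they are at most `δ M`, `3 δ M`, `6 M`
  have b0' := b0.trans ((mono c0').trans (shr hδM0))
  have b1' := b1.trans (add_le_add c0' (mono c1'))
  have b2' := b2.trans (add_le_add (add_le_add (c0'.trans hδM) c1')
    ((mono c2').trans (shr (by positivity))))
  -- after three steps they are at most `δ M`, `4 δ M`, `10 δ M`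
  have a0' := a0.trans ((mono b0').trans (shr hδM0))
  have a1' := a1.trans (add_le_add b0' ((mono b1').trans (shr (by positivity))))
  have a2' := a2.trans (add_le_add (add_le_add b0' b1') (mono b2'))
  refine (pi_norm_le_iff_of_nonneg (by positivity)).2 fun i => ?_
  rw [Real.norm_eq_abs]
  fin_cases i
  · exact a0'.trans (by linarith)
  · exact a1'.trans (by linarith)
  · exact a2'.trans (by linarith)

end Scale

/-! ### Ladders of quasi-norms and the Calderón–Zygmund decomposition -/

/-- The left quotient `x⁻¹ · y`. -/
def heisDiff (x y : Fin 3 → ℝ) : Fin 3 → ℝ := heisMul (heisInv x) y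

theorem heisMul_heisDiff_heisDiff (x y z : Fin 3 → ℝ) :
    heisMul (heisDiff x y) (heisDiff y z) = heisDiff x z := by
  ext i; fin_cases i <;> simp [heisDiff, heisMul, heisInv]; ring

theorem heisInv_heisDiff (x y : Fin 3 → ℝ) : heisInv (heisDiff x y) = heisDiff y x := by
  ext i; fin_cases i <;> simp [heisDiff, heisMul, heisInv] ; ring

theorem heisDiff_heisDiff (b z x : Fin 3 → ℝ) :
    heisDiff (heisDiff b z) (heisDiff b x) = heisDiff z x := by
  ext i; fin_cases i <;> simp [heisDiff, heisMul, heisInv]; ring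

theorem heisMul_heisDiff (x y : Fin 3 → ℝ) : heisMul x (heisDiff x y) = y := by
  ext i; fin_cases i <;> simp [heisDiff, heisMul, heisInv]; ring

theorem continuous_heisMul :
    Continuous fun q : (Fin 3 → ℝ) × (Fin 3 → ℝ) => heisMul q.1 q.2 := by
  refine continuous_pi fun i => ?_
  fin_cases i <;> simp [heisMul] <;> fun_prop

theorem continuous_heisInv : Continuous heisInv := by
  have : heisInv = fun x => -x := funext heisInv_eq_neg
  rw [this]; exact continuous_neg

theorem continuous_heisDiff :
    Continuous fun q : (Fin 3 → ℝ) × (Fin 3 → ℝ) => heisDiff q.1 q.2 :=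
  continuous_heisMul.comp ((continuous_heisInv.comp continuous_fst).prodMk continuous_snd)

theorem measurePreserving_heisDiff_left (x : Fin 3 → ℝ) :
    MeasurePreserving (fun y => heisDiff x y) volume volume :=
  measurePreserving_heisMul_left _

theorem measurePreserving_heisDiff_right (y : Fin 3 → ℝ) :
    MeasurePreserving (fun x => heisDiff x y) volume volume :=
  (measurePreserving_heisMul_right y).comp measurePreserving_heisInv

/-- A family of quasi-norms on `ℍ¹`, indexed by `ℤ`, whose unit balls have volumes proportional to
`2 ^ k` and are nested up to the constant `B`; they shrink to the identity as `k → -∞`. The ball of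
radius `1 + 2 B` is covered by `M` sets of diameter at most one in the next quasi-norm. Enlarging a ball by a constant factor need
not give a subset of a ball further up the ladder. -/
structure NormLadder (N : ℤ → (Fin 3 → ℝ) → ℝ) (B : ℝ) (M : ℕ) : Prop where
  one_le : 1 ≤ B
  continuous : ∀ k, Continuous (N k)
  nonneg : ∀ k x, 0 ≤ N k x
  inv : ∀ k x, N k (heisInv x) = N k x
  mul_le : ∀ k x y, N k (heisMul x y) ≤ N k x + N k y + N k x * N k y
  mono : ∀ k l x, k ≤ l → N l x ≤ B * N k x
  volume_le : ∀ k r, 0 ≤ r → volume {x | N k x ≤ r} = ENNReal.ofReal ((2 : ℝ) ^ k * (2 * r) ^ 3)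
  small : ∀ U ∈ nhds (0 : Fin 3 → ℝ), ∃ k, {x | N k x ≤ 1} ⊆ U
  cover : ∀ k, ∃ V : Fin M → Set (Fin 3 → ℝ), {x | N k x ≤ 1 + 2 * B} ⊆ ⋃ i, V i ∧
    ∀ i, ∀ x ∈ V i, ∀ y ∈ V i, N (k + 1) (heisDiff x y) ≤ 1

namespace NormLadder

variable {N : ℤ → (Fin 3 → ℝ) → ℝ} {B : ℝ} {M : ℕ}

/-- The left translate by `x` of the unit ball of `N k`. -/
def gball (N : ℤ → (Fin 3 → ℝ) → ℝ) (k : ℤ) (x : Fin 3 → ℝ) : Set (Fin 3 → ℝ) :=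
  {z | N k (heisDiff x z) ≤ 1}

/-- The common volume of the balls `gball N k x`. -/
def vol (k : ℤ) : ℝ≥0∞ := ENNReal.ofReal ((2 : ℝ) ^ k * 8)

theorem vol_pos (k : ℤ) : 0 < vol k := ENNReal.ofReal_pos.2 (by positivity)

theorem vol_ne_top (k : ℤ) : vol k ≠ ∞ := ENNReal.ofReal_ne_top

theorem vol_succ (k : ℤ) : vol (k + 1) = 2 * vol k := by
  rw [vol, vol, zpow_add_one₀ two_ne_zero, mul_right_comm, mul_comm,
    ENNReal.ofReal_mul (by norm_num)]
  simp

theorem comm (hN : NormLadder N B M) (k : ℤ) (x z : Fin 3 → ℝ) :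
    N k (heisDiff x z) = N k (heisDiff z x) := by
  rw [← hN.inv, heisInv_heisDiff]

theorem triangle (hN : NormLadder N B M) (k : ℤ) (x y z : Fin 3 → ℝ) :
    N k (heisDiff x z) ≤ N k (heisDiff x y) + N k (heisDiff y z)
      + N k (heisDiff x y) * N k (heisDiff y z) := by
  rw [← heisMul_heisDiff_heisDiff x y z]
  exact hN.mul_le k _ _

theorem measurableSet_gball (hN : NormLadder N B M) (k : ℤ) (x : Fin 3 → ℝ) :
    MeasurableSet (gball N k x) :=
  (((hN.continuous k).comp (continuous_heisDiff.comp (Continuous.prodMk_right x))).measurable)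
    measurableSet_Iic

theorem volume_translate_le (hN : NormLadder N B M) (k : ℤ) (x : Fin 3 → ℝ) {r : ℝ} (hr : 0 ≤ r) :
    volume {z | N k (heisDiff x z) ≤ r} = ENNReal.ofReal ((2 : ℝ) ^ k * (2 * r) ^ 3) := by
  rw [← hN.volume_le k r hr]
  exact (measurePreserving_heisDiff_left x).measure_preimage
    ((hN.continuous k).measurable measurableSet_Iic).nullMeasurableSet

theorem volume_gball (hN : NormLadder N B M) (k : ℤ) (x : Fin 3 → ℝ) :
    volume (gball N k x) = vol k := by
  rw [gball, hN.volume_translate_le k x zero_le_one, vol]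
  norm_num

/-- The average of `‖f‖` over the ball of index `k` around `x` exceeds `a`. -/
def Exceeds {E : Type*} [NormedAddCommGroup E] (N : ℤ → (Fin 3 → ℝ) → ℝ) (f : (Fin 3 → ℝ) → E)
    (a : ℝ≥0∞) (k : ℤ) (x : Fin 3 → ℝ) : Prop :=
  a * vol k < ∫⁻ z in gball N k x, ‖f z‖ₑ

variable {E : Type*} [NormedAddCommGroup E]

theorem measurableSet_exceeds (hN : NormLadder N B M) {f : (Fin 3 → ℝ) → E} (hf : Continuous f)
    (a : ℝ≥0∞) (k : ℤ) : MeasurableSet {x | Exceeds N f a k x} := by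
  have hS : MeasurableSet {q : (Fin 3 → ℝ) × (Fin 3 → ℝ) | N k (heisDiff q.1 q.2) ≤ 1} :=
    ((hN.continuous k).comp continuous_heisDiff).measurable measurableSet_Iic
  have hm : Measurable ({q : (Fin 3 → ℝ) × (Fin 3 → ℝ) | N k (heisDiff q.1 q.2) ≤ 1}.indicator
      fun q => ‖f q.2‖ₑ) :=
    (hf.enorm.measurable.comp measurable_snd).indicator hS
  have h1 := hm.lintegral_prod_right' (ν := volume)
  have h2 : (fun x => ∫⁻ z in gball N k x, ‖f z‖ₑ) = fun x => ∫⁻ z,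
      {q : (Fin 3 → ℝ) × (Fin 3 → ℝ) | N k (heisDiff q.1 q.2) ≤ 1}.indicator
      (fun q => ‖f q.2‖ₑ) (x, z) := by
    ext x
    rw [← lintegral_indicator (hN.measurableSet_gball k x)]
    rfl
  rw [← h2] at h1
  exact measurableSet_lt measurable_const h1

/-- A continuous function is bounded by `a` off the set where some average exceeds `a`. -/
theorem enorm_le_of_not_exceeds (hN : NormLadder N B M) {f : (Fin 3 → ℝ) → E} (hf : Continuous f)
    {a : ℝ≥0∞} {x : Fin 3 → ℝ} (h : ∀ k, ¬ Exceeds N f a k x) : ‖f x‖ₑ ≤ a := by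
  by_contra! hlt
  obtain ⟨a', h1, h2⟩ := exists_between hlt
  have hU : {y | a' < ‖f (heisMul x y)‖ₑ} ∈ nhds (0 : Fin 3 → ℝ) := by
    refine (isOpen_lt continuous_const (hf.enorm.comp (continuous_heisMul.comp
      (Continuous.prodMk_right x)))).mem_nhds ?_
    have : heisMul x 0 = x := by
      ext i; fin_cases i <;> simp [heisMul]
    simpa [this] using h2
  obtain ⟨k, hk⟩ := hN.small _ hU
  refine h k ?_
  have h3 : a' * vol k ≤ ∫⁻ z in gball N k x, ‖f z‖ₑ := by
    rw [← hN.volume_gball k x, ← setLIntegral_const]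
    refine setLIntegral_mono hf.enorm.measurable fun z hz => ?_
    have := hk (show heisDiff x z ∈ {y | N k y ≤ 1} from hz)
    simp only [mem_ofPred_eq, heisMul_heisDiff] at this
    exact this.le
  exact lt_of_lt_of_le ((ENNReal.mul_lt_mul_iff_left (vol_pos k).ne' (vol_ne_top k)).2 h1) h3

/-- The pieces chosen by the stopping rule: if no average at a level above `l` around points of `S`
exceeds `a`, then the mean of `‖f‖` over a piece of size comparable to a ball of index `l` is at
most a constant times `a`. -/
theorem lintegral_le_of_not_exceeds (hN : NormLadder N B M) {f : (Fin 3 → ℝ) → E}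
    {a : ℝ≥0∞} {b : Fin 3 → ℝ} {l : ℤ} {S : Set (Fin 3 → ℝ)}
    (hS : S ⊆ {x | N l (heisDiff b x) ≤ 1 + 2 * B}) (h : ∀ x ∈ S, ¬ Exceeds N f a (l + 1) x) :
    ∫⁻ z in S, ‖f z‖ₑ ≤ 2 * M * a * vol l := by
  obtain ⟨V, hV, hVd⟩ := hN.cover l
  have hsub : S ⊆ ⋃ i, (S ∩ {x | heisDiff b x ∈ V i}) := fun x hx => by
    obtain ⟨i, hi⟩ := mem_iUnion.1 (hV (hS hx))
    exact mem_iUnion.2 ⟨i, hx, hi⟩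
  have hpiece : ∀ i, ∫⁻ z in S ∩ {x | heisDiff b x ∈ V i}, ‖f z‖ₑ ≤ a * vol (l + 1) := by
    intro i
    rcases (S ∩ {x | heisDiff b x ∈ V i}).eq_empty_or_nonempty with he | ⟨y, hyS, hyV⟩
    · rw [he]; simp
    · refine (lintegral_mono_set fun z hz => ?_).trans (not_lt.1 (h y hyS))
      have := hVd i _ hyV _ hz.2
      rwa [heisDiff_heisDiff] at this
  calc ∫⁻ z in S, ‖f z‖ₑ ≤ ∫⁻ z in ⋃ i, (S ∩ {x | heisDiff b x ∈ V i}), ‖f z‖ₑ :=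
        lintegral_mono_set hsub
    _ ≤ ∑' i, ∫⁻ z in S ∩ {x | heisDiff b x ∈ V i}, ‖f z‖ₑ := lintegral_iUnion_le _ _
    _ ≤ ∑' _ : Fin M, a * vol (l + 1) := ENNReal.tsum_le_tsum hpiece
    _ = 2 * M * a * vol l := by
      rw [tsum_fintype, Finset.sum_const, vol_succ]
      simp only [Finset.card_univ, Fintype.card_fin, nsmul_eq_mul]
      ring

theorem vol_mul_le_of_exceeds {f : (Fin 3 → ℝ) → E} {a : ℝ≥0∞} {k : ℤ} {x : Fin 3 → ℝ}
    (h : Exceeds N f a k x) : a * vol k ≤ ∫⁻ z, ‖f z‖ₑ :=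
  h.le.trans (setLIntegral_le_lintegral _ _)

/-- Only the balls of bounded index can have an average exceeding `a`. -/
theorem exists_zpow_le (a : ℝ≥0∞) (ha : a ≠ 0) {f : (Fin 3 → ℝ) → E} (hfi : ∫⁻ z, ‖f z‖ₑ ≠ ∞) :
    ∃ L : ℝ, ∀ k x, Exceeds N f a k x → (2 : ℝ) ^ k ≤ L := by
  have hne : (∫⁻ z, ‖f z‖ₑ) / a ≠ ∞ := ENNReal.div_ne_top hfi ha
  refine ⟨((∫⁻ z, ‖f z‖ₑ) / a).toReal, fun k x h => ?_⟩
  have h1 : vol k ≤ (∫⁻ z, ‖f z‖ₑ) / a := by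
    rw [ENNReal.le_div_iff_mul_le (Or.inl ha) (Or.inr hfi), mul_comm]
    exact vol_mul_le_of_exceeds h
  have h2 := (ENNReal.ofReal_le_iff_le_toReal hne).1 h1
  have h3 : (0 : ℝ) < 2 ^ k := by positivity
  linarith

/-- At each point where some average exceeds `a` there is a largest such ball. -/
theorem exists_stopping {f : (Fin 3 → ℝ) → E} {a : ℝ≥0∞} (ha : a ≠ 0)
    (hfi : ∫⁻ z, ‖f z‖ₑ ≠ ∞) {x : Fin 3 → ℝ} (hx : ∃ k, Exceeds N f a k x) :
    ∃ k, Exceeds N f a k x ∧ ∀ j, k < j → ¬ Exceeds N f a j x := by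
  obtain ⟨L, hL⟩ := exists_zpow_le (N := N) a ha hfi
  obtain ⟨n, hn⟩ := pow_unbounded_of_one_lt L (one_lt_two : (1 : ℝ) < 2)
  obtain ⟨k, hk, hmax⟩ := Int.exists_greatest_of_bdd (P := fun k => Exceeds N f a k x)
    ⟨n, fun k hk => by
      have := (hL k x hk).trans_lt hn
      rw [← zpow_natCast, zpow_lt_zpow_iff_right₀ one_lt_two] at this
      exact this.le⟩ hx
  exact ⟨k, hk, fun j hj h => absurd (hmax j h) (not_le.2 hj)⟩

/-- The covering part of the Calderón–Zygmund decomposition: the set where some average exceeds `a`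
is partitioned into countably many measurable pieces, each attached to one of a family of
pairwise disjoint balls whose averages exceed `a`. A piece consists of points whose own stopping
index is at most that of its ball; this, rather than an engulfing property, makes the mean of `‖f‖`
over the piece comparable to `a`. -/
theorem exists_pieces (hN : NormLadder N B M) {f : (Fin 3 → ℝ) → E} (hf : Continuous f)
    {a : ℝ≥0∞} (ha : a ≠ 0) (hfi : ∫⁻ z, ‖f z‖ₑ ≠ ∞) :
    ∃ (u : Set (Fin 3 → ℝ)) (l : u → ℤ) (Q : u → Set (Fin 3 → ℝ)), u.Countable ∧
      (∀ b : u, Exceeds N f a (l b) b) ∧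
      Pairwise (Function.onFun Disjoint fun b : u => gball N (l b) b) ∧
      (∀ b, MeasurableSet (Q b)) ∧ Pairwise (Function.onFun Disjoint Q) ∧
      (∀ b : u, Q b ⊆ {x | N (l b) (heisDiff b x) ≤ 1 + 2 * B}) ∧
      (∀ b, ∫⁻ z in Q b, ‖f z‖ₑ ≤ 2 * M * a * vol (l b)) ∧
      (⋃ b, Q b) = {x | ∃ k, Exceeds N f a k x} := by
  classical
  set Ω := {x | ∃ k, Exceeds N f a k x} with hΩ
  have hst : ∀ x : Ω, ∃ k, Exceeds N f a k x ∧ ∀ j, k < j → ¬ Exceeds N f a j x := fun x =>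
    exists_stopping ha hfi x.2
  choose κ hκ hκmax using hst
  obtain ⟨L, hL⟩ := exists_zpow_le (N := N) a ha hfi
  -- the factor `3 / 2 < 2` forces the index of a selected ball to be at least that of the given one
  obtain ⟨v, -, hvd, hvc⟩ := Vitali.exists_disjoint_subfamily_covering_enlargement
    (fun x : Ω => gball N (κ x) x) univ (fun x => (2 : ℝ) ^ κ x) (3 / 2) (by norm_num)
    (fun x _ => by positivity) L (fun x _ => hL _ _ (hκ x)) (fun x _ => by
      refine nonempty_of_measure_ne_zero (μ := volume) ?_
      rw [hN.volume_gball]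
      exact (vol_pos _).ne')
  set u : Set (Fin 3 → ℝ) := Subtype.val '' v with hu
  have huΩ : ∀ b : u, (b : Fin 3 → ℝ) ∈ Ω := by
    rintro ⟨_, y, _, rfl⟩; exact y.2
  have hmemv : ∀ b : u, (⟨b, huΩ b⟩ : Ω) ∈ v := by
    rintro ⟨_, y, hy, rfl⟩; exact hy
  set l : u → ℤ := fun b => κ ⟨b, huΩ b⟩ with hl
  have hdisj : Pairwise (Function.onFun Disjoint fun b : u => gball N (l b) b) := by
    intro b b' hbb
    refine hvd (hmemv b) (hmemv b') fun h => hbb ?_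
    exact Subtype.ext (congrArg (fun y : Ω => (y : Fin 3 → ℝ)) h)
  have hcount : u.Countable := by
    have := Measure.countable_meas_pos_of_disjoint_iUnion (μ := volume)
      (fun b : u => hN.measurableSet_gball (l b) b) hdisj
    simp only [hN.volume_gball, vol_pos, ofPred_true] at this
    exact countable_coe_iff.1 (countable_univ_iff.1 this)
  have : Countable u := hcount.to_subtype
  obtain ⟨e, he⟩ := exists_injective_nat u
  set S : u → Set (Fin 3 → ℝ) := fun b => {x | (∃ k, Exceeds N f a k x) ∧
    (∀ k, l b < k → ¬ Exceeds N f a k x) ∧ N (l b) (heisDiff b x) ≤ 1 + 2 * B} with hS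
  have hSm : ∀ b, MeasurableSet (S b) := by
    intro b
    have h1 : MeasurableSet {x | ∃ k, Exceeds N f a k x} := by
      simp only [ofPred_exists]
      exact MeasurableSet.iUnion fun k => hN.measurableSet_exceeds hf a k
    have h2 : MeasurableSet {x | ∀ k, l b < k → ¬ Exceeds N f a k x} := by
      simp only [ofPred_forall]
      exact MeasurableSet.iInter fun k => MeasurableSet.iInter fun _ =>
        (hN.measurableSet_exceeds hf a k).compl
    have h3 : MeasurableSet {x | N (l b) (heisDiff b x) ≤ 1 + 2 * B} :=
      ((hN.continuous _).comp (continuous_heisDiff.comp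
        (Continuous.prodMk_right (b : Fin 3 → ℝ)))).measurable measurableSet_Iic
    exact h1.inter (h2.inter h3)
  have hScov : ∀ x ∈ Ω, ∃ b, x ∈ S b := by
    intro x hx
    obtain ⟨y, hyv, ⟨z, hzx, hzy⟩, hle⟩ := hvc ⟨x, hx⟩ (mem_univ _)
    have hkk : κ ⟨x, hx⟩ ≤ κ y := by
      by_contra! hlt
      have h1 : (2 : ℝ) ^ (κ y + 1) ≤ 2 ^ κ ⟨x, hx⟩ :=
        zpow_le_zpow_right₀ one_le_two (Int.add_one_le_iff.2 hlt)
      rw [zpow_add_one₀ two_ne_zero] at h1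
      have h2 : (0 : ℝ) < 2 ^ κ y := by positivity
      linarith
    refine ⟨⟨y, y, hyv, rfl⟩, hx, fun k hk => hκmax ⟨x, hx⟩ k (hkk.trans_lt hk), ?_⟩
    change N (κ y) (heisDiff y x) ≤ 1 + 2 * B
    have h1 : N (κ y) (heisDiff y z) ≤ 1 := hzy
    have h2 : N (κ y) (heisDiff z x) ≤ B := by
      rw [hN.comm]
      refine (hN.mono _ _ _ hkk).trans ?_
      exact mul_le_of_le_one_right (zero_le_one.trans hN.one_le) hzx
    have h3 := hN.triangle (κ y) y z x
    have h4 := hN.nonneg (κ y) (heisDiff y z)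
    have h5 := hN.nonneg (κ y) (heisDiff z x)
    have h6 := mul_le_mul h1 h2 h5 zero_le_one
    linarith
  -- the sets `S b` cover; removing the earlier ones in an enumeration `e` makes them disjoint
  refine ⟨u, l, fun b => S b \ ⋃ b' ∈ {b' | e b' < e b}, S b', hcount,
    fun b => hκ ⟨b, huΩ b⟩, hdisj, fun b => (hSm b).diff
      (MeasurableSet.biUnion (to_countable _) fun b' _ => hSm b'), ?_,
    fun b x hx => hx.1.2.2, ?_, ?_⟩
  · have key : ∀ b b' : u, e b < e b' → Disjoint (S b \ ⋃ c ∈ {c | e c < e b}, S c)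
        (S b' \ ⋃ c ∈ {c | e c < e b'}, S c) := fun b b' hlt =>
      disjoint_left.2 fun x hx hx' => hx'.2 (mem_biUnion (show b ∈ {c | e c < e b'} from hlt) hx.1)
    intro b b' hbb
    rcases lt_or_gt_of_ne (he.ne hbb) with h | h
    · exact key b b' h
    · exact (key b' b h).symm
  · intro b
    exact (lintegral_mono_set sdiff_subset).trans (hN.lintegral_le_of_not_exceeds (b := b)
      (fun x hx => hx.2.2) fun x hx => hx.2.1 _ (lt_add_one _))
  · refine Subset.antisymm (iUnion_subset fun b x hx => hx.1.1) fun x hx => ?_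
    have hex : ∃ n, ∃ b, e b = n ∧ x ∈ S b := by
      obtain ⟨b, hb⟩ := hScov x hx
      exact ⟨e b, b, rfl, hb⟩
    obtain ⟨b, hb, hxb⟩ := Nat.find_spec hex
    refine mem_iUnion.2 ⟨b, hxb, fun hmem => ?_⟩
    obtain ⟨b', hb', hxb'⟩ := mem_iUnion₂.1 hmem
    rw [mem_ofPred_eq, hb] at hb'
    exact Nat.find_min hex hb' ⟨b', rfl, hxb'⟩

end NormLadder

/-- Evaluation of a sum of functions supported on pairwise disjoint sets. -/
theorem hasSum_indicator_of_disjoint {X ι E : Type*} [AddCommMonoid E] [TopologicalSpace E]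
    {s : ι → Set X} (hs : Pairwise (Function.onFun Disjoint s)) (F : ι → X → E) (x : X) :
    (∃ i, x ∈ s i ∧ HasSum (fun j => (s j).indicator (F j) x) (F i x)) ∨
      ((∀ i, x ∉ s i) ∧ HasSum (fun j => (s j).indicator (F j) x) 0) := by
  by_cases h : ∃ i, x ∈ s i
  · obtain ⟨i, hi⟩ := h
    refine Or.inl ⟨i, hi, ?_⟩
    have := hasSum_single (f := fun j => (s j).indicator (F j) x) i fun j hj =>
      indicator_of_notMem (fun hxj => disjoint_left.1 (hs hj) hxj hi) _
    rwa [indicator_of_mem hi] at this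
  · push Not at h
    refine Or.inr ⟨h, ?_⟩
    simp only [fun j => indicator_of_notMem (h j) (F j)]
    exact hasSum_zero

namespace NormLadder

variable {N : ℤ → (Fin 3 → ℝ) → ℝ} {B : ℝ} {M : ℕ}
variable {E : Type*} [NormedAddCommGroup E] [NormedSpace ℝ E] [CompleteSpace E]

/-- The Calderón–Zygmund decomposition at height `a`. Each bad part is the restriction of `f` to a
piece, minus the constant function of the same integral on the unit ball to which the piece is
attached. The unit balls are disjoint, so these constants add up to a bounded function. -/
theorem exists_decomposition (hN : NormLadder N B M) {f : (Fin 3 → ℝ) → E} (hf : Continuous f)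
    (hfi : Integrable f) {a : ℝ≥0∞} (ha : a ≠ 0) :
    ∃ (u : Set (Fin 3 → ℝ)) (l : u → ℤ) (g : (Fin 3 → ℝ) → E) (b : u → (Fin 3 → ℝ) → E),
      u.Countable ∧ (∀ x, HasSum (fun i => b i x) (f x - g x)) ∧
      AEStronglyMeasurable g ∧ (∀ x, ‖g x‖ₑ ≤ (1 + 2 * M) * a) ∧
      ∫⁻ x, ‖g x‖ₑ ≤ ∫⁻ x, ‖f x‖ₑ ∧
      (∀ i, Integrable (b i)) ∧ (∀ i, ∫ x, b i x = 0) ∧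
      (∀ i x, 1 + 2 * B < N (l i) (heisDiff i x) → b i x = 0) ∧
      ∑' i, ∫⁻ x, ‖b i x‖ₑ ≤ 2 * ∫⁻ x, ‖f x‖ₑ ∧
      a * ∑' i, vol (l i) ≤ ∫⁻ x, ‖f x‖ₑ := by
  have hfin : ∫⁻ x, ‖f x‖ₑ ≠ ∞ := hfi.2.ne
  obtain ⟨u, l, Q, hu, hex, hball, hQm, hQd, hQs, hQle, hQu⟩ := hN.exists_pieces hf ha hfin
  have : Countable u := hu.to_subtype
  have hBm : ∀ i : u, MeasurableSet (gball N (l i) i) := fun i => hN.measurableSet_gball _ _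
  have hvol : ∀ i : u, volume (gball N (l i) i) = vol (l i) := fun i => hN.volume_gball _ _
  have hvr : ∀ i : u, (vol (l i)).toReal ≠ 0 := fun i =>
    (ENNReal.toReal_pos (vol_pos _).ne' (vol_ne_top _)).ne'
  have hsumQ : ∑' i, ∫⁻ x in Q i, ‖f x‖ₑ = ∫⁻ x in ⋃ i, Q i, ‖f x‖ₑ :=
    (lintegral_iUnion hQm hQd _).symm
  have hsumQ' : ∑' i, ∫⁻ x in Q i, ‖f x‖ₑ ≤ ∫⁻ x, ‖f x‖ₑ :=
    hsumQ.trans_le (setLIntegral_le_lintegral _ _)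
  set w : u → E := fun i => ((vol (l i)).toReal)⁻¹ • ∫ x in Q i, f x with hw
  have hwvol : ∀ i, ‖w i‖ₑ * vol (l i) ≤ ∫⁻ x in Q i, ‖f x‖ₑ := by
    intro i
    have h1 : ‖w i‖ₑ * vol (l i) = ‖∫ x in Q i, f x‖ₑ := by
      rw [hw, enorm_smul, enorm_inv (hvr i), Real.enorm_of_nonneg ENNReal.toReal_nonneg,
        ENNReal.ofReal_toReal (vol_ne_top _), mul_right_comm,
        ENNReal.inv_mul_cancel (vol_pos _).ne' (vol_ne_top _), one_mul]
    rw [h1]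
    exact enorm_integral_le_lintegral_enorm _
  have hwa : ∀ i, ‖w i‖ₑ ≤ 2 * M * a := fun i => by
    have := (hwvol i).trans (hQle i)
    exact (ENNReal.mul_le_mul_iff_left (vol_pos _).ne' (vol_ne_top _)).1 this
  set Ω := {x | ∃ k, Exceeds N f a k x} with hΩ
  have hΩm : MeasurableSet Ω := hQu ▸ MeasurableSet.iUnion hQm
  set b₁ : u → (Fin 3 → ℝ) → E := fun i => (Q i).indicator f with hb₁
  set b₂ : u → (Fin 3 → ℝ) → E := fun i => (gball N (l i) i).indicator fun _ => w i with hb₂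
  set g₂ : (Fin 3 → ℝ) → E := fun x => ∑' i, b₂ i x with hg₂
  set g : (Fin 3 → ℝ) → E := fun x => Ωᶜ.indicator f x + g₂ x with hg
  have hb₁sum : ∀ x, HasSum (fun i => b₁ i x) (Ω.indicator f x) := by
    intro x
    rcases hasSum_indicator_of_disjoint hQd (fun _ => f) x with ⟨i, hi, h⟩ | ⟨hi, h⟩
    · have hx : x ∈ Ω := hQu ▸ mem_iUnion.2 ⟨i, hi⟩
      rwa [indicator_of_mem hx]
    · have hx : x ∉ Ω := by
        rw [← hQu]; simpa using hi
      rwa [indicator_of_notMem hx]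
  have hb₂sum : ∀ x, HasSum (fun i => b₂ i x) (g₂ x) := by
    intro x
    rcases hasSum_indicator_of_disjoint hball (fun i _ => w i) x with ⟨i, hi, h⟩ | ⟨hi, h⟩
    · exact h.summable.hasSum
    · exact h.summable.hasSum
  have hg₂a : ∀ x, ‖g₂ x‖ₑ ≤ 2 * M * a := by
    intro x
    rcases hasSum_indicator_of_disjoint hball (fun i _ => w i) x with ⟨i, hi, h⟩ | ⟨hi, h⟩
    · have e : g₂ x = w i := h.tsum_eq
      rw [e]; exact hwa i
    · have e : g₂ x = 0 := h.tsum_eq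
      rw [e]; simp
  have hg₂s : ∀ x, ‖g₂ x‖ₑ ≤ ∑' i, ‖b₂ i x‖ₑ := by
    intro x
    rcases hasSum_indicator_of_disjoint hball (fun i _ => w i) x with ⟨i, hi, h⟩ | ⟨hi, h⟩
    · have e : g₂ x = w i := h.tsum_eq
      rw [e]
      refine le_trans (le_of_eq ?_) (ENNReal.le_tsum i)
      simp only [hb₂]
      rw [indicator_of_mem hi]
    · have e : g₂ x = 0 := h.tsum_eq
      rw [e]; simp
  have hb₂m : ∀ i, StronglyMeasurable (b₂ i) := fun i =>
    stronglyMeasurable_const.indicator (hBm i)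
  have hb₂n : ∀ i, ∫⁻ x, ‖b₂ i x‖ₑ = ‖w i‖ₑ * vol (l i) := by
    intro i
    simp only [hb₂, enorm_indicator_eq_indicator_enorm]
    rw [lintegral_indicator (hBm i), setLIntegral_const, hvol]
  have hb₁n : ∀ i, ∫⁻ x, ‖b₁ i x‖ₑ = ∫⁻ x in Q i, ‖f x‖ₑ := by
    intro i
    simp only [hb₁, enorm_indicator_eq_indicator_enorm]
    rw [lintegral_indicator (hQm i)]
  have hb₁i : ∀ i, Integrable (b₁ i) := fun i => hfi.indicator (hQm i)
  have hb₂i : ∀ i, Integrable (b₂ i) := fun i => by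
    refine ⟨(hb₂m i).aestronglyMeasurable, ?_⟩
    rw [HasFiniteIntegral, hb₂n]
    exact ENNReal.mul_lt_top enorm_lt_top (vol_ne_top _).lt_top
  have hsum₂ : ∑' i, ∫⁻ x, ‖b₂ i x‖ₑ ≤ ∑' i, ∫⁻ x in Q i, ‖f x‖ₑ :=
    ENNReal.tsum_le_tsum fun i => (hb₂n i).trans_le (hwvol i)
  refine ⟨u, l, g, fun i x => b₁ i x - b₂ i x, hu, fun x => ?_, ?_, fun x => ?_, ?_,
    fun i => (hb₁i i).sub (hb₂i i), fun i => ?_, fun i x hx => ?_, ?_, ?_⟩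
  · have h := (hb₁sum x).sub (hb₂sum x)
    convert h using 1
    have : f x = Ωᶜ.indicator f x + Ω.indicator f x := by
      rw [← Pi.add_apply, indicator_compl_add_self]
    rw [hg]
    simp only
    nth_rewrite 1 [this]
    abel
  · refine (hf.aestronglyMeasurable.indicator hΩm.compl).add ?_
    refine StronglyMeasurable.aestronglyMeasurable
      (stronglyMeasurable_of_tendsto (Filter.atTop : Filter (Finset u))
        (f := fun s x => ∑ i ∈ s, b₂ i x) (fun s => ?_) ?_)
    · exact Finset.stronglyMeasurable_fun_sum s fun i _ => hb₂m i
    · exact tendsto_pi_nhds.2 fun x => by simpa [HasSum] using hb₂sum x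
  · refine (enorm_add_le _ _).trans ?_
    rw [add_mul, one_mul]
    refine add_le_add ?_ (hg₂a x)
    by_cases hx : x ∈ Ω
    · rw [indicator_of_notMem (show x ∉ Ωᶜ from fun h => h hx)]; simp
    · rw [indicator_of_mem hx]
      exact hN.enorm_le_of_not_exceeds hf fun k hk => hx ⟨k, hk⟩
  · calc ∫⁻ x, ‖g x‖ₑ ≤ ∫⁻ x, (‖Ωᶜ.indicator f x‖ₑ + ∑' i, ‖b₂ i x‖ₑ) :=
          lintegral_mono fun x => (enorm_add_le _ _).trans (add_le_add le_rfl (hg₂s x))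
      _ = (∫⁻ x in Ωᶜ, ‖f x‖ₑ) + ∑' i, ∫⁻ x, ‖b₂ i x‖ₑ := by
          simp only [enorm_indicator_eq_indicator_enorm]
          rw [lintegral_add_left (hf.enorm.measurable.indicator hΩm.compl),
            lintegral_indicator hΩm.compl, lintegral_tsum fun i => (hb₂m i).enorm.aemeasurable]
      _ ≤ (∫⁻ x in Ωᶜ, ‖f x‖ₑ) + ∫⁻ x in Ω, ‖f x‖ₑ := by
          refine add_le_add le_rfl (hsum₂.trans ?_)
          rw [hsumQ, hQu]
      _ = ∫⁻ x, ‖f x‖ₑ := by rw [add_comm, lintegral_add_compl _ hΩm]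
  · have h2 : ∫ x, b₂ i x = ∫ x in Q i, f x := by
      simp only [hb₂]
      rw [integral_indicator_const _ (hBm i), Measure.real, hvol, hw]
      simp only
      rw [smul_smul, mul_inv_cancel₀ (hvr i), one_smul]
    rw [integral_sub (hb₁i i) (hb₂i i), h2, hb₁, integral_indicator (hQm i), sub_self]
  · have h1 : x ∉ Q i := fun h => not_lt.2 (hQs i h) hx
    have h2 : x ∉ gball N (l i) i := fun h => by
      have h' : N (l i) (heisDiff i x) ≤ 1 := h
      linarith [hN.one_le]
    simp only [hb₁, hb₂]
    rw [indicator_of_notMem h1, indicator_of_notMem h2, sub_zero]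
  · calc ∑' i, ∫⁻ x, ‖b₁ i x - b₂ i x‖ₑ
        ≤ ∑' i, ((∫⁻ x, ‖b₁ i x‖ₑ) + ∫⁻ x, ‖b₂ i x‖ₑ) := by
          refine ENNReal.tsum_le_tsum fun i => ?_
          rw [← lintegral_add_right _ (hb₂m i).enorm]
          exact lintegral_mono fun x => enorm_sub_le
      _ = (∑' i, ∫⁻ x, ‖b₁ i x‖ₑ) + ∑' i, ∫⁻ x, ‖b₂ i x‖ₑ := ENNReal.tsum_add
      _ ≤ 2 * ∫⁻ x, ‖f x‖ₑ := by
          rw [two_mul]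
          refine add_le_add ?_ (hsum₂.trans hsumQ')
          simp only [hb₁n]
          exact hsumQ'
  · rw [← ENNReal.tsum_mul_left]
    calc ∑' i, a * vol (l i) ≤ ∑' i : u, ∫⁻ z in gball N (l i) i, ‖f z‖ₑ :=
          ENNReal.tsum_le_tsum fun i => (hex i).le
      _ = ∫⁻ z in ⋃ i : u, gball N (l i) i, ‖f z‖ₑ := (lintegral_iUnion hBm hball _).symm
      _ ≤ ∫⁻ z, ‖f z‖ₑ := setLIntegral_le_lintegral _ _

end NormLadder

/-! ### Convolution operators with operator-valued kernels -/

/-- Young's inequality for the convolution of nonnegative functions on `ℍ¹`. -/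
theorem lintegral_conv_rpow_le {u v : (Fin 3 → ℝ) → ℝ≥0∞} (hu : AEMeasurable u)
    (hv : Measurable v) {p : ℝ} (hp : 1 ≤ p) :
    ∫⁻ x, (∫⁻ z, u z * v (heisDiff z x)) ^ p ≤ (∫⁻ y, v y) ^ p * ∫⁻ z, u z ^ p := by
  have hvm : Measurable fun q : (Fin 3 → ℝ) × (Fin 3 → ℝ) => v (heisDiff q.2 q.1) :=
    hv.comp (continuous_heisDiff.comp continuous_swap).measurable
  have hvx : ∀ x, Measurable fun z => v (heisDiff z x) := fun x =>
    hvm.comp (measurable_const.prodMk measurable_id)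
  have hvint : ∀ x, ∫⁻ z, v (heisDiff z x) = ∫⁻ y, v y := fun x =>
    (measurePreserving_heisDiff_right x).lintegral_comp hv
  have hvint' : ∀ z, ∫⁻ x, v (heisDiff z x) = ∫⁻ y, v y := fun z =>
    (measurePreserving_heisDiff_left z).lintegral_comp hv
  have hp0 : 0 < p := zero_lt_one.trans_le hp
  -- Hölder's inequality with respect to the measure `v (z⁻¹ x) dz`
  have hold : ∀ x, (∫⁻ z, u z * v (heisDiff z x)) ^ p
      ≤ (∫⁻ y, v y) ^ (p - 1) * ∫⁻ z, u z ^ p * v (heisDiff z x) := by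
    intro x
    rcases hp.eq_or_lt with rfl | hp1
    · simp
    set q := p.conjExponent with hq
    have hpq : p.HolderConjugate q := Real.HolderConjugate.conjExponent hp1
    have h1 := ENNReal.lintegral_mul_le_Lp_mul_Lq volume hpq
      (f := fun z => u z * v (heisDiff z x) ^ (1 / p)) (g := fun z => v (heisDiff z x) ^ (1 / q))
      (hu.mul ((hvx x).pow_const _).aemeasurable) ((hvx x).pow_const _).aemeasurable
    have e1 : ∀ z, u z * v (heisDiff z x) ^ (1 / p) * v (heisDiff z x) ^ (1 / q)
        = u z * v (heisDiff z x) := fun z => by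
      rw [mul_assoc, ← ENNReal.rpow_add_of_nonneg _ _ (by have := hpq.pos; positivity)
        (by have := hpq.symm.pos; positivity), show 1 / p + 1 / q = 1 by
          rw [one_div, one_div]; exact hpq.inv_add_inv_eq_one, ENNReal.rpow_one]
    have e2 : ∀ z, (u z * v (heisDiff z x) ^ (1 / p)) ^ p
        = u z ^ p * v (heisDiff z x) := fun z => by
      rw [ENNReal.mul_rpow_of_nonneg _ _ hp0.le, ← ENNReal.rpow_mul, one_div_mul_cancel hp0.ne',
        ENNReal.rpow_one]
    have e3 : ∀ z, (v (heisDiff z x) ^ (1 / q)) ^ q = v (heisDiff z x) := fun z => by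
      rw [← ENNReal.rpow_mul, one_div_mul_cancel hpq.symm.ne_zero, ENNReal.rpow_one]
    simp only [Pi.mul_apply, e1, e2, e3, hvint] at h1
    calc (∫⁻ z, u z * v (heisDiff z x)) ^ p
        ≤ ((∫⁻ z, u z ^ p * v (heisDiff z x)) ^ (1 / p) * (∫⁻ y, v y) ^ (1 / q)) ^ p :=
          ENNReal.rpow_le_rpow h1 hp0.le
      _ = (∫⁻ y, v y) ^ (p - 1) * ∫⁻ z, u z ^ p * v (heisDiff z x) := by
          rw [ENNReal.mul_rpow_of_nonneg _ _ hp0.le, ← ENNReal.rpow_mul,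
            one_div_mul_cancel hp0.ne', ENNReal.rpow_one, ← ENNReal.rpow_mul, mul_comm]
          congr 2
          have := hpq.sub_one_mul_conj
          have hq0 := hpq.symm.ne_zero
          field_simp
          linarith
  calc ∫⁻ x, (∫⁻ z, u z * v (heisDiff z x)) ^ p
      ≤ ∫⁻ x, (∫⁻ y, v y) ^ (p - 1) * ∫⁻ z, u z ^ p * v (heisDiff z x) := lintegral_mono hold
    _ = (∫⁻ y, v y) ^ (p - 1) * ∫⁻ x, ∫⁻ z, u z ^ p * v (heisDiff z x) := by
        refine lintegral_const_mul'' _ ?_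
        exact (((hu.pow_const p).comp_snd (μ := volume)).mul hvm.aemeasurable).lintegral_prod_right'
    _ = (∫⁻ y, v y) ^ (p - 1) * ∫⁻ z, ∫⁻ x, u z ^ p * v (heisDiff z x) := by
        rw [lintegral_lintegral_swap]
        exact ((hu.pow_const p).comp_snd (μ := volume)).mul hvm.aemeasurable
    _ = (∫⁻ y, v y) ^ (p - 1) * ∫⁻ z, u z ^ p * ∫⁻ y, v y := by
        congr 1
        refine lintegral_congr fun z => ?_
        rw [lintegral_const_mul _ (show Measurable fun x => v (heisDiff z x) from
          hv.comp (measurePreserving_heisDiff_left z).measurable), hvint']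
    _ = (∫⁻ y, v y) ^ p * ∫⁻ z, u z ^ p := by
        rw [lintegral_mul_const'' _ (hu.pow_const p), mul_comm (∫⁻ z, u z ^ p), ← mul_assoc]
        congr 1
        nth_rewrite 2 [← ENNReal.rpow_one (∫⁻ y, v y)]
        rw [← ENNReal.rpow_add_of_nonneg _ _ (by linarith) zero_le_one, sub_add_cancel]

section OpConv

variable {E F : Type*} [NormedAddCommGroup E] [NormedSpace ℝ E] [NormedAddCommGroup F]
  [NormedSpace ℝ F]

/-- Right convolution with a kernel whose values are operators. -/
def opConv (k : (Fin 3 → ℝ) → E →L[ℝ] F) (f : (Fin 3 → ℝ) → E) (x : Fin 3 → ℝ) : F :=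
  ∫ z, k (heisDiff z x) (f z)

variable {k : (Fin 3 → ℝ) → E →L[ℝ] F} {f g : (Fin 3 → ℝ) → E}

theorem aestronglyMeasurable_opConv_kernel (hk : Continuous k) (hf : AEStronglyMeasurable f) :
    AEStronglyMeasurable (fun q : (Fin 3 → ℝ) × (Fin 3 → ℝ) => k (heisDiff q.2 q.1) (f q.2))
      (volume.prod volume) := by
  have h1 : AEStronglyMeasurable
      (fun q : (Fin 3 → ℝ) × (Fin 3 → ℝ) => k (heisDiff q.2 q.1)) (volume.prod volume) :=
    (hk.comp (continuous_heisDiff.comp continuous_swap)).aestronglyMeasurable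
  exact (ContinuousLinearMap.id ℝ (E →L[ℝ] F)).aestronglyMeasurable_comp₂ h1 hf.comp_snd

theorem aestronglyMeasurable_opConv (hk : Continuous k) (hf : AEStronglyMeasurable f) :
    AEStronglyMeasurable (opConv k f) :=
  (aestronglyMeasurable_opConv_kernel hk hf).integral_prod_right'

theorem enorm_opConv_le (x : Fin 3 → ℝ) :
    ‖opConv k f x‖ₑ ≤ ∫⁻ z, ‖f z‖ₑ * ‖k (heisDiff z x)‖ₑ := by
  refine (enorm_integral_le_lintegral_enorm _).trans (lintegral_mono fun z => ?_)
  rw [mul_comm]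
  exact ContinuousLinearMap.le_opENorm _ _

theorem lintegral_opConv_rpow_le (hk : Continuous k) (hf : AEStronglyMeasurable f) {p : ℝ}
    (hp : 1 ≤ p) :
    ∫⁻ x, ‖opConv k f x‖ₑ ^ p ≤ (∫⁻ y, ‖k y‖ₑ) ^ p * ∫⁻ z, ‖f z‖ₑ ^ p :=
  (lintegral_mono fun x => ENNReal.rpow_le_rpow (enorm_opConv_le x) (by linarith)).trans
    (lintegral_conv_rpow_le hf.enorm hk.enorm.measurable hp)

theorem integrable_opConv_kernel (hk : Continuous k) (hkc : HasCompactSupport k) {p : ℝ≥0∞}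
    (hp : 1 ≤ p) (hf : MemLp f p) (x : Fin 3 → ℝ) :
    Integrable fun z => k (heisDiff z x) (f z) := by
  have : ENNReal.HolderConjugate p.conjExponent p := (ENNReal.HolderConjugate.conjExponent hp).symm
  have h1 : MemLp (fun z => k (heisDiff z x)) p.conjExponent :=
    (hk.memLp_of_hasCompactSupport hkc).comp_measurePreserving (measurePreserving_heisDiff_right x)
  exact memLp_one_iff_integrable.1
    ((ContinuousLinearMap.id ℝ (E →L[ℝ] F)).memLp_of_bilin (r := 1) h1 hf)

theorem opConv_sub (hk : Continuous k) (hkc : HasCompactSupport k) {p q : ℝ≥0∞}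
    (hp : 1 ≤ p) (hq : 1 ≤ q) (hf : MemLp f p) (hg : MemLp g q) (x : Fin 3 → ℝ) :
    opConv k (f - g) x = opConv k f x - opConv k g x := by
  rw [opConv, opConv, opConv, ← integral_sub (integrable_opConv_kernel hk hkc hp hf x)
    (integrable_opConv_kernel hk hkc hq hg x)]
  simp

/-- A kernel that is smooth at scale `l` maps functions of mean zero living on a ball of index `l`
to functions that are integrable away from the ball. -/
theorem lintegral_opConv_atom_le {N : ℤ → (Fin 3 → ℝ) → ℝ} {B : ℝ} {M : ℕ}
    (hN : NormLadder N B M) (hk : Continuous k) (hkc : HasCompactSupport k) {R' : ℝ} {CH : ℝ≥0∞}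
    (hH : ∀ l y, N l y ≤ 1 + 2 * B →
      ∫⁻ x in {x | R' < N l x}, ‖k (heisDiff y x) - k x‖ₑ ≤ CH)
    {b : (Fin 3 → ℝ) → E} (hb : Integrable b) (hb0 : ∫ x, b x = 0) {l : ℤ} {c : Fin 3 → ℝ}
    (hbs : ∀ x, 1 + 2 * B < N l (heisDiff c x) → b x = 0) [CompleteSpace E] [CompleteSpace F] :
    ∫⁻ x in {x | R' < N l (heisDiff c x)}, ‖opConv k b x‖ₑ ≤ CH * ∫⁻ z, ‖b z‖ₑ := by
  have hA : MeasurableSet {x | R' < N l (heisDiff c x)} :=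
    measurableSet_lt measurable_const
      ((hN.continuous l).comp (continuous_heisDiff.comp (Continuous.prodMk_right c))).measurable
  have hpt : ∀ x, ‖opConv k b x‖ₑ
      ≤ ∫⁻ z, ‖k (heisDiff z x) - k (heisDiff c x)‖ₑ * ‖b z‖ₑ := by
    intro x
    have e : opConv k b x = ∫ z, (k (heisDiff z x) - k (heisDiff c x)) (b z) := by
      have h1 := integrable_opConv_kernel hk hkc le_rfl (memLp_one_iff_integrable.2 hb) x
      have h2 : Integrable fun z => k (heisDiff c x) (b z) :=
        (k (heisDiff c x)).integrable_comp hb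
      simp only [sub_apply]
      rw [integral_sub h1 h2, ContinuousLinearMap.integral_comp_comm _ hb, hb0, map_zero, sub_zero,
        opConv]
    rw [e]
    exact (enorm_integral_le_lintegral_enorm _).trans
      (lintegral_mono fun z => ContinuousLinearMap.le_opENorm _ _)
  have hm : Continuous fun q : (Fin 3 → ℝ) × (Fin 3 → ℝ) =>
      ‖k (heisDiff q.2 q.1) - k (heisDiff c q.1)‖ₑ :=
    ((hk.comp (continuous_heisDiff.comp continuous_swap)).sub (hk.comp (continuous_heisDiff.comp
      (continuous_const.prodMk continuous_fst)))).enorm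
  calc ∫⁻ x in {x | R' < N l (heisDiff c x)}, ‖opConv k b x‖ₑ
      ≤ ∫⁻ x in {x | R' < N l (heisDiff c x)},
          ∫⁻ z, ‖k (heisDiff z x) - k (heisDiff c x)‖ₑ * ‖b z‖ₑ := lintegral_mono hpt
    _ = ∫⁻ z, ∫⁻ x in {x | R' < N l (heisDiff c x)},
          ‖k (heisDiff z x) - k (heisDiff c x)‖ₑ * ‖b z‖ₑ := by
        rw [lintegral_lintegral_swap]
        exact hm.measurable.aemeasurable.mul (hb.1.enorm.comp_snd)
    _ ≤ ∫⁻ z, CH * ‖b z‖ₑ := by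
        refine lintegral_mono fun z => ?_
        by_cases hz : 1 + 2 * B < N l (heisDiff c z)
        · simp [hbs z hz]
        have hmz : Measurable fun x => ‖k (heisDiff z x) - k (heisDiff c x)‖ₑ :=
          (hm.comp (Continuous.prodMk_left z)).measurable
        rw [lintegral_mul_const _ hmz]
        gcongr
        have hg : Measurable ({x | R' < N l x}.indicator
            fun x => ‖k (heisDiff (heisDiff c z) x) - k x‖ₑ) := by
          refine Measurable.indicator ?_ (measurableSet_lt measurable_const
            (hN.continuous l).measurable)
          exact ((hk.comp (continuous_heisDiff.comp (Continuous.prodMk_right _))).sub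
            hk).enorm.measurable
        have h1 := (measurePreserving_heisDiff_left c).lintegral_comp hg
        rw [lintegral_indicator (measurableSet_lt measurable_const
            (hN.continuous l).measurable)] at h1
        refine le_trans (le_of_eq ?_) (hH l _ (not_lt.1 hz))
        rw [← h1, ← lintegral_indicator hA]
        refine lintegral_congr fun x => ?_
        simp only [indicator, mem_ofPred_eq, heisDiff_heisDiff]
    _ = CH * ∫⁻ z, ‖b z‖ₑ := lintegral_const_mul'' _ hb.1.enorm

/-- Weak type `(1,1)`, from the `L²` bound and Hörmander's condition. -/
theorem NormLadder.weak_type {N : ℤ → (Fin 3 → ℝ) → ℝ} {B : ℝ} {M : ℕ} [CompleteSpace E]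
    [CompleteSpace F] (hN : NormLadder N B M) (hk : Continuous k) (hkc : HasCompactSupport k)
    {R' : ℝ} (hR' : 0 ≤ R') {CH A : ℝ≥0∞}
    (hH : ∀ l y, N l y ≤ 1 + 2 * B →
      ∫⁻ x in {x | R' < N l x}, ‖k (heisDiff y x) - k x‖ₑ ≤ CH)
    (h2 : ∀ g, AEStronglyMeasurable g → ∫⁻ x, ‖opConv k g x‖ₑ ^ 2 ≤ A * ∫⁻ x, ‖g x‖ₑ ^ 2)
    (hf : Continuous f) (hfc : HasCompactSupport f) {a : ℝ≥0∞} (ha : a ≠ 0) (ha' : a ≠ ∞) :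
    a * volume {x | 2 * a < ‖opConv k f x‖ₑ}
      ≤ (A * (1 + 2 * M) + ENNReal.ofReal (R' ^ 3) + 2 * CH) * ∫⁻ x, ‖f x‖ₑ := by
  have hfi : Integrable f := hf.integrable_of_hasCompactSupport hfc
  obtain ⟨u, l, g, b, hu, hsum, hgm, hga, hg1, hbi, hb0, hbs, hb1, hvol⟩ :=
    hN.exists_decomposition hf hfi ha
  have : Countable u := hu.to_subtype
  set I := ∫⁻ x, ‖f x‖ₑ with hI
  have hIfin : I ≠ ∞ := hfi.2.ne
  have hgi : Integrable g := ⟨hgm, hg1.trans_lt hIfin.lt_top⟩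
  set Ωs := ⋃ i : u, {x | N (l i) (heisDiff i x) ≤ R'} with hΩs
  -- the good part
  have hgood : a * volume {x | a < ‖opConv k g x‖ₑ} ≤ A * (1 + 2 * M) * I := by
    have h3 : ∫⁻ x, ‖g x‖ₑ ^ 2 ≤ (1 + 2 * M) * a * I := by
      calc ∫⁻ x, ‖g x‖ₑ ^ 2 ≤ ∫⁻ x, (1 + 2 * M) * a * ‖g x‖ₑ :=
            lintegral_mono fun x => by rw [sq]; gcongr; exact hga x
        _ = (1 + 2 * M) * a * ∫⁻ x, ‖g x‖ₑ := lintegral_const_mul'' _ hgm.enorm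
        _ ≤ _ := by gcongr
    have h4 : a ^ 2 * volume {x | a < ‖opConv k g x‖ₑ} ≤ ∫⁻ x, ‖opConv k g x‖ₑ ^ 2 := by
      refine le_trans ?_ (mul_meas_ge_le_lintegral₀
        ((aestronglyMeasurable_opConv hk hgm).enorm.pow_const 2) (a ^ 2))
      refine mul_le_mul' le_rfl (measure_mono fun x hx => ?_)
      exact pow_le_pow_left' (le_of_lt (show a < ‖opConv k g x‖ₑ from hx)) 2
    have h5 : a * (a * volume {x | a < ‖opConv k g x‖ₑ}) ≤ a * (A * (1 + 2 * M) * I) := by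
      calc a * (a * volume {x | a < ‖opConv k g x‖ₑ})
          = a ^ 2 * volume {x | a < ‖opConv k g x‖ₑ} := by ring
        _ ≤ A * ((1 + 2 * M) * a * I) := h4.trans ((h2 g hgm).trans (by gcongr))
        _ = a * (A * (1 + 2 * M) * I) := by ring
    exact (ENNReal.mul_le_mul_iff_right ha ha').1 h5
  -- the exceptional set
  have hexc : a * volume Ωs ≤ ENNReal.ofReal (R' ^ 3) * I := by
    calc a * volume Ωs ≤ a * ∑' i : u, volume {x | N (l i) (heisDiff i x) ≤ R'} := by
          gcongr; exact measure_iUnion_le _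
      _ = a * ∑' i, ENNReal.ofReal (R' ^ 3) * NormLadder.vol (l i) := by
          congr 2
          ext i
          rw [hN.volume_translate_le _ _ hR', NormLadder.vol, ← ENNReal.ofReal_mul (by positivity)]
          congr 1; ring
      _ = ENNReal.ofReal (R' ^ 3) * (a * ∑' i, NormLadder.vol (l i)) := by
          rw [ENNReal.tsum_mul_left]; ring
      _ ≤ _ := by gcongr
  -- the bad part away from the exceptional set
  have hsumn : ∑' i, ∫⁻ x, ‖b i x‖ₑ ≠ ∞ :=
    (hb1.trans_lt (ENNReal.mul_lt_top (by simp) hIfin.lt_top)).ne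
  obtain ⟨K, hK⟩ := hkc.exists_bound_of_continuous hk
  have hbadpt : ∀ x, ‖opConv k (f - g) x‖ₑ ≤ ∑' i, ‖opConv k (b i) x‖ₑ := by
    intro x
    have hF := hasSum_integral_of_summable_integral_norm (μ := volume)
      (F := fun i z => k (heisDiff z x) (b i z))
      (fun i => integrable_opConv_kernel hk hkc le_rfl (memLp_one_iff_integrable.2 (hbi i)) x) (by
        have hs : Summable fun i => K * ∫ z, ‖b i z‖ := by
          refine Summable.mul_left _ ?_
          simp only [integral_norm_eq_lintegral_enorm (hbi _).1]
          exact ENNReal.summable_toReal hsumn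
        refine Summable.of_nonneg_of_le (fun i => integral_nonneg fun z => norm_nonneg _)
          (fun i => ?_) hs
        rw [← integral_const_mul]
        refine integral_mono_of_nonneg (ae_of_all _ fun z => norm_nonneg _)
          ((hbi i).norm.const_mul K) (ae_of_all _ fun z => ?_)
        exact (ContinuousLinearMap.le_opNorm _ _).trans
          (mul_le_mul_of_nonneg_right (hK _) (norm_nonneg _)))
    have e : (∫ z, ∑' i, k (heisDiff z x) (b i z)) = opConv k (f - g) x := by
      refine integral_congr_ae (ae_of_all _ fun z => ?_)
      exact ((k (heisDiff z x)).hasSum (hsum z)).tsum_eq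
    rw [e] at hF
    rw [← hF.tsum_eq]
    exact enorm_tsum_le_tsum_enorm
  have hbad : a * volume {x | x ∉ Ωs ∧ a < ‖opConv k (f - g) x‖ₑ} ≤ 2 * CH * I := by
    have hm : AEMeasurable (fun x => ‖opConv k (f - g) x‖ₑ) (volume.restrict Ωsᶜ) :=
      (aestronglyMeasurable_opConv hk (hfi.1.sub hgm)).enorm.restrict
    have hΩm : MeasurableSet Ωs := MeasurableSet.iUnion fun i =>
      measurableSet_le ((hN.continuous _).comp (continuous_heisDiff.comp
        (Continuous.prodMk_right (i : Fin 3 → ℝ)))).measurable measurable_const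
    calc a * volume {x | x ∉ Ωs ∧ a < ‖opConv k (f - g) x‖ₑ}
        ≤ a * (volume.restrict Ωsᶜ) {x | a ≤ ‖opConv k (f - g) x‖ₑ} := by
          refine mul_le_mul' le_rfl ?_
          rw [Measure.restrict_apply' hΩm.compl]
          exact measure_mono fun x hx => ⟨le_of_lt hx.2, hx.1⟩
      _ ≤ ∫⁻ x in Ωsᶜ, ‖opConv k (f - g) x‖ₑ := mul_meas_ge_le_lintegral₀ hm a
      _ ≤ ∫⁻ x in Ωsᶜ, ∑' i, ‖opConv k (b i) x‖ₑ := lintegral_mono hbadpt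
      _ = ∑' i, ∫⁻ x in Ωsᶜ, ‖opConv k (b i) x‖ₑ :=
          lintegral_tsum fun i => (aestronglyMeasurable_opConv hk (hbi i).1).enorm.restrict
      _ ≤ ∑' i, CH * ∫⁻ x, ‖b i x‖ₑ := by
          refine ENNReal.tsum_le_tsum fun i => le_trans (lintegral_mono_set fun x hx => ?_)
            (lintegral_opConv_atom_le hN hk hkc hH (hbi i) (hb0 i) (hbs i))
          by_contra h
          exact hx (mem_iUnion.2 ⟨i, not_lt.1 (show ¬ R' < N (l i) (heisDiff i x) from h)⟩)
      _ ≤ 2 * CH * I := by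
          rw [ENNReal.tsum_mul_left, mul_comm 2, mul_assoc]
          gcongr
  have hsplit : {x | 2 * a < ‖opConv k f x‖ₑ} ⊆ {x | a < ‖opConv k g x‖ₑ} ∪
      (Ωs ∪ {x | x ∉ Ωs ∧ a < ‖opConv k (f - g) x‖ₑ}) := by
    intro x hx
    by_contra h
    simp only [mem_union, mem_ofPred_eq, not_or, not_lt, not_and] at h
    have h1 := h.2.2 h.2.1
    have e : opConv k f x = opConv k g x + opConv k (f - g) x := by
      rw [opConv_sub hk hkc le_rfl le_rfl (memLp_one_iff_integrable.2 hfi)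
        (memLp_one_iff_integrable.2 hgi)]
      abel
    have h3 : ‖opConv k f x‖ₑ ≤ 2 * a := by
      rw [e, two_mul]
      exact (enorm_add_le _ _).trans (add_le_add h.1 h1)
    exact absurd hx (not_lt.2 h3)
  calc a * volume {x | 2 * a < ‖opConv k f x‖ₑ}
      ≤ a * (volume {x | a < ‖opConv k g x‖ₑ} + (volume Ωs
          + volume {x | x ∉ Ωs ∧ a < ‖opConv k (f - g) x‖ₑ})) := by
        gcongr
        refine (measure_mono hsplit).trans ((measure_union_le _ _).trans ?_)
        gcongr
        exact measure_union_le _ _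
    _ = a * volume {x | a < ‖opConv k g x‖ₑ} + (a * volume Ωs
          + a * volume {x | x ∉ Ωs ∧ a < ‖opConv k (f - g) x‖ₑ}) := by ring
    _ ≤ A * (1 + 2 * M) * I + (ENNReal.ofReal (R' ^ 3) * I + 2 * CH * I) := by gcongr
    _ = _ := by ring

end OpConv

/-! ### Interpolation between weak type (1,1) and strong type (2,2) -/

theorem lintegral_Ioc_rpow {r s : ℝ} (hr : -1 < r) (hs : 0 ≤ s) :
    ∫⁻ t in Ioc 0 s, ENNReal.ofReal (t ^ r) = ENNReal.ofReal (s ^ (r + 1) / (r + 1)) := by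
  have hi : IntervalIntegrable (fun t : ℝ => t ^ r) volume 0 s :=
    intervalIntegral.intervalIntegrable_rpow' hr
  rw [← ofReal_integral_eq_lintegral_ofReal
    ((intervalIntegrable_iff_integrableOn_Ioc_of_le hs).1 hi)
    ((ae_restrict_iff' measurableSet_Ioc).2 (ae_of_all _ fun t ht => Real.rpow_nonneg ht.1.le r)),
    ← intervalIntegral.integral_of_le hs, integral_rpow (Or.inl hr),
    Real.zero_rpow (by linarith), sub_zero]

theorem lintegral_Ioi_rpow {r s : ℝ} (hr : r < -1) (hs : 0 < s) :
    ∫⁻ t in Ioi s, ENNReal.ofReal (t ^ r) = ENNReal.ofReal (-s ^ (r + 1) / (r + 1)) := by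
  rw [← ofReal_integral_eq_lintegral_ofReal (integrableOn_Ioi_rpow_of_lt hr hs)
    ((ae_restrict_iff' measurableSet_Ioi).2
      (ae_of_all _ fun t ht => Real.rpow_nonneg (hs.trans ht).le r)),
    integral_Ioi_rpow_of_lt hr hs]

/-- The contribution of the part of `f` above height `t / 3`. -/
theorem lintegral_high_part {p s : ℝ} (hp : 1 < p) (hs : 0 ≤ s) :
    ∫⁻ t in Ioi 0, ENNReal.ofReal (t⁻¹ * (if t < 3 * s then s else 0))
        * ENNReal.ofReal (t ^ (p - 1))
      ≤ ENNReal.ofReal (3 ^ (p - 1) / (p - 1)) * ENNReal.ofReal (s ^ p) := by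
  rcases hs.eq_or_lt with rfl | hs
  · have : ∫⁻ t in Ioi (0 : ℝ), ENNReal.ofReal (t⁻¹ * (if t < 3 * 0 then 0 else 0))
        * ENNReal.ofReal (t ^ (p - 1)) = 0 := by simp
    rw [this]; exact bot_le
  have h1 : ∀ t ∈ Ioi (0 : ℝ), ENNReal.ofReal (t⁻¹ * (if t < 3 * s then s else 0))
      * ENNReal.ofReal (t ^ (p - 1))
      ≤ ENNReal.ofReal s * (Ioc 0 (3 * s)).indicator (fun t => ENNReal.ofReal (t ^ (p - 2))) t := by
    intro t ht
    have ht0 : 0 < t := ht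
    split_ifs with h
    · rw [indicator_of_mem (show t ∈ Ioc 0 (3 * s) from ⟨ht, h.le⟩),
        ← ENNReal.ofReal_mul (by positivity), ← ENNReal.ofReal_mul hs.le]
      refine ENNReal.ofReal_le_ofReal (le_of_eq ?_)
      have : t ^ (p - 1) = t ^ (p - 2) * t := by
        rw [← Real.rpow_add_one ht0.ne']; congr 1; ring
      rw [this]
      field_simp
    · simp
  calc _ ≤ ∫⁻ t in Ioi (0 : ℝ), ENNReal.ofReal s
          * (Ioc 0 (3 * s)).indicator (fun t => ENNReal.ofReal (t ^ (p - 2))) t :=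
        setLIntegral_mono' measurableSet_Ioi h1
    _ ≤ ∫⁻ t, ENNReal.ofReal s
          * (Ioc 0 (3 * s)).indicator (fun t => ENNReal.ofReal (t ^ (p - 2))) t :=
        setLIntegral_le_lintegral _ _
    _ = ENNReal.ofReal s * ∫⁻ t in Ioc 0 (3 * s), ENNReal.ofReal (t ^ (p - 2)) := by
        rw [lintegral_const_mul' _ _ ENNReal.ofReal_ne_top, lintegral_indicator measurableSet_Ioc]
    _ ≤ _ := by
        rw [lintegral_Ioc_rpow (by linarith) (by positivity), ← ENNReal.ofReal_mul hs.le,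
          ← ENNReal.ofReal_mul (by have : 0 < p - 1 := by linarith
                                   positivity)]
        refine ENNReal.ofReal_le_ofReal (le_of_eq ?_)
        have e1 : p - 2 + 1 = p - 1 := by ring
        have e2 : s ^ p = s ^ (p - 1) * s := by
          rw [← Real.rpow_add_one hs.ne']; congr 1; ring
        rw [e1, e2, Real.mul_rpow (by norm_num) hs.le]
        ring

/-- The contribution of the part of `f` below height `t`. -/
theorem lintegral_low_part {p s : ℝ} (hp : 1 < p) (hp2 : p < 2) (hs : 0 ≤ s) :
    ∫⁻ t in Ioi 0, ENNReal.ofReal (t⁻¹ ^ 2 * min s t ^ 2) * ENNReal.ofReal (t ^ (p - 1))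
      ≤ ENNReal.ofReal (1 / p + 1 / (2 - p)) * ENNReal.ofReal (s ^ p) := by
  rcases hs.eq_or_lt with rfl | hs
  · have : ∫⁻ t in Ioi (0 : ℝ), ENNReal.ofReal (t⁻¹ ^ 2 * min 0 t ^ 2)
        * ENNReal.ofReal (t ^ (p - 1)) = 0 := by
      rw [setLIntegral_congr_fun measurableSet_Ioi (g := fun _ => 0)]
      · simp
      · intro t ht
        simp [min_eq_left (le_of_lt (show (0 : ℝ) < t from ht))]
    rw [this]; exact bot_le
  have hp' : 0 < 2 - p := by linarith
  have e : Ioi (0 : ℝ) = Ioc 0 s ∪ Ioi s := (Ioc_union_Ioi_eq_Ioi hs.le).symm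
  have h1 : ∫⁻ t in Ioc 0 s, ENNReal.ofReal (t⁻¹ ^ 2 * min s t ^ 2) * ENNReal.ofReal (t ^ (p - 1))
      = ∫⁻ t in Ioc 0 s, ENNReal.ofReal (t ^ (p - 1)) := by
    refine setLIntegral_congr_fun measurableSet_Ioc fun t ht => ?_
    have : t⁻¹ ^ 2 * min s t ^ 2 = 1 := by
      rw [min_eq_right ht.2]
      have := ht.1.ne'
      field_simp
    change ENNReal.ofReal (t⁻¹ ^ 2 * min s t ^ 2) * _ = _
    rw [this, ENNReal.ofReal_one, one_mul]
  have h2 : ∫⁻ t in Ioi s, ENNReal.ofReal (t⁻¹ ^ 2 * min s t ^ 2) * ENNReal.ofReal (t ^ (p - 1))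
      = ∫⁻ t in Ioi s, ENNReal.ofReal (s ^ 2) * ENNReal.ofReal (t ^ (p - 3)) := by
    refine setLIntegral_congr_fun measurableSet_Ioi fun t ht => ?_
    have ht0 : 0 < t := hs.trans ht
    rw [min_eq_left (le_of_lt ht), ← ENNReal.ofReal_mul (by positivity),
      ← ENNReal.ofReal_mul (by positivity)]
    have : t ^ (p - 1) = t ^ (p - 3) * t ^ (2 : ℕ) := by
      rw [← Real.rpow_add_natCast ht0.ne']; congr 1; push_cast; ring
    rw [this]
    congr 1
    field_simp
  rw [e, lintegral_union measurableSet_Ioi (by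
    rw [disjoint_left]; exact fun t h1 h2 => not_lt.2 h1.2 h2), h1, h2,
    lintegral_const_mul' _ _ ENNReal.ofReal_ne_top, lintegral_Ioc_rpow (by linarith) hs.le,
    lintegral_Ioi_rpow (by linarith) hs, ← ENNReal.ofReal_mul (by positivity)]
  have e2 : s ^ (2 : ℕ) * (-s ^ (p - 3 + 1) / (p - 3 + 1)) = s ^ p / (2 - p) := by
    have : s ^ p = s ^ (p - 2) * s ^ (2 : ℕ) := by
      rw [← Real.rpow_add_natCast hs.ne']; congr 1; push_cast; ring
    rw [this, show p - 3 + 1 = p - 2 by ring]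
    have h3 : p - 2 ≠ 0 := by linarith
    have h4 : 2 - p ≠ 0 := by linarith
    field_simp
    ring
  rw [e2, sub_add_cancel, ← ENNReal.ofReal_add (by positivity) (by positivity),
    ← ENNReal.ofReal_mul (by positivity)]
  exact ENNReal.ofReal_le_ofReal (le_of_eq (by ring))

/-- The constant of the interpolation inequality. -/
def interpConst (p : ℝ) (C A : ℝ≥0∞) : ℝ≥0∞ :=
  ENNReal.ofReal p * (3 * C * ENNReal.ofReal (3 ^ (p - 1) / (p - 1))
    + 9 * A * ENNReal.ofReal (1 / p + 1 / (2 - p)))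

theorem interpConst_ne_top {p : ℝ} {C A : ℝ≥0∞} (hC : C ≠ ∞) (hA : A ≠ ∞) :
    interpConst p C A ≠ ∞ := by
  unfold interpConst
  finiteness

/-- If the distribution function of `h` is controlled by the truncations of `f` then the `p`-th
moments are comparable. -/
theorem lintegral_rpow_le_of_distribution_le {X : Type*} [MeasurableSpace X] {μ : Measure X}
    [SFinite μ] {f h : X → ℝ} (hf : Measurable f) (hf0 : ∀ x, 0 ≤ f x) (hh : AEMeasurable h μ)
    (hh0 : ∀ x, 0 ≤ h x) {C A : ℝ≥0∞} {p : ℝ} (hp : 1 < p) (hp2 : p < 2)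
    (H : ∀ t, 0 < t → μ {x | t < h x}
      ≤ 3 * C * ∫⁻ x, ENNReal.ofReal (t⁻¹ * (if t < 3 * f x then f x else 0)) ∂μ
        + 9 * A * ∫⁻ x, ENNReal.ofReal (t⁻¹ ^ 2 * min (f x) t ^ 2) ∂μ) :
    ∫⁻ x, ENNReal.ofReal (h x ^ p) ∂μ ≤ interpConst p C A * ∫⁻ x, ENNReal.ofReal (f x ^ p) ∂μ := by
  have hp0 : 0 < p := by linarith
  have m1 : Measurable fun q : ℝ × X =>
      ENNReal.ofReal (q.1⁻¹ * (if q.1 < 3 * f q.2 then f q.2 else 0)) := by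
    refine Measurable.ennreal_ofReal (measurable_fst.inv.mul (Measurable.ite ?_ ?_ ?_))
    · exact measurableSet_lt measurable_fst (measurable_const.mul (hf.comp measurable_snd))
    · exact hf.comp measurable_snd
    · exact measurable_const
  have m2 : Measurable fun q : ℝ × X =>
      ENNReal.ofReal (q.1⁻¹ ^ 2 * min (f q.2) q.1 ^ 2) := by
    refine Measurable.ennreal_ofReal ((measurable_fst.inv.pow_const 2).mul
      (((hf.comp measurable_snd).min measurable_fst).pow_const 2))
  have mt : Measurable fun t : ℝ => ENNReal.ofReal (t ^ (p - 1)) :=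
    (measurable_id.pow_const _).ennreal_ofReal
  have swap : ∀ {G : ℝ × X → ℝ≥0∞}, Measurable G →
      ∫⁻ t in Ioi 0, (∫⁻ x, G (t, x) ∂μ) * ENNReal.ofReal (t ^ (p - 1))
        = ∫⁻ x, (∫⁻ t in Ioi 0, G (t, x) * ENNReal.ofReal (t ^ (p - 1))) ∂μ := by
    intro G hG
    rw [← lintegral_lintegral_swap (f := fun t x => G (t, x) * ENNReal.ofReal (t ^ (p - 1)))]
    · refine lintegral_congr fun t => ?_
      exact (lintegral_mul_const _ (show Measurable fun x => G (t, x) from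
        hG.comp measurable_prodMk_left)).symm
    · exact (hG.mul (mt.comp measurable_fst)).aemeasurable
  rw [lintegral_rpow_eq_lintegral_meas_lt_mul μ (ae_of_all _ hh0) hh hp0, interpConst, mul_assoc]
  gcongr
  calc ∫⁻ t in Ioi 0, μ {x | t < h x} * ENNReal.ofReal (t ^ (p - 1))
      ≤ ∫⁻ t in Ioi 0, (3 * C * ((∫⁻ x, ENNReal.ofReal (t⁻¹ * (if t < 3 * f x then f x else 0)) ∂μ)
            * ENNReal.ofReal (t ^ (p - 1)))
          + 9 * A * ((∫⁻ x, ENNReal.ofReal (t⁻¹ ^ 2 * min (f x) t ^ 2) ∂μ)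
            * ENNReal.ofReal (t ^ (p - 1)))) := by
        refine setLIntegral_mono' measurableSet_Ioi fun t ht => ?_
        rw [← mul_assoc, ← mul_assoc, ← add_mul]
        gcongr
        exact H t ht
    _ = 3 * C * (∫⁻ t in Ioi 0, (∫⁻ x, ENNReal.ofReal
            (t⁻¹ * (if t < 3 * f x then f x else 0)) ∂μ) * ENNReal.ofReal (t ^ (p - 1)))
          + 9 * A * ∫⁻ t in Ioi 0, (∫⁻ x, ENNReal.ofReal (t⁻¹ ^ 2 * min (f x) t ^ 2) ∂μ)
            * ENNReal.ofReal (t ^ (p - 1)) := by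
        have a1 : Measurable fun t : ℝ => (∫⁻ x, ENNReal.ofReal
            (t⁻¹ * (if t < 3 * f x then f x else 0)) ∂μ) * ENNReal.ofReal (t ^ (p - 1)) :=
          (m1.lintegral_prod_right' (ν := μ)).mul mt
        have a2 : Measurable fun t : ℝ => (∫⁻ x, ENNReal.ofReal
            (t⁻¹ ^ 2 * min (f x) t ^ 2) ∂μ) * ENNReal.ofReal (t ^ (p - 1)) :=
          (m2.lintegral_prod_right' (ν := μ)).mul mt
        rw [lintegral_add_left (a1.const_mul _), lintegral_const_mul _ a1, lintegral_const_mul _ a2]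
    _ ≤ 3 * C * (ENNReal.ofReal (3 ^ (p - 1) / (p - 1)) * ∫⁻ x, ENNReal.ofReal (f x ^ p) ∂μ)
          + 9 * A * (ENNReal.ofReal (1 / p + 1 / (2 - p))
            * ∫⁻ x, ENNReal.ofReal (f x ^ p) ∂μ) := by
        rw [swap m1, swap m2, ← lintegral_const_mul' _ _ ENNReal.ofReal_ne_top,
          ← lintegral_const_mul' _ _ ENNReal.ofReal_ne_top]
        refine add_le_add (mul_le_mul' le_rfl (lintegral_mono fun x => ?_))
          (mul_le_mul' le_rfl (lintegral_mono fun x => ?_))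
        · exact lintegral_high_part hp (hf0 x)
        · exact lintegral_low_part hp hp2 (hf0 x)
    _ = _ := by ring

section Truncation

variable {E F : Type*} [NormedAddCommGroup E] [NormedSpace ℝ E] [NormedAddCommGroup F]
  [NormedSpace ℝ F]

/-- The function `f` cut off at height `a`: values of norm above `a` are scaled back to norm `a`. Unlike
a sharp cut, this preserves continuity. -/
def truncate (a : ℝ) (f : (Fin 3 → ℝ) → E) (x : Fin 3 → ℝ) : E := (a / max a ‖f x‖) • f x

theorem continuous_truncate {a : ℝ} (ha : 0 < a) {f : (Fin 3 → ℝ) → E} (hf : Continuous f) :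
    Continuous (truncate a f) :=
  (continuous_const.div (continuous_const.max hf.norm)
    fun _ => (ha.trans_le (le_max_left _ _)).ne').smul hf

theorem hasCompactSupport_truncate (a : ℝ) {f : (Fin 3 → ℝ) → E} (hf : HasCompactSupport f) :
    HasCompactSupport (truncate a f) :=
  HasCompactSupport.mono hf fun x hx => by
    contrapose! hx
    simp only [Function.mem_support, not_not] at hx ⊢
    simp [truncate, hx]

theorem norm_truncate {a : ℝ} (ha : 0 < a) (f : (Fin 3 → ℝ) → E) (x : Fin 3 → ℝ) :
    ‖truncate a f x‖ = min ‖f x‖ a := by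
  have hm : 0 < max a ‖f x‖ := ha.trans_le (le_max_left _ _)
  rw [truncate, norm_smul, Real.norm_of_nonneg (by positivity)]
  rcases le_total a ‖f x‖ with h | h
  · have : 0 < ‖f x‖ := ha.trans_le h
    rw [max_eq_right h, min_eq_right h]; field_simp
  · rw [max_eq_left h, min_eq_left h]; field_simp

theorem norm_sub_truncate_le {a : ℝ} (ha : 0 < a) (f : (Fin 3 → ℝ) → E) (x : Fin 3 → ℝ) :
    ‖f x - truncate a f x‖ ≤ if a < ‖f x‖ then ‖f x‖ else 0 := by
  have hm : 0 < max a ‖f x‖ := ha.trans_le (le_max_left _ _)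
  have e : f x - truncate a f x = (1 - a / max a ‖f x‖) • f x := by
    rw [sub_smul, one_smul, truncate]
  split_ifs with h
  · rw [e, norm_smul]
    refine mul_le_of_le_one_left (norm_nonneg _) ?_
    have h1 : a / max a ‖f x‖ ≤ 1 := (div_le_one hm).2 (le_max_left _ _)
    have h2 : 0 ≤ a / max a ‖f x‖ := by positivity
    rw [Real.norm_of_nonneg (by linarith)]; linarith
  · rw [e, max_eq_left (not_lt.1 h), div_self ha.ne', sub_self, zero_smul, norm_zero]

theorem enorm_rpow_eq_ofReal {V : Type*} [NormedAddCommGroup V] (v : V) {p : ℝ} (hp : 0 ≤ p) :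
    ‖v‖ₑ ^ p = ENNReal.ofReal (‖v‖ ^ p) := by
  rw [← ofReal_norm, ENNReal.ofReal_rpow_of_nonneg (norm_nonneg _) hp]

/-- Marcinkiewicz interpolation. At height `t` the function is cut off at `t / 3`; the part above the
cut is handled by the weak type bound and the part below it by the `L²` bound. -/
theorem lintegral_opConv_rpow_le_of_weak_type {k : (Fin 3 → ℝ) → E →L[ℝ] F}
    (hk : Continuous k) (hkc : HasCompactSupport k) {C A : ℝ≥0∞}
    (h1 : ∀ f : (Fin 3 → ℝ) → E, Continuous f → HasCompactSupport f → ∀ a : ℝ≥0∞, a ≠ 0 → a ≠ ∞ →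
      a * volume {x | 2 * a < ‖opConv k f x‖ₑ} ≤ C * ∫⁻ x, ‖f x‖ₑ)
    (h2 : ∀ g, AEStronglyMeasurable g → ∫⁻ x, ‖opConv k g x‖ₑ ^ 2 ≤ A * ∫⁻ x, ‖g x‖ₑ ^ 2)
    {p : ℝ} (hp : 1 < p) (hp2 : p < 2) {f : (Fin 3 → ℝ) → E} (hf : Continuous f)
    (hfc : HasCompactSupport f) :
    ∫⁻ x, ‖opConv k f x‖ₑ ^ p ≤ interpConst p C A * ∫⁻ x, ‖f x‖ₑ ^ p := by
  have hp0 : 0 < p := by linarith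
  simp only [enorm_rpow_eq_ofReal _ hp0.le]
  refine lintegral_rpow_le_of_distribution_le hf.norm.measurable (fun x => norm_nonneg _)
    (aestronglyMeasurable_opConv hk hf.aestronglyMeasurable).norm.aemeasurable
    (fun x => norm_nonneg _) hp hp2 fun t ht => ?_
  set a := t / 3 with ha
  have ha0 : 0 < a := by positivity
  set g := truncate a f with hg
  have hgc := continuous_truncate ha0 hf
  have hgs := hasCompactSupport_truncate a hfc
  have hac : ENNReal.ofReal a ≠ 0 := (ENNReal.ofReal_pos.2 ha0).ne'
  have hsplit : {x | t < ‖opConv k f x‖} ⊆ {x | 2 * ENNReal.ofReal a < ‖opConv k (f - g) x‖ₑ} ∪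
      {x | ENNReal.ofReal a ≤ ‖opConv k g x‖ₑ} := by
    intro x hx
    by_contra h
    simp only [mem_union, mem_ofPred_eq, not_or, not_lt, not_le] at h hx
    have e : opConv k f x = opConv k (f - g) x + opConv k g x := by
      rw [opConv_sub hk hkc le_rfl le_rfl (hf.memLp_of_hasCompactSupport hfc)
        (hgc.memLp_of_hasCompactSupport hgs)]
      abel
    have i1 : ‖opConv k (f - g) x‖ ≤ 2 * a := by
      have := h.1
      rw [← ofReal_norm, show (2 : ℝ≥0∞) = ENNReal.ofReal 2 by simp,
        ← ENNReal.ofReal_mul (by norm_num)] at this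
      exact (ENNReal.ofReal_le_ofReal_iff (by positivity)).1 this
    have i2 : ‖opConv k g x‖ < a := by
      have := h.2
      rw [← ofReal_norm] at this
      exact (ENNReal.ofReal_lt_ofReal_iff ha0).1 this
    have i3 := norm_add_le (opConv k (f - g) x) (opConv k g x)
    rw [← e] at i3
    linarith
  have b1 : volume {x | 2 * ENNReal.ofReal a < ‖opConv k (f - g) x‖ₑ}
      ≤ 3 * C * ∫⁻ x, ENNReal.ofReal (t⁻¹ * (if t < 3 * ‖f x‖ then ‖f x‖ else 0)) := by
    have := h1 (f - g) (hf.sub hgc) (hfc.sub hgs) (ENNReal.ofReal a) hac ENNReal.ofReal_ne_top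
    rw [mul_comm, ← ENNReal.le_div_iff_mul_le (Or.inl hac) (Or.inl ENNReal.ofReal_ne_top)] at this
    refine this.trans ?_
    have e1 : ∫⁻ x, ‖(f - g) x‖ₑ
        ≤ ∫⁻ x, ENNReal.ofReal t * ENNReal.ofReal (t⁻¹ * (if t < 3 * ‖f x‖ then ‖f x‖ else 0)) := by
      refine lintegral_mono fun x => ?_
      rw [← ENNReal.ofReal_mul ht.le, ← mul_assoc, mul_inv_cancel₀ ht.ne', one_mul,
        ← ofReal_norm]
      refine ENNReal.ofReal_le_ofReal ((norm_sub_truncate_le ha0 f x).trans (le_of_eq ?_))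
      simp only [ha, div_lt_iff₀ (by norm_num : (0:ℝ) < 3), mul_comm]
    rw [lintegral_const_mul' _ _ ENNReal.ofReal_ne_top] at e1
    rw [ENNReal.div_le_iff hac ENNReal.ofReal_ne_top]
    refine (mul_le_mul' le_rfl e1).trans (le_of_eq ?_)
    have e2 : ENNReal.ofReal t = 3 * ENNReal.ofReal a := by
      rw [show (3 : ℝ≥0∞) = ENNReal.ofReal 3 by simp, ← ENNReal.ofReal_mul (by norm_num)]
      congr 1; rw [ha]; ring
    rw [e2]; ring
  have b2 : volume {x | ENNReal.ofReal a ≤ ‖opConv k g x‖ₑ}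
      ≤ 9 * A * ∫⁻ x, ENNReal.ofReal (t⁻¹ ^ 2 * min ‖f x‖ t ^ 2) := by
    have hsub : {x | ENNReal.ofReal a ≤ ‖opConv k g x‖ₑ}
        ⊆ {x | ENNReal.ofReal a ^ 2 ≤ ‖opConv k g x‖ₑ ^ 2} := fun x hx =>
      pow_le_pow_left' (show ENNReal.ofReal a ≤ ‖opConv k g x‖ₑ from hx) 2
    have := (mul_meas_ge_le_lintegral₀ ((aestronglyMeasurable_opConv hk
      hgc.aestronglyMeasurable).enorm.pow_const 2) (ENNReal.ofReal a ^ 2)).trans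
      (h2 g hgc.aestronglyMeasurable)
    have hac2 : ENNReal.ofReal a ^ 2 ≠ 0 := pow_ne_zero 2 hac
    have hac3 : ENNReal.ofReal a ^ 2 ≠ ∞ := ENNReal.pow_ne_top ENNReal.ofReal_ne_top
    rw [mul_comm, ← ENNReal.le_div_iff_mul_le (Or.inl hac2) (Or.inl hac3)] at this
    refine (measure_mono hsub).trans (this.trans ?_)
    have e1 : ∫⁻ x, ‖g x‖ₑ ^ 2
        ≤ ∫⁻ x, ENNReal.ofReal (t ^ 2) * ENNReal.ofReal (t⁻¹ ^ 2 * min ‖f x‖ t ^ 2) := by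
      refine lintegral_mono fun x => ?_
      rw [← ENNReal.ofReal_mul (by positivity), ← mul_assoc, ← mul_pow, mul_inv_cancel₀ ht.ne',
        one_pow, one_mul, ← ofReal_norm, ← ENNReal.ofReal_pow (norm_nonneg _)]
      refine ENNReal.ofReal_le_ofReal ?_
      rw [norm_truncate ha0]
      refine pow_le_pow_left₀ (le_min (norm_nonneg _) ha0.le) (min_le_min le_rfl ?_) 2
      rw [ha]; linarith
    rw [lintegral_const_mul' _ _ ENNReal.ofReal_ne_top] at e1
    rw [ENNReal.div_le_iff hac2 hac3]
    refine (mul_le_mul' le_rfl e1).trans (le_of_eq ?_)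
    have e2 : ENNReal.ofReal (t ^ 2) = 9 * ENNReal.ofReal a ^ 2 := by
      rw [show (9 : ℝ≥0∞) = ENNReal.ofReal 9 by simp, ← ENNReal.ofReal_pow ha0.le,
        ← ENNReal.ofReal_mul (by norm_num)]
      congr 1; rw [ha]; ring
    rw [e2]; ring
  exact (measure_mono hsplit).trans ((measure_union_le _ _).trans (add_le_add b1 b2))

/-- Passage from compactly supported continuous functions to all of `L^p`. -/
theorem eLpNorm_opConv_le_of_dense {k : (Fin 3 → ℝ) → E →L[ℝ] F}
    (hk : Continuous k) (hkc : HasCompactSupport k) {p : ℝ≥0∞} (hp : 1 ≤ p) (hp' : p ≠ ∞)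
    {D : ℝ≥0∞} (hD : D ≠ ∞)
    (H : ∀ f : (Fin 3 → ℝ) → E, Continuous f → HasCompactSupport f →
      ∫⁻ x, ‖opConv k f x‖ₑ ^ p.toReal ≤ D * ∫⁻ x, ‖f x‖ₑ ^ p.toReal)
    {f : (Fin 3 → ℝ) → E} (hf : MemLp f p) :
    eLpNorm (opConv k f) p ≤ D ^ (1 / p.toReal) * eLpNorm f p := by
  have hp0 : p ≠ 0 := (zero_lt_one.trans_le hp).ne'
  have hpr : 1 ≤ p.toReal := by
    simpa using ENNReal.toReal_mono hp' hp
  have toNorm : ∀ {D' : ℝ≥0∞} (h : (Fin 3 → ℝ) → E),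
      ∫⁻ x, ‖opConv k h x‖ₑ ^ p.toReal ≤ D' * ∫⁻ x, ‖h x‖ₑ ^ p.toReal →
      eLpNorm (opConv k h) p ≤ D' ^ (1 / p.toReal) * eLpNorm h p := by
    intro D' h hh
    rw [eLpNorm_eq_lintegral_rpow_enorm_toReal hp0 hp',
      eLpNorm_eq_lintegral_rpow_enorm_toReal hp0 hp',
      ← ENNReal.mul_rpow_of_nonneg _ _ (by positivity)]
    exact ENNReal.rpow_le_rpow hh (by positivity)
  set D₁ := D ^ (1 / p.toReal) with hD₁
  set Y := ((∫⁻ y, ‖k y‖ₑ) ^ p.toReal) ^ (1 / p.toReal) with hY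
  have hD₁t : D₁ ≠ ∞ := ENNReal.rpow_ne_top_of_nonneg (by positivity) hD
  have hYt : Y ≠ ∞ := by
    have : ∫⁻ y, ‖k y‖ₑ ≠ ∞ := (hk.integrable_of_hasCompactSupport hkc).2.ne
    exact ENNReal.rpow_ne_top_of_nonneg (by positivity)
      (ENNReal.rpow_ne_top_of_nonneg (by positivity) this)
  have key : ∀ δ : ℝ≥0∞, δ ≠ 0 →
      eLpNorm (opConv k f) p ≤ D₁ * eLpNorm f p + (D₁ + Y) * δ := by
    intro δ hδ
    obtain ⟨g, hgc, hgd, hgcont, hgm⟩ := hf.exists_hasCompactSupport_eLpNorm_sub_le hp' hδ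
    have e : opConv k f = opConv k (f - g) + opConv k g := by
      ext x
      rw [Pi.add_apply, opConv_sub hk hkc hp hp hf hgm]
      abel
    have n1 : eLpNorm (opConv k (f - g)) p ≤ Y * δ :=
      (toNorm _ (lintegral_opConv_rpow_le hk (hf.1.sub hgm.1) hpr)).trans (by gcongr)
    have n2 : eLpNorm (opConv k g) p ≤ D₁ * (eLpNorm f p + δ) := by
      refine (toNorm _ (H g hgcont hgc)).trans ?_
      gcongr
      have : g = f - (f - g) := by abel
      rw [this]
      exact (eLpNorm_sub_le hf.1 (hf.1.sub hgm.1) hp).trans (by gcongr)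
    have n3 : eLpNorm (opConv k f) p ≤ eLpNorm (opConv k (f - g)) p + eLpNorm (opConv k g) p := by
      rw [e]
      exact eLpNorm_add_le (aestronglyMeasurable_opConv hk (hf.1.sub hgm.1))
        (aestronglyMeasurable_opConv hk hgm.1) hp
    have n4 := n3.trans (add_le_add n1 n2)
    refine n4.trans (le_of_eq ?_)
    ring
  refine ENNReal.le_of_forall_pos_le_add fun ε hε _ => ?_
  have hS : D₁ + Y ≠ ∞ := ENNReal.add_ne_top.2 ⟨hD₁t, hYt⟩
  have hδ : (ε : ℝ≥0∞) / (D₁ + Y + 1) ≠ 0 :=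
    (ENNReal.div_pos (by exact_mod_cast hε.ne') (ENNReal.add_ne_top.2 ⟨hS, by simp⟩)).ne'
  refine (key _ hδ).trans (add_le_add le_rfl ?_)
  rw [← mul_div_assoc]
  refine ENNReal.div_le_of_le_mul ?_
  rw [mul_comm]
  exact mul_le_mul' le_rfl (self_le_add_right _ _)

end Truncation

/-! ### Bump functions adapted to the matrices `Ã(t)` -/

/-- A Lipschitz function supported in the unit ball of the sup norm. -/
structure IsBump (ς : (Fin 3 → ℝ) → ℂ) (L : ℝ≥0) : Prop where
  lipschitz : LipschitzWith L ς
  eq_zero : ∀ u, 1 < ‖u‖ → ς u = 0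

namespace IsBump

variable {ς : (Fin 3 → ℝ) → ℂ} {L : ℝ≥0}

theorem continuous (h : IsBump ς L) : Continuous ς := h.lipschitz.continuous

theorem hasCompactSupport (h : IsBump ς L) : HasCompactSupport ς :=
  HasCompactSupport.intro (isCompact_closedBall (0 : Fin 3 → ℝ) 1) fun u hu =>
    h.eq_zero u (by simpa using hu)

theorem integrable (h : IsBump ς L) : Integrable ς :=
  h.continuous.integrable_of_hasCompactSupport h.hasCompactSupport

/-- The reflected conjugate, which produces the kernels of the adjoint operators. -/
theorem conj_neg (h : IsBump ς L) : IsBump (fun u => conj (ς (-u))) L where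
  lipschitz := by
    refine LipschitzWith.of_dist_le_mul fun u v => ?_
    rw [Complex.dist_conj_conj]
    simpa using h.lipschitz.dist_le_mul (-u) (-v)
  eq_zero u hu := by simp [h.eq_zero (-u) (by simpa using hu)]

/-- The `L¹` modulus of continuity of a bump function for the translations of all the group laws
`twist κ`, uniformly in `κ`. -/
theorem exists_modulus (h : IsBump ς L) : ∃ C : ℝ≥0, ∀ κ : ℝ, |κ| ≤ 1 → ∀ y,
    ∫⁻ u, ‖ς (twist κ y u) - ς u‖ₑ ≤ C * ENNReal.ofReal ‖y‖ := by
  set I := ∫⁻ u, ‖ς u‖ₑ with hI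
  have hIfin : I ≠ ∞ := h.integrable.2.ne
  set C₁ : ℝ≥0∞ := ENNReal.ofReal (L * 4) * ENNReal.ofReal ((2 * 3) ^ 3) with hC₁
  refine ⟨(C₁ + 2 * I).toNNReal, fun κ hκ y => ?_⟩
  rw [ENNReal.coe_toNNReal (by finiteness)]
  rcases le_or_gt ‖y‖ 1 with hy | hy
  · -- a translation by `‖y‖ ≤ 1` moves the support within the ball of radius `3`
    have hpt : ∀ u, ‖ς (twist κ y u) - ς u‖ₑ
        ≤ (Metric.closedBall (0 : Fin 3 → ℝ) 3).indicator
          (fun _ => ENNReal.ofReal (L * 4) * ENNReal.ofReal ‖y‖) u := by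
      intro u
      rcases le_or_gt ‖u‖ 3 with hu | hu
      · rw [indicator_of_mem (by simpa using hu), ← ofReal_norm,
          ← ENNReal.ofReal_mul (by positivity)]
        refine ENNReal.ofReal_le_ofReal ?_
        rw [← dist_eq_norm]
        refine (h.lipschitz.dist_le_mul _ _).trans ?_
        rw [dist_eq_norm, mul_assoc]
        refine mul_le_mul_of_nonneg_left ((norm_twist_sub_right_le hκ y u).trans ?_) L.2
        nlinarith [norm_nonneg y]
      · have h1 : 1 < ‖twist κ y u‖ := by
          by_contra! hle
          have h2 := norm_twist_le hκ (-y) (twist κ y u)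
          rw [twist_neg_twist, norm_neg] at h2
          nlinarith [norm_nonneg y, norm_nonneg (twist κ y u)]
        rw [h.eq_zero _ h1, h.eq_zero u (by linarith)]
        simp
    calc ∫⁻ u, ‖ς (twist κ y u) - ς u‖ₑ
        ≤ ∫⁻ u, (Metric.closedBall (0 : Fin 3 → ℝ) 3).indicator
          (fun _ => ENNReal.ofReal (L * 4) * ENNReal.ofReal ‖y‖) u := lintegral_mono hpt
      _ = C₁ * ENNReal.ofReal ‖y‖ := by
          rw [lintegral_indicator measurableSet_closedBall, setLIntegral_const,
            Real.volume_pi_closedBall _ (by norm_num)]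
          simp only [Fintype.card_fin, hC₁]
          ring
      _ ≤ _ := by gcongr; exact self_le_add_right _ _
  · have hm : Measurable fun u => ‖ς u‖ₑ := h.continuous.enorm.measurable
    calc ∫⁻ u, ‖ς (twist κ y u) - ς u‖ₑ ≤ ∫⁻ u, (‖ς (twist κ y u)‖ₑ + ‖ς u‖ₑ) :=
          lintegral_mono fun u => enorm_sub_le
      _ = I + I := by
          rw [lintegral_add_right _ hm, (measurePreserving_twist_left κ y).lintegral_comp hm]
      _ = 2 * I * 1 := by ring
      _ ≤ (C₁ + 2 * I) * ENNReal.ofReal ‖y‖ := by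
          gcongr
          · exact self_le_add_left _ _
          · rw [← ENNReal.ofReal_one]
            exact ENNReal.ofReal_le_ofReal hy.le

end IsBump

/-- The bump function `ς` rescaled by `Ã(t)`, normalized in `L¹`. -/
def bump (α β : ℝ → ℝ) (ς : (Fin 3 → ℝ) → ℂ) (t : ℝ) (x : Fin 3 → ℝ) : ℂ :=
  (((ATilde α β t).det⁻¹ : ℝ) : ℂ) * ς ((ATilde α β t)⁻¹ *ᵥ x)

section Bump

variable {α β : ℝ → ℝ} {ς : (Fin 3 → ℝ) → ℂ} {L : ℝ≥0}

theorem kernelD_zero (x : Fin 3 → ℝ) : kernelD α β ς 0 x = bump α β ς ((2 : ℝ)⁻¹ ^ 0) x := by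
  rw [kernelD, bump, ← det_ATildeDyadic]
  rfl

/-- The kernels are differences of consecutive bumps. -/
theorem kernelD_succ (hΓ : IsAdmissibleCurve α β) (j : ℕ) (x : Fin 3 → ℝ) :
    kernelD α β ς (j + 1) x
      = bump α β ς ((2 : ℝ)⁻¹ ^ (j + 1)) x - bump α β ς ((2 : ℝ)⁻¹ ^ j) x := by
  have h1 : (0 : ℝ) < (2 : ℝ)⁻¹ ^ (j + 1) := by positivity
  have e : SDyadic α β (j + 1) ≠ 0 := by
    rw [← det_ATildeDyadic]; exact (hΓ.det_pos h1).ne'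
  rw [kernelD, bump, bump]
  simp only [sigmaFn]
  have h2 : ATildeDyadic α β (j + 1) *ᵥ ((ATildeDyadic α β (j + 1))⁻¹ *ᵥ x) = x :=
    hΓ.mulVec_inv_mulVec h1 x
  rw [h2, mul_sub, ← mul_assoc, ← Complex.ofReal_mul, ← mul_div_assoc, inv_mul_cancel₀ e, one_div,
    ← det_ATildeDyadic, ← det_ATildeDyadic]
  rfl

theorem adjKernel_bump (t : ℝ) (x : Fin 3 → ℝ) :
    adjKernel (bump α β ς t) x = bump α β (fun u => conj (ς (-u))) t x := by
  simp [adjKernel, bump, heisInv_eq_neg, Matrix.mulVec_neg]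

/-- The adjoint operators are the operators `𝒟_j` for the reflected conjugate of `ς`. -/
theorem adjKernel_kernelD (hΓ : IsAdmissibleCurve α β) (j : ℕ) :
    adjKernel (kernelD α β ς j) = kernelD α β (fun u => conj (ς (-u))) j := by
  ext x
  cases j with
  | zero => rw [kernelD_zero, ← adjKernel_bump, adjKernel, adjKernel, kernelD_zero]
  | succ j =>
    rw [kernelD_succ hΓ, ← adjKernel_bump, ← adjKernel_bump, adjKernel, kernelD_succ hΓ, map_sub]
    rfl

theorem IsBump.continuous_bump (hς : IsBump ς L) (t : ℝ) : Continuous (bump α β ς t) :=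
  continuous_const.mul
    (hς.continuous.comp (Continuous.matrix_mulVec continuous_const continuous_id))

theorem IsBump.bump_eq_zero (hς : IsBump ς L) {t : ℝ} {x : Fin 3 → ℝ}
    (hx : 1 < scaleNorm α β t x) : bump α β ς t x = 0 := by
  rw [bump, hς.eq_zero _ hx, mul_zero]

theorem IsBump.hasCompactSupport_bump (hς : IsBump ς L) (hΓ : IsAdmissibleCurve α β) {t : ℝ}
    (ht : 0 < t) : HasCompactSupport (bump α β ς t) := by
  have hc : IsCompact ((fun v => ATilde α β t *ᵥ v) '' Metric.closedBall 0 1) :=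
    (isCompact_closedBall _ _).image (Continuous.matrix_mulVec continuous_const continuous_id)
  refine HasCompactSupport.intro hc fun x hx => hς.bump_eq_zero ?_
  by_contra! h
  refine hx ⟨(ATilde α β t)⁻¹ *ᵥ x, by simpa [scaleNorm] using h, hΓ.mulVec_inv_mulVec ht x⟩

theorem enorm_bump (hΓ : IsAdmissibleCurve α β) {t : ℝ} (ht : 0 < t) (x y : Fin 3 → ℝ) :
    ‖bump α β ς t x - bump α β ς t y‖ₑ = (ENNReal.ofReal (ATilde α β t).det)⁻¹
      * ‖ς ((ATilde α β t)⁻¹ *ᵥ x) - ς ((ATilde α β t)⁻¹ *ᵥ y)‖ₑ := by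
  have hd := hΓ.det_pos ht
  rw [bump, bump, ← mul_sub, enorm_mul, ← ENNReal.ofReal_inv_of_pos hd]
  congr 1
  rw [← ofReal_norm, Complex.norm_real, Real.norm_of_nonneg (inv_nonneg.2 hd.le)]

theorem lintegral_comp_scale (hΓ : IsAdmissibleCurve α β) {t : ℝ} (ht : 0 < t)
    {g : (Fin 3 → ℝ) → ℝ≥0∞} (hg : Measurable g) :
    ∫⁻ x, (ENNReal.ofReal (ATilde α β t).det)⁻¹ * g ((ATilde α β t)⁻¹ *ᵥ x) = ∫⁻ u, g u := by
  have hd := hΓ.det_pos ht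
  rw [lintegral_const_mul _ (show Measurable fun x => g ((ATilde α β t)⁻¹ *ᵥ x) from
    hg.comp (measurable_inv_mulVec t)), hΓ.lintegral_comp_inv_mulVec ht hg,
    ← mul_assoc, ENNReal.inv_mul_cancel (ENNReal.ofReal_pos.2 hd).ne' ENNReal.ofReal_ne_top,
    one_mul]

theorem lintegral_enorm_bump (hς : IsBump ς L) (hΓ : IsAdmissibleCurve α β) {t : ℝ} (ht : 0 < t) :
    ∫⁻ x, ‖bump α β ς t x‖ₑ = ∫⁻ u, ‖ς u‖ₑ := by
  rw [← lintegral_comp_scale hΓ ht hς.continuous.enorm.measurable]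
  refine lintegral_congr fun x => ?_
  have hd := hΓ.det_pos ht
  rw [bump, enorm_mul, ← ENNReal.ofReal_inv_of_pos hd]
  congr 1
  rw [← ofReal_norm, Complex.norm_real, Real.norm_of_nonneg (inv_nonneg.2 hd.le)]

theorem integral_bump (hς : IsBump ς L) (hΓ : IsAdmissibleCurve α β) {t : ℝ} (ht : 0 < t) :
    ∫ x, bump α β ς t x = ∫ u, ς u := by
  have hd := hΓ.det_pos ht
  simp only [bump]
  rw [integral_const_mul, ← integral_map (f := ς) (measurable_inv_mulVec t).aemeasurable
    hς.continuous.aestronglyMeasurable, hΓ.map_inv_mulVec ht, integral_smul_measure,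
    ENNReal.toReal_ofReal hd.le, Complex.real_smul, ← mul_assoc, ← Complex.ofReal_mul,
    inv_mul_cancel₀ hd.ne', Complex.ofReal_one, one_mul]

/-- The `L¹` modulus of continuity of the rescaled bumps under left and right translations. -/
theorem IsBump.exists_bump_modulus (hς : IsBump ς L) (hΓ : IsAdmissibleCurve α β) :
    ∃ C : ℝ≥0, ∀ t, 0 < t → ∀ y,
      ∫⁻ x, ‖bump α β ς t (heisDiff y x) - bump α β ς t x‖ₑ
        ≤ C * ENNReal.ofReal (scaleNorm α β t y) ∧
      ∫⁻ x, ‖bump α β ς t (heisMul x (heisInv y)) - bump α β ς t x‖ₑ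
        ≤ C * ENNReal.ofReal (scaleNorm α β t y) := by
  obtain ⟨C, hC⟩ := hς.exists_modulus
  refine ⟨C, fun t ht y => ?_⟩
  have key : ∀ κ, |κ| ≤ 1 → ∀ z : Fin 3 → ℝ, (ATilde α β t)⁻¹ *ᵥ z
      = -((ATilde α β t)⁻¹ *ᵥ y) → ∀ T : (Fin 3 → ℝ) → (Fin 3 → ℝ),
      (∀ x, (ATilde α β t)⁻¹ *ᵥ T x
        = twist κ ((ATilde α β t)⁻¹ *ᵥ z) ((ATilde α β t)⁻¹ *ᵥ x)) →
      ∫⁻ x, ‖bump α β ς t (T x) - bump α β ς t x‖ₑ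
        ≤ C * ENNReal.ofReal (scaleNorm α β t y) := by
    intro κ hκ z hz T hT
    have e : ∀ x, ‖bump α β ς t (T x) - bump α β ς t x‖ₑ
        = (ENNReal.ofReal (ATilde α β t).det)⁻¹ * (fun u => ‖ς (twist κ ((ATilde α β t)⁻¹ *ᵥ z) u)
          - ς u‖ₑ) ((ATilde α β t)⁻¹ *ᵥ x) := fun x => by
      rw [enorm_bump hΓ ht, hT]
    simp only [e]
    have hm : Measurable fun u => ‖ς (twist κ ((ATilde α β t)⁻¹ *ᵥ z) u) - ς u‖ₑ :=
      ((hς.continuous.measurable.comp (measurePreserving_twist_left _ _).measurable).sub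
        hς.continuous.measurable).enorm
    rw [lintegral_comp_scale hΓ ht hm]
    refine (hC κ hκ _).trans (le_of_eq ?_)
    rw [hz, norm_neg, scaleNorm]
  have hκ := hΓ.abs_kappa_le ht
  have hneg : (ATilde α β t)⁻¹ *ᵥ heisInv y = -((ATilde α β t)⁻¹ *ᵥ y) := by
    rw [heisInv_eq_neg, Matrix.mulVec_neg]
  refine ⟨key _ hκ (heisInv y) hneg _ fun x => hΓ.inv_mulVec_heisMul ht _ _,
    key (-kappa α β t) (by rwa [abs_neg]) (heisInv y) hneg _ fun x => ?_⟩
  rw [hΓ.inv_mulVec_heisMul ht, twist_swap]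

end Bump

/-! ### Almost orthogonality in `L²` -/

/-- Young's inequality for operator-valued kernels. -/
theorem eLpNorm_opConv_le {E F : Type*} [NormedAddCommGroup E] [NormedSpace ℝ E]
    [NormedAddCommGroup F] [NormedSpace ℝ F] {k : (Fin 3 → ℝ) → E →L[ℝ] F}
    {f : (Fin 3 → ℝ) → E} (hk : Continuous k) (hf : AEStronglyMeasurable f) {p : ℝ≥0∞}
    (hp : 1 ≤ p) (hp' : p ≠ ∞) :
    eLpNorm (opConv k f) p ≤ (∫⁻ y, ‖k y‖ₑ) * eLpNorm f p := by
  have hp0 : p ≠ 0 := (zero_lt_one.trans_le hp).ne'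
  have hr : 1 ≤ p.toReal := by
    rw [← ENNReal.toReal_one]; exact ENNReal.toReal_mono hp' hp
  have hr0 : 0 < p.toReal := zero_lt_one.trans_le hr
  rw [eLpNorm_eq_lintegral_rpow_enorm_toReal hp0 hp',
    eLpNorm_eq_lintegral_rpow_enorm_toReal hp0 hp']
  refine (ENNReal.rpow_le_rpow (lintegral_opConv_rpow_le hk hf hr) (by positivity)).trans
    (le_of_eq ?_)
  rw [ENNReal.mul_rpow_of_nonneg _ _ (by positivity), ← ENNReal.rpow_mul,
    mul_one_div_cancel hr0.ne', ENNReal.rpow_one]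

theorem memLp_opConv {E F : Type*} [NormedAddCommGroup E] [NormedSpace ℝ E]
    [NormedAddCommGroup F] [NormedSpace ℝ F] {k : (Fin 3 → ℝ) → E →L[ℝ] F}
    {f : (Fin 3 → ℝ) → E} (hk : Continuous k) (hkc : HasCompactSupport k) {p : ℝ≥0∞}
    (hp : 1 ≤ p) (hp' : p ≠ ∞) (hf : MemLp f p) : MemLp (opConv k f) p :=
  ⟨aestronglyMeasurable_opConv hk hf.1, (eLpNorm_opConv_le hk hf.1 hp hp').trans_lt
    (ENNReal.mul_lt_top (hk.integrable_of_hasCompactSupport hkc).2 hf.2)⟩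

section Scalar

variable {K L f : (Fin 3 → ℝ) → ℂ}

/-- The substitution `y = z⁻¹ x` turns `heisConv` into an integral against `K (z⁻¹ x)`. -/
theorem heisConv_eq_opConv (K f : (Fin 3 → ℝ) → ℂ) :
    heisConv K f = opConv (fun y => ContinuousLinearMap.mul ℝ ℂ (K y)) f := by
  ext x
  rw [heisConv, ← (show MeasurePreserving (heisInvEquiv.trans (heisRightEquiv x)) volume volume from
    (measurePreserving_heisMul_right x).comp measurePreserving_heisInv).integral_comp']
  refine integral_congr_ae (ae_of_all _ fun z => ?_)
  have e : (heisInvEquiv.trans (heisRightEquiv x)) z = heisDiff z x := rfl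
  have e2 : heisMul x (heisInv (heisDiff z x)) = z := by
    ext i; fin_cases i <;> simp [heisMul, heisInv, heisDiff]; ring
  simp only [e, e2, ContinuousLinearMap.mul_apply', mul_comm]

theorem continuous_mulKernel (hK : Continuous K) :
    Continuous fun y => ContinuousLinearMap.mul ℝ ℂ (K y) :=
  (ContinuousLinearMap.mul ℝ ℂ).continuous.comp hK

theorem hasCompactSupport_mulKernel (hK : HasCompactSupport K) :
    HasCompactSupport fun y => ContinuousLinearMap.mul ℝ ℂ (K y) :=
  hK.comp_left (map_zero _)

theorem enorm_mulKernel (y : Fin 3 → ℝ) : ‖ContinuousLinearMap.mul ℝ ℂ (K y)‖ₑ = ‖K y‖ₑ := by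
  rw [← ofReal_norm, ← ofReal_norm, ContinuousLinearMap.opNorm_mul_apply]

theorem aestronglyMeasurable_heisConv (hK : Continuous K) (hf : AEStronglyMeasurable f) :
    AEStronglyMeasurable (heisConv K f) := by
  rw [heisConv_eq_opConv]
  exact aestronglyMeasurable_opConv (continuous_mulKernel hK) hf

theorem eLpNorm_heisConv_le (hK : Continuous K) (hf : AEStronglyMeasurable f) {p : ℝ≥0∞}
    (hp : 1 ≤ p) (hp' : p ≠ ∞) :
    eLpNorm (heisConv K f) p ≤ (∫⁻ y, ‖K y‖ₑ) * eLpNorm f p := by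
  have h := eLpNorm_opConv_le (continuous_mulKernel hK) hf hp hp'
  simpa only [← heisConv_eq_opConv, enorm_mulKernel] using h

theorem memLp_heisConv (hK : Continuous K) (hKc : HasCompactSupport K) {p : ℝ≥0∞} (hp : 1 ≤ p)
    (hp' : p ≠ ∞) (hf : MemLp f p) : MemLp (heisConv K f) p := by
  rw [heisConv_eq_opConv]
  exact memLp_opConv (continuous_mulKernel hK) (hasCompactSupport_mulKernel hKc) hp hp' hf

/-- If `K` has mean zero, the composition of the convolutions with `L` and `K` is controlled by the
right modulus of continuity of `L` on the support of `K`. -/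
theorem eLpNorm_heisConv_heisConv_le (hK : Continuous K) (hKc : HasCompactSupport K)
    (hK0 : ∫ y, K y = 0) (hL : Continuous L) (hLc : HasCompactSupport L) (hf : MemLp f 2) :
    eLpNorm (heisConv K (heisConv L f)) 2
      ≤ (∫⁻ y, (∫⁻ v, ‖L (heisMul v (heisInv y)) - L v‖ₑ) * ‖K y‖ₑ) * eLpNorm f 2 := by
  set h := heisConv L f with hh
  have hh2 : MemLp h 2 := memLp_heisConv hL hLc (by norm_num) (by norm_num) hf
  have hΦ : Measurable fun w : (Fin 3 → ℝ) × (Fin 3 → ℝ) =>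
      ‖L (heisMul w.1 (heisInv w.2)) - L w.1‖ₑ * ‖K w.2‖ₑ := by
    have h1 : Continuous fun w : (Fin 3 → ℝ) × (Fin 3 → ℝ) => heisMul w.1 (heisInv w.2) :=
      continuous_heisMul.comp (continuous_fst.prodMk (continuous_heisInv.comp continuous_snd))
    exact ((hL.comp h1).sub (hL.comp continuous_fst)).enorm.measurable.mul
      (hK.comp continuous_snd).enorm.measurable
  set m : (Fin 3 → ℝ) → ℝ≥0∞ := fun v =>
    ∫⁻ y, ‖L (heisMul v (heisInv y)) - L v‖ₑ * ‖K y‖ₑ with hm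
  have hmm : Measurable m := hΦ.lintegral_prod_right'
  have hLint : ∀ x, Integrable fun z => ContinuousLinearMap.mul ℝ ℂ (L (heisDiff z x)) (f z) :=
    fun x => integrable_opConv_kernel (continuous_mulKernel hL) (hasCompactSupport_mulKernel hLc)
      (by norm_num) hf x
  have hinc : ∀ x y, ‖h (heisMul x (heisInv y)) - h x‖ₑ
      ≤ ∫⁻ z, ‖f z‖ₑ * ‖L (heisMul (heisDiff z x) (heisInv y)) - L (heisDiff z x)‖ₑ := by
    intro x y
    have e : h (heisMul x (heisInv y)) - h x
        = ∫ z, (L (heisMul (heisDiff z x) (heisInv y)) - L (heisDiff z x)) * f z := by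
      rw [hh, heisConv_eq_opConv, opConv, opConv, ← integral_sub (hLint _) (hLint _)]
      refine integral_congr_ae (ae_of_all _ fun z => ?_)
      simp only [ContinuousLinearMap.mul_apply', sub_mul]
      rw [heisDiff, heisDiff, heisMul_assoc]
    rw [e]
    refine (enorm_integral_le_lintegral_enorm _).trans (lintegral_mono fun z => ?_)
    rw [enorm_mul, mul_comm]
  have hpt : ∀ x, ‖heisConv K h x‖ₑ ≤ ∫⁻ z, ‖f z‖ₑ * m (heisDiff z x) := by
    intro x
    have hKi : Integrable K := hK.integrable_of_hasCompactSupport hKc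
    have hhx : MemLp (fun y => h (heisMul x (heisInv y))) 2 :=
      hh2.comp_measurePreserving ((measurePreserving_heisMul_left x).comp measurePreserving_heisInv)
    have e : heisConv K h x = ∫ y, (h (heisMul x (heisInv y)) - h x) * K y := by
      have hi : Integrable fun y => h (heisMul x (heisInv y)) * K y :=
        hhx.integrable_mul (hK.memLp_of_hasCompactSupport (p := 2) hKc)
      simp only [sub_mul]
      rw [integral_sub hi (hKi.const_mul _), integral_const_mul, hK0, mul_zero, sub_zero, heisConv]
    rw [e]
    calc ‖∫ y, (h (heisMul x (heisInv y)) - h x) * K y‖ₑ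
        ≤ ∫⁻ y, ‖h (heisMul x (heisInv y)) - h x‖ₑ * ‖K y‖ₑ := by
          refine (enorm_integral_le_lintegral_enorm _).trans (lintegral_mono fun z => ?_)
          rw [enorm_mul]
      _ ≤ ∫⁻ y, ∫⁻ z, ‖f z‖ₑ * (‖L (heisMul (heisDiff z x) (heisInv y)) - L (heisDiff z x)‖ₑ
            * ‖K y‖ₑ) := by
          refine lintegral_mono fun y => ?_
          simp only [← mul_assoc]
          rw [lintegral_mul_const' _ _ enorm_ne_top]
          gcongr
          exact hinc x y
      _ = ∫⁻ z, ∫⁻ y, ‖f z‖ₑ * (‖L (heisMul (heisDiff z x) (heisInv y)) - L (heisDiff z x)‖ₑ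
            * ‖K y‖ₑ) := by
          refine lintegral_lintegral_swap ?_
          refine (hf.1.enorm.comp_snd (μ := volume)).mul ?_
          have : Measurable fun w : (Fin 3 → ℝ) × (Fin 3 → ℝ) => (heisDiff w.2 x, w.1) :=
            ((measurePreserving_heisDiff_right x).measurable.comp measurable_snd).prodMk
              measurable_fst
          exact (hΦ.comp this).aemeasurable
      _ = ∫⁻ z, ‖f z‖ₑ * m (heisDiff z x) :=
          lintegral_congr fun z => lintegral_const_mul' _ _ enorm_ne_top
  have hmint : ∫⁻ v, m v = ∫⁻ y, (∫⁻ v, ‖L (heisMul v (heisInv y)) - L v‖ₑ) * ‖K y‖ₑ := by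
    rw [hm, lintegral_lintegral_swap hΦ.aemeasurable]
    exact lintegral_congr fun y => lintegral_mul_const' _ _ enorm_ne_top
  have key := (lintegral_mono fun x => ENNReal.rpow_le_rpow (hpt x) zero_le_two).trans
    (lintegral_conv_rpow_le (p := 2) hf.1.enorm hmm (by norm_num))
  rw [eLpNorm_eq_lintegral_rpow_enorm_toReal two_ne_zero ENNReal.ofNat_ne_top,
    eLpNorm_eq_lintegral_rpow_enorm_toReal two_ne_zero ENNReal.ofNat_ne_top, ← hmint]
  simp only [ENNReal.toReal_ofNat]
  refine (ENNReal.rpow_le_rpow key (by norm_num : (0:ℝ) ≤ 1 / 2)).trans (le_of_eq ?_)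
  rw [ENNReal.mul_rpow_of_nonneg _ _ (by norm_num), ← ENNReal.rpow_mul]
  norm_num

end Scalar

/-- Almost orthogonal vectors of a Hilbert space: geometric decay of the inner products gives the
bound for the norm of the sum that orthogonality would give, up to a constant. -/
theorem norm_sum_sq_le_of_almost_orthogonal {H : Type*} [NormedAddCommGroup H]
    [InnerProductSpace ℂ H] {g : ℕ → H} {x : ℕ → ℝ} {C q : ℝ} (hC : 0 ≤ C)
    (hq : 0 ≤ q) (hq1 : q < 1)
    (h : ∀ j d, ‖inner ℂ (g j) (g (j + d))‖ ≤ C * q ^ d * (x j * x (j + d))) (n : ℕ) :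
    ‖∑ j ∈ Finset.range n, g j‖ ^ 2 ≤ 2 * C / (1 - q) * ∑ j ∈ Finset.range n, x j ^ 2 := by
  have hsym : ∀ j k, ‖inner ℂ (g j) (g k)‖
      ≤ C * q ^ ((k - j) + (j - k)) * ((x j ^ 2 + x k ^ 2) / 2) := by
    have hle : ∀ j d, ‖inner ℂ (g j) (g (j + d))‖
        ≤ C * q ^ d * ((x j ^ 2 + x (j + d) ^ 2) / 2) := fun j d => by
      refine (h j d).trans (mul_le_mul_of_nonneg_left ?_ (by positivity))
      nlinarith [sq_nonneg (x j - x (j + d))]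
    intro j k
    rcases le_total j k with hjk | hjk
    · obtain ⟨d, rfl⟩ := Nat.exists_eq_add_of_le hjk
      simpa using hle j d
    · obtain ⟨d, rfl⟩ := Nat.exists_eq_add_of_le hjk
      rw [norm_inner_symm, add_comm (x (k + d) ^ 2)]
      simpa using hle k d
  have hgeom : ∀ j, ∑ k ∈ Finset.range n, q ^ ((k - j) + (j - k)) ≤ 2 / (1 - q) := by
    intro j
    have hs : ∀ m, ∑ i ∈ Finset.range m, q ^ i ≤ 1 / (1 - q) := fun m => by
      rw [le_div_iff₀ (by linarith), geom_sum_mul_neg]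
      linarith [pow_nonneg hq m]
    calc ∑ k ∈ Finset.range n, q ^ ((k - j) + (j - k))
        ≤ ∑ k ∈ Finset.range (j + n), q ^ ((k - j) + (j - k)) :=
          Finset.sum_le_sum_of_subset_of_nonneg (Finset.range_mono (by omega))
            fun _ _ _ => by positivity
      _ = ∑ k ∈ Finset.range j, q ^ (j - k) + ∑ i ∈ Finset.range n, q ^ i := by
          rw [Finset.sum_range_add]
          congr 1
          · refine Finset.sum_congr rfl fun k hk => ?_
            rw [Nat.sub_eq_zero_of_le (Finset.mem_range.1 hk).le, zero_add]
          · refine Finset.sum_congr rfl fun i _ => ?_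
            congr 1
            omega
      _ ≤ ∑ i ∈ Finset.range j, q ^ i + ∑ i ∈ Finset.range n, q ^ i := by
          gcongr ?_ + _
          rw [← Finset.sum_range_reflect (fun i => q ^ i)]
          refine Finset.sum_le_sum fun k hk => ?_
          have := Finset.mem_range.1 hk
          exact pow_le_pow_of_le_one hq hq1.le (by omega)
      _ ≤ 1 / (1 - q) + 1 / (1 - q) := add_le_add (hs j) (hs n)
      _ = 2 / (1 - q) := by ring
  have hexp : ‖∑ j ∈ Finset.range n, g j‖ ^ 2
      ≤ ∑ j ∈ Finset.range n, ∑ k ∈ Finset.range n, ‖inner ℂ (g j) (g k)‖ := by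
    have e := congrArg norm (inner_self_eq_norm_sq_to_K (𝕜 := ℂ) (∑ j ∈ Finset.range n, g j))
    rw [norm_pow, RCLike.norm_ofReal, abs_of_nonneg (norm_nonneg _)] at e
    rw [← e, sum_inner]
    refine (norm_sum_le _ _).trans (Finset.sum_le_sum fun j _ => ?_)
    rw [inner_sum]
    exact norm_sum_le _ _
  refine hexp.trans ?_
  set w : ℕ → ℕ → ℝ := fun j k => q ^ ((k - j) + (j - k)) with hw
  have hwsym : ∀ j k, w j k = w k j := fun j k => by simp only [hw, add_comm]
  calc ∑ j ∈ Finset.range n, ∑ k ∈ Finset.range n, ‖inner ℂ (g j) (g k)‖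
      ≤ ∑ j ∈ Finset.range n, ∑ k ∈ Finset.range n, C * w j k * ((x j ^ 2 + x k ^ 2) / 2) :=
        Finset.sum_le_sum fun j _ => Finset.sum_le_sum fun k _ => hsym j k
    _ = ∑ j ∈ Finset.range n, ∑ k ∈ Finset.range n, C / 2 * (w j k * x j ^ 2)
        + ∑ j ∈ Finset.range n, ∑ k ∈ Finset.range n, C / 2 * (w j k * x k ^ 2) := by
        simp only [← Finset.sum_add_distrib]
        exact Finset.sum_congr rfl fun j _ => Finset.sum_congr rfl fun k _ => by ring
    _ = C * ∑ j ∈ Finset.range n, (∑ k ∈ Finset.range n, w j k) * x j ^ 2 := by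
        rw [Finset.sum_comm (f := fun j k => C / 2 * (w j k * x k ^ 2))]
        rw [← Finset.sum_add_distrib, Finset.mul_sum]
        refine Finset.sum_congr rfl fun j _ => ?_
        rw [← Finset.sum_add_distrib, Finset.sum_mul, Finset.mul_sum]
        refine Finset.sum_congr rfl fun k _ => ?_
        rw [hwsym k j]
        ring
    _ ≤ C * ∑ j ∈ Finset.range n, 2 / (1 - q) * x j ^ 2 := by
        gcongr with j _
        exact hgeom j
    _ = _ := by rw [← Finset.mul_sum]; ring

/-! ### Almost orthogonality of the Littlewood–Paley kernels -/

theorem eLpNorm_two_sq {V : Type*} [NormedAddCommGroup V] (f : (Fin 3 → ℝ) → V) :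
    eLpNorm f 2 ^ 2 = ∫⁻ x, ‖f x‖ₑ ^ 2 := by
  rw [eLpNorm_eq_lintegral_rpow_enorm_toReal two_ne_zero ENNReal.ofNat_ne_top,
    ← ENNReal.rpow_natCast, ← ENNReal.rpow_mul]
  norm_num

/-- The `L²` form of `norm_sum_sq_le_of_almost_orthogonal`. -/
theorem lintegral_sum_sq_le_of_almost_orthogonal {G F : ℕ → (Fin 3 → ℝ) → ℂ}
    (hG : ∀ j, MemLp (G j) 2) (hF : ∀ j, MemLp (F j) 2) {C q : ℝ} (hC : 0 ≤ C) (hq : 0 ≤ q)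
    (hq1 : q < 1) (h : ∀ j d, ‖∫ x, G j x * conj (G (j + d) x)‖
      ≤ C * q ^ d * ((eLpNorm (F j) 2).toReal * (eLpNorm (F (j + d)) 2).toReal)) (n : ℕ) :
    ∫⁻ x, ‖∑ j ∈ Finset.range n, G j x‖ₑ ^ 2
      ≤ ENNReal.ofReal (2 * C / (1 - q)) * ∑ j ∈ Finset.range n, ∫⁻ x, ‖F j x‖ₑ ^ 2 := by
  have hA : 0 ≤ 2 * C / (1 - q) := div_nonneg (by positivity) (by linarith)
  obtain ⟨g, hgG⟩ : ∃ g : ℕ → Lp ℂ 2 (volume : Measure (Fin 3 → ℝ)), ∀ j, g j =ᵐ[volume] G j :=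
    ⟨fun j => (hG j).toLp (G j), fun j => (hG j).coeFn_toLp⟩
  have hinner : ∀ j d, ‖inner ℂ (g j) (g (j + d))‖
      ≤ C * q ^ d * ((eLpNorm (F j) 2).toReal * (eLpNorm (F (j + d)) 2).toReal) := by
    intro j d
    have e1 : inner ℂ (g (j + d)) (g j) = ∫ x, G j x * conj (G (j + d) x) := by
      rw [L2.inner_def]
      refine integral_congr_ae ?_
      filter_upwards [hgG j, hgG (j + d)] with x h1 h2
      rw [h1, h2, RCLike.inner_apply]
    rw [norm_inner_symm, e1]
    exact h j d
  obtain ⟨x, hx⟩ : ∃ x : ℕ → ℝ, ∀ j, (eLpNorm (F j) 2).toReal = x j := ⟨_, fun _ => rfl⟩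
  simp only [hx] at hinner
  have key := norm_sum_sq_le_of_almost_orthogonal hC hq hq1 hinner n
  simp only [← hx] at key
  obtain ⟨S, hS⟩ : ∃ S, S = ∑ j ∈ Finset.range n, g j := ⟨_, rfl⟩
  rw [← hS] at key
  have hSG : ⇑S =ᵐ[volume] fun x => ∑ j ∈ Finset.range n, G j x := by
    have h1 := Lp.coeFn_finsetSum (Finset.range n) g
    have h2 : ∀ᵐ x, ∀ j, g j x = G j x := ae_all_iff.2 hgG
    filter_upwards [h1, h2] with x hx1 hx2
    rw [hS, hx1, Finset.sum_apply]
    exact Finset.sum_congr rfl fun j _ => hx2 j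
  rw [Lp.norm_def, eLpNorm_congr_ae hSG] at key
  have hSfin : eLpNorm (fun x => ∑ j ∈ Finset.range n, G j x) 2 ≠ ∞ := by
    rw [← eLpNorm_congr_ae hSG]
    exact Lp.eLpNorm_ne_top S
  have hfin : ∀ j, eLpNorm (F j) 2 ^ 2 ≠ ∞ := fun j => ENNReal.pow_ne_top (hF j).2.ne
  simp only [← eLpNorm_two_sq]
  simp only [← ENNReal.toReal_pow] at key
  rw [← ENNReal.toReal_sum fun j _ => hfin j] at key
  rw [← ENNReal.toReal_le_toReal (ENNReal.pow_ne_top hSfin)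
    (ENNReal.mul_ne_top ENNReal.ofReal_ne_top (ENNReal.sum_ne_top.2 fun j _ => hfin j)),
    ENNReal.toReal_mul, ENNReal.toReal_ofReal hA]
  exact key

section Kernel

variable {α β : ℝ → ℝ} {ς : (Fin 3 → ℝ) → ℂ} {L : ℝ≥0}

theorem kernelD_zero_eq : kernelD α β ς 0 = bump α β ς ((2 : ℝ)⁻¹ ^ 0) := funext kernelD_zero

theorem kernelD_succ_eq (hΓ : IsAdmissibleCurve α β) (j : ℕ) :
    kernelD α β ς (j + 1)
      = bump α β ς ((2 : ℝ)⁻¹ ^ (j + 1)) - bump α β ς ((2 : ℝ)⁻¹ ^ j) :=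
  funext (kernelD_succ hΓ j)

theorem two_inv_pow_pos (j : ℕ) : (0 : ℝ) < (2 : ℝ)⁻¹ ^ j := by positivity

namespace IsBump

theorem continuous_kernelD (hς : IsBump ς L) (hΓ : IsAdmissibleCurve α β) (j : ℕ) :
    Continuous (kernelD α β ς j) := by
  cases j with
  | zero => rw [kernelD_zero_eq]; exact hς.continuous_bump _
  | succ j => rw [kernelD_succ_eq hΓ]; exact (hς.continuous_bump _).sub (hς.continuous_bump _)

theorem hasCompactSupport_kernelD (hς : IsBump ς L) (hΓ : IsAdmissibleCurve α β) (j : ℕ) :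
    HasCompactSupport (kernelD α β ς j) := by
  cases j with
  | zero => rw [kernelD_zero_eq]; exact hς.hasCompactSupport_bump hΓ (two_inv_pow_pos _)
  | succ j =>
    rw [kernelD_succ_eq hΓ]
    exact (hς.hasCompactSupport_bump hΓ (two_inv_pow_pos _)).sub
      (hς.hasCompactSupport_bump hΓ (two_inv_pow_pos _))

theorem lintegral_enorm_kernelD_le (hς : IsBump ς L) (hΓ : IsAdmissibleCurve α β) (j : ℕ) :
    ∫⁻ x, ‖kernelD α β ς j x‖ₑ ≤ 2 * ∫⁻ u, ‖ς u‖ₑ := by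
  cases j with
  | zero =>
    rw [kernelD_zero_eq, lintegral_enorm_bump hς hΓ (two_inv_pow_pos _), two_mul]
    exact self_le_add_right _ _
  | succ j =>
    rw [kernelD_succ_eq hΓ, two_mul]
    nth_rewrite 1 [← lintegral_enorm_bump hς hΓ (two_inv_pow_pos (j + 1))]
    rw [← lintegral_enorm_bump hς hΓ (two_inv_pow_pos j),
      ← lintegral_add_right _ (hς.continuous_bump _).enorm.measurable]
    exact lintegral_mono fun x => enorm_sub_le

theorem integral_kernelD_succ (hς : IsBump ς L) (hΓ : IsAdmissibleCurve α β) (j : ℕ) :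
    ∫ x, kernelD α β ς (j + 1) x = 0 := by
  have hi : ∀ i : ℕ, Integrable (bump α β ς ((2 : ℝ)⁻¹ ^ i)) := fun i =>
    (hς.continuous_bump _).integrable_of_hasCompactSupport
      (hς.hasCompactSupport_bump hΓ (two_inv_pow_pos i))
  simp only [kernelD_succ hΓ]
  rw [integral_sub (hi _) (hi _), integral_bump hς hΓ (two_inv_pow_pos _),
    integral_bump hς hΓ (two_inv_pow_pos _), sub_self]

/-- The modulus of continuity of the kernels under right translations: a translation of size `r` at the
scale `2^{-(j+d)}` moves the kernel of index `j` by `O(r q ^ d)` in `L¹`. -/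
theorem exists_kernelD_modulus (hς : IsBump ς L) (hΓ : IsAdmissibleCurve α β) :
    ∃ C q : ℝ≥0, 0 < q ∧ q < 1 ∧ ∀ j d : ℕ, ∀ y,
      ∫⁻ x, ‖kernelD α β ς j (heisMul x (heisInv y)) - kernelD α β ς j x‖ₑ
        ≤ C * q ^ d * ENNReal.ofReal (scaleNorm α β ((2 : ℝ)⁻¹ ^ (j + d)) y) := by
  obtain ⟨C, hC⟩ := hς.exists_bump_modulus hΓ
  obtain ⟨ε, hε, hle⟩ := hΓ.exists_scaleNorm_le
  set q : ℝ := (2 : ℝ)⁻¹ ^ ε with hq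
  have hq0 : 0 < q := by positivity
  have hq1 : q < 1 := Real.rpow_lt_one (by norm_num) (by norm_num) hε
  have hscale : ∀ i d : ℕ, ∀ y, scaleNorm α β ((2 : ℝ)⁻¹ ^ i) y
      ≤ 10 * q ^ d * scaleNorm α β ((2 : ℝ)⁻¹ ^ (i + d)) y := by
    intro i d y
    have h := hle ((2 : ℝ)⁻¹ ^ (i + d)) ((2 : ℝ)⁻¹ ^ i) (two_inv_pow_pos _)
      (pow_le_pow_of_le_one (by norm_num) (by norm_num) (by omega)) y
    have e : ((2 : ℝ)⁻¹ ^ (i + d) / (2 : ℝ)⁻¹ ^ i) ^ ε = q ^ d := by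
      rw [pow_add, mul_div_cancel_left₀ _ (two_inv_pow_pos i).ne', ← Real.rpow_natCast_mul
        (by norm_num), mul_comm, Real.rpow_mul_natCast (by norm_num)]
    rwa [e] at h
  have hbump : ∀ i d : ℕ, ∀ y,
      ∫⁻ x, ‖bump α β ς ((2 : ℝ)⁻¹ ^ i) (heisMul x (heisInv y)) - bump α β ς ((2 : ℝ)⁻¹ ^ i) x‖ₑ
        ≤ C * ENNReal.ofReal (10 * q ^ d * scaleNorm α β ((2 : ℝ)⁻¹ ^ (i + d)) y) := by
    intro i d y
    refine (hC _ (two_inv_pow_pos i) y).2.trans ?_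
    gcongr
    exact hscale i d y
  have hconv : ∀ d : ℕ, ∀ s : ℝ, (C : ℝ≥0∞) * ENNReal.ofReal (10 * q ^ d * s)
      = C * 10 * ((NNReal.mk q hq0.le : ℝ≥0) : ℝ≥0∞) ^ d * ENNReal.ofReal s := by
    intro d s
    rw [ENNReal.ofReal_mul (by positivity), ENNReal.ofReal_mul (by norm_num),
      ENNReal.ofReal_pow hq0.le, ENNReal.ofReal_eq_coe_nnreal hq0.le]
    norm_num [mul_assoc]
  refine ⟨2 * (C * 10), NNReal.mk q hq0.le, hq0, hq1, fun j d y => ?_⟩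
  have hgoal : (((2 * (C * 10) : ℝ≥0) : ℝ≥0∞)) * ((NNReal.mk q hq0.le : ℝ≥0) : ℝ≥0∞) ^ d
      * ENNReal.ofReal (scaleNorm α β ((2 : ℝ)⁻¹ ^ (j + d)) y)
      = C * ENNReal.ofReal (10 * q ^ d * scaleNorm α β ((2 : ℝ)⁻¹ ^ (j + d)) y)
        + C * ENNReal.ofReal (10 * q ^ d * scaleNorm α β ((2 : ℝ)⁻¹ ^ (j + d)) y) := by
    rw [hconv, ENNReal.coe_mul, ENNReal.coe_mul]
    push_cast
    ring
  rw [hgoal]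
  cases j with
  | zero =>
    rw [kernelD_zero_eq]
    exact (hbump 0 d y).trans (self_le_add_right _ _)
  | succ j =>
    have h2 : C * ENNReal.ofReal (10 * q ^ (d + 1) * scaleNorm α β ((2 : ℝ)⁻¹ ^ (j + (d + 1))) y)
        ≤ C * ENNReal.ofReal (10 * q ^ d * scaleNorm α β ((2 : ℝ)⁻¹ ^ (j + 1 + d)) y) := by
      rw [show j + (d + 1) = j + 1 + d by ring]
      refine mul_le_mul_right (ENNReal.ofReal_le_ofReal (mul_le_mul_of_nonneg_right
        (mul_le_mul_of_nonneg_left ?_ (by norm_num)) ?_)) _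
      · exact pow_le_pow_of_le_one hq0.le hq1.le (by omega)
      · exact scaleNorm_nonneg _ _
    refine le_trans ?_ (add_le_add (hbump (j + 1) d y) ((hbump j (d + 1) y).trans h2))
    have hm : Measurable fun x => ‖bump α β ς ((2 : ℝ)⁻¹ ^ j) (heisMul x (heisInv y))
        - bump α β ς ((2 : ℝ)⁻¹ ^ j) x‖ₑ :=
      (((hς.continuous_bump _).measurable.comp (measurePreserving_heisMul_right _).measurable).sub
        (hς.continuous_bump _).measurable).enorm
    rw [← lintegral_add_right _ hm]
    refine lintegral_mono fun x => ?_
    rw [kernelD_succ hΓ, kernelD_succ hΓ]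
    refine le_trans (le_of_eq ?_) enorm_sub_le
    congr 1
    ring

theorem scaleNorm_le_of_kernelD_succ_ne_zero (hς : IsBump ς L) (hΓ : IsAdmissibleCurve α β) {j : ℕ}
    {y : Fin 3 → ℝ} (hy : kernelD α β ς (j + 1) y ≠ 0) :
    scaleNorm α β ((2 : ℝ)⁻¹ ^ j) y ≤ 10 := by
  obtain ⟨ε, hε, hle⟩ := hΓ.exists_scaleNorm_le
  by_contra! h
  refine hy ?_
  have hs : (2 : ℝ)⁻¹ ^ (j + 1) ≤ (2 : ℝ)⁻¹ ^ j :=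
    pow_le_pow_of_le_one (by norm_num) (by norm_num) (by omega)
  have h1 := hle _ _ (two_inv_pow_pos (j + 1)) hs y
  have h2 : ((2 : ℝ)⁻¹ ^ (j + 1) / (2 : ℝ)⁻¹ ^ j) ^ ε ≤ 1 :=
    Real.rpow_le_one (by positivity) (div_le_one_of_le₀ hs (by positivity)) hε.le
  have h3 : 10 * ((2 : ℝ)⁻¹ ^ (j + 1) / (2 : ℝ)⁻¹ ^ j) ^ ε * scaleNorm α β ((2 : ℝ)⁻¹ ^ (j + 1)) y
      ≤ 10 * 1 * scaleNorm α β ((2 : ℝ)⁻¹ ^ (j + 1)) y := by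
    gcongr
    exact scaleNorm_nonneg _ _
  rw [kernelD_succ hΓ, hς.bump_eq_zero (by linarith), hς.bump_eq_zero (by linarith), sub_zero]

/-- The operators `𝒟_{j+d} 𝒟_j^*` decay geometrically in `d` on `L²`. -/
theorem exists_almost_orthogonal (hς : IsBump ς L) (hΓ : IsAdmissibleCurve α β) :
    ∃ C q : ℝ≥0, q < 1 ∧ ∀ j d : ℕ, ∀ f : (Fin 3 → ℝ) → ℂ, MemLp f 2 →
      eLpNorm (heisConv (kernelD α β ς (j + d)) (heisConv (adjKernel (kernelD α β ς j)) f)) 2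
        ≤ C * q ^ d * eLpNorm f 2 := by
  obtain ⟨C, q, hq0, hq1, hC⟩ := hς.conj_neg.exists_kernelD_modulus hΓ
  set I := ∫⁻ u, ‖ς u‖ₑ with hI
  set I' := ∫⁻ u, ‖(fun u => conj (ς (-u))) u‖ₑ with hI'
  have hIfin : I ≠ ∞ := hς.integrable.2.ne
  have hIfin' : I' ≠ ∞ := hς.conj_neg.integrable.2.ne
  have hq0' : (q : ℝ≥0∞) ≠ 0 := by exact_mod_cast hq0.ne'
  refine ⟨(2 * I * (2 * I')).toNNReal + (C * 10 * (2 * I) / q).toNNReal, q, hq1, fun j d f hf => ?_⟩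
  rw [ENNReal.coe_add, ENNReal.coe_toNNReal (by finiteness), ENNReal.coe_toNNReal
    (ENNReal.div_ne_top (by finiteness) hq0'), adjKernel_kernelD hΓ]
  cases d with
  | zero =>
    -- no cancellation is available or needed here
    rw [pow_zero, mul_one, add_zero]
    refine (eLpNorm_heisConv_le (hς.continuous_kernelD hΓ j) (aestronglyMeasurable_heisConv
      (hς.conj_neg.continuous_kernelD hΓ j) hf.1) (by norm_num) (by norm_num)).trans ?_
    refine (mul_le_mul' (hς.lintegral_enorm_kernelD_le hΓ j)
      ((eLpNorm_heisConv_le (hς.conj_neg.continuous_kernelD hΓ j) hf.1 (by norm_num)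
        (by norm_num)).trans
          (mul_le_mul_left (hς.conj_neg.lintegral_enorm_kernelD_le hΓ j) _))).trans ?_
    rw [← mul_assoc]
    gcongr
    exact self_le_add_right _ _
  | succ d =>
    refine (eLpNorm_heisConv_heisConv_le (hς.continuous_kernelD hΓ _)
      (hς.hasCompactSupport_kernelD hΓ _) (hς.integral_kernelD_succ hΓ (j + d))
      (hς.conj_neg.continuous_kernelD hΓ j) (hς.conj_neg.hasCompactSupport_kernelD hΓ j)
      hf).trans ?_
    gcongr
    calc ∫⁻ y, (∫⁻ v, ‖kernelD α β (fun u => conj (ς (-u))) j (heisMul v (heisInv y))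
            - kernelD α β (fun u => conj (ς (-u))) j v‖ₑ) * ‖kernelD α β ς (j + (d + 1)) y‖ₑ
        ≤ ∫⁻ y, C * q ^ d * 10 * ‖kernelD α β ς (j + (d + 1)) y‖ₑ := by
          refine lintegral_mono fun y => ?_
          by_cases hy : kernelD α β ς (j + (d + 1)) y = 0
          · simp [hy]
          · have h := hς.scaleNorm_le_of_kernelD_succ_ne_zero hΓ (j := j + d) hy
            refine mul_le_mul' ((hC j d y).trans (mul_le_mul_right ?_ _)) le_rfl
            rw [← ENNReal.ofReal_ofNat 10]
            exact ENNReal.ofReal_le_ofReal h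
      _ = C * q ^ d * 10 * ∫⁻ y, ‖kernelD α β ς (j + (d + 1)) y‖ₑ :=
          lintegral_const_mul' _ _ (by finiteness)
      _ ≤ C * q ^ d * 10 * (2 * I) := by
          gcongr
          exact hς.lintegral_enorm_kernelD_le hΓ _
      _ = C * 10 * (2 * I) / q * q ^ (d + 1) := by
          rw [pow_succ', ← mul_assoc (_ / _), ENNReal.div_mul_cancel hq0' ENNReal.coe_ne_top]
          ring
      _ ≤ _ := by
          gcongr
          exact self_le_add_left _ _

/-- The adjoint of the vector-valued operator `f ↦ (𝒟_j f)_j` is bounded on `L²`. -/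
theorem exists_lintegral_sum_adjoint_le (hς : IsBump ς L) (hΓ : IsAdmissibleCurve α β) :
    ∃ A : ℝ≥0, ∀ n : ℕ, ∀ F : ℕ → (Fin 3 → ℝ) → ℂ, (∀ j, MemLp (F j) 2) →
      ∫⁻ x, ‖∑ j ∈ Finset.range n, heisConv (adjKernel (kernelD α β ς j)) (F j) x‖ₑ ^ 2
        ≤ A * ∑ j ∈ Finset.range n, ∫⁻ x, ‖F j x‖ₑ ^ 2 := by
  obtain ⟨C, q, hq1, hC⟩ := hς.exists_almost_orthogonal hΓ
  refine ⟨(2 * (C : ℝ) / (1 - q)).toNNReal, fun n F hF => ?_⟩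
  have hK : ∀ j, Integrable (kernelD α β ς j) := fun j =>
    (hς.continuous_kernelD hΓ j).integrable_of_hasCompactSupport (hς.hasCompactSupport_kernelD hΓ j)
  have hG : ∀ j, MemLp (heisConv (adjKernel (kernelD α β ς j)) (F j)) 2 := fun j => by
    rw [adjKernel_kernelD hΓ]
    exact memLp_heisConv (hς.conj_neg.continuous_kernelD hΓ j)
      (hς.conj_neg.hasCompactSupport_kernelD hΓ j) (by norm_num) (by norm_num) (hF j)
  refine lintegral_sum_sq_le_of_almost_orthogonal hG hF C.2 q.2 (by exact_mod_cast hq1)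
    (fun j d => ?_) n
  have hKG := memLp_heisConv (hς.continuous_kernelD hΓ (j + d))
    (hς.hasCompactSupport_kernelD hΓ (j + d)) (by norm_num) (by norm_num) (hG j)
  have h2 := integral_norm_mul_conj_le (p := 2) (q := 2) hKG (hF (j + d)) 0
  have h0 : ∀ x, heisMul x 0 = x := fun x => by
    ext i; fin_cases i <;> simp [heisMul]
  simp only [h0] at h2
  rw [← integral_heisConv_mul_conj (p := 2) (q := 2) (hK _) (hG j) (hF (j + d))]
  refine (norm_integral_le_integral_norm _).trans (h2.trans ?_)
  rw [← mul_assoc]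
  refine mul_le_mul_of_nonneg_right ?_ ENNReal.toReal_nonneg
  have h3 := ENNReal.toReal_mono (ENNReal.mul_ne_top (by finiteness) (hF j).2.ne) (hC j d _ (hF j))
  simpa [ENNReal.toReal_mul] using h3

end IsBump

end Kernel

/-! ### The ladder of quasi-norms of an admissible curve -/

section Ladder

variable {α β : ℝ → ℝ}

namespace IsAdmissibleCurve

/-- The quotient `det Ã(t) / t` is nondecreasing. -/
theorem det_le_div_mul_det (hΓ : IsAdmissibleCurve α β) {s t : ℝ} (hs : 0 < s) (hst : s ≤ t) :
    (ATilde α β s).det ≤ s / t * (ATilde α β t).det := by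
  have ht : 0 < t := hs.trans_le hst
  have m1 := hΓ.monotoneOn_h2 hs.le ht.le hst
  have m2 := hΓ.h3Bar_mono hs hst
  have p1 := hΓ.h2_pos hs
  have p2 := hΓ.h3Bar_pos hs
  rw [det_ATilde, det_ATilde]
  have e : s / t * (t * h2 α t * (t * h2 α t + h3Bar α β t))
      = s * h2 α t * (t * h2 α t + h3Bar α β t) := by field_simp
  have p3 := hΓ.h2_pos ht
  rw [e]
  gcongr

theorem continuousOn_det (hΓ : IsAdmissibleCurve α β) :
    ContinuousOn (fun t => (ATilde α β t).det) (Ioi 0) := by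
  intro t ht
  simp only [det_ATilde]
  have h1 : ContinuousAt (h2 α) t := (hΓ.hasDerivAt_h2 ht).continuousAt
  have h2 : ContinuousAt (h3Bar α β) t := (hΓ.differentiableAt_h3Bar ht).continuousAt
  exact ((continuousAt_id.mul h1).mul ((continuousAt_id.mul h1).add h2)).continuousWithinAt

theorem exists_det_eq (hΓ : IsAdmissibleCurve α β) {v : ℝ} (hv : 0 < v) :
    ∃ t, 0 < t ∧ (ATilde α β t).det = v := by
  set D := (ATilde α β 1).det with hD
  have hD0 : 0 < D := hΓ.det_pos one_pos
  -- `det Ã(t) / t` is nondecreasing, which locates the value `v`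
  have hs : 0 < min 1 (v / D) := lt_min one_pos (by positivity)
  have hle : min 1 (v / D) ≤ max 1 (v / D) := (min_le_left _ _).trans (le_max_left _ _)
  have h1 : (ATilde α β (min 1 (v / D))).det ≤ v := by
    refine (hΓ.det_le_div_mul_det hs (min_le_left _ _)).trans ?_
    rw [div_one, ← hD, ← le_div_iff₀ hD0]
    exact min_le_right _ _
  have h2 : v ≤ (ATilde α β (max 1 (v / D))).det := by
    have h := hΓ.det_le_div_mul_det one_pos (le_max_left 1 (v / D))
    rw [← hD, div_mul_eq_mul_div, one_mul, le_div_iff₀ (by positivity)] at h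
    refine le_trans ?_ h
    rw [mul_comm, ← div_le_iff₀ hD0]
    exact le_max_right _ _
  obtain ⟨t, ht, hte⟩ := intermediate_value_Icc hle
    (hΓ.continuousOn_det.mono fun x hx => hs.trans_le hx.1) ⟨h1, h2⟩
  exact ⟨t, hs.trans_le ht.1, hte⟩

/-- The dyadic scales `2⁻ʲ` may have unit balls of wildly different volumes, so the ladder is
indexed by the scales `τ k` at which the determinant of `Ã` equals `2 ^ k`. -/
theorem exists_normLadder (hΓ : IsAdmissibleCurve α β) :
    ∃ τ : ℤ → ℝ, (∀ k, 0 < τ k) ∧ ∃ M : ℕ, NormLadder (fun k => scaleNorm α β (τ k)) 10 M := by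
  choose τ hτ hdet using fun k : ℤ => hΓ.exists_det_eq (v := (2 : ℝ) ^ k) (by positivity)
  obtain ⟨ε, hε, hle⟩ := hΓ.exists_scaleNorm_le
  have hlt : ∀ k t, 0 < t → (2 : ℝ) ^ k < (ATilde α β t).det → τ k < t := by
    intro k t ht hk
    by_contra! h
    have h1 := hΓ.det_le_div_mul_det ht h
    rw [hdet] at h1
    have h2 : t / τ k ≤ 1 := div_le_one_of_le₀ h (hτ k).le
    nlinarith [zpow_pos (two_pos : (0 : ℝ) < 2) k]
  have hmono : ∀ k l, k ≤ l → τ k ≤ τ l := by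
    intro k l hkl
    by_contra! h
    have h1 := hΓ.det_le_div_mul_det (hτ l) h.le
    rw [hdet, hdet] at h1
    have h2 : τ l / τ k < 1 := (div_lt_one (hτ k)).2 h
    have h3 : (2 : ℝ) ^ k ≤ 2 ^ l := zpow_le_zpow_right₀ one_le_two hkl
    nlinarith [zpow_pos (two_pos : (0 : ℝ) < 2) k]
  have hN : ∀ k l x, k ≤ l → scaleNorm α β (τ l) x ≤ 10 * scaleNorm α β (τ k) x := by
    intro k l x hkl
    refine (hle _ _ (hτ k) (hmono k l hkl) x).trans ?_
    have h2 : (τ k / τ l) ^ ε ≤ 1 :=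
      Real.rpow_le_one (div_nonneg (hτ k).le (hτ l).le)
        (div_le_one_of_le₀ (hmono k l hkl) (hτ l).le) hε.le
    nlinarith [scaleNorm_nonneg (α := α) (β := β) (τ k) x]
  -- radius `1 + 2 * 10`; two points of a small ball are at distance at most `22 / 220` at the same
  -- level, hence at most `1` at the next one
  obtain ⟨S, hSR, hSfin, hScov⟩ := (isCompact_closedBall (0 : Fin 3 → ℝ) 21).finite_cover_balls
    (show (0 : ℝ) < 1 / 440 by norm_num)
  set e := hSfin.toFinset.equivFin
  refine ⟨τ, hτ, hSfin.toFinset.card, ?_⟩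
  refine ⟨by norm_num, fun k => continuous_scaleNorm _, fun k x => scaleNorm_nonneg _ x,
    fun k x => scaleNorm_heisInv _ x, fun k x y => hΓ.scaleNorm_heisMul_le (hτ k) x y, hN,
    fun k r hr => by rw [hΓ.volume_scaleNorm_le (hτ k) hr, hdet], ?_, ?_⟩
  · intro U hU
    have hcont : Continuous fun v : Fin 3 → ℝ => ATilde α β 1 *ᵥ v :=
      Continuous.matrix_mulVec continuous_const continuous_id
    have hU' : (fun v : Fin 3 → ℝ => ATilde α β 1 *ᵥ v) ⁻¹' U ∈ nhds (0 : Fin 3 → ℝ) :=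
      hcont.continuousAt.preimage_mem_nhds (by simpa using hU)
    obtain ⟨δ, hδ, hδU⟩ := Metric.nhds_basis_closedBall.mem_iff.1 hU'
    set t := min 1 ((δ / 10) ^ (1 / ε)) with ht
    have ht0 : 0 < t := lt_min one_pos (by positivity)
    have htε : 10 * t ^ ε ≤ δ := by
      have h1 : t ^ ε ≤ ((δ / 10) ^ (1 / ε)) ^ ε :=
        Real.rpow_le_rpow ht0.le (min_le_right _ _) hε.le
      rw [← Real.rpow_mul (by positivity), one_div_mul_cancel hε.ne', Real.rpow_one] at h1
      linarith
    obtain ⟨m, hm⟩ := exists_pow_lt_of_lt_one (hΓ.det_pos ht0) (by norm_num : (2 : ℝ)⁻¹ < 1)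
    refine ⟨-(m : ℤ), fun x hx => ?_⟩
    have hτt : τ (-(m : ℤ)) < t := hlt _ _ ht0 (by
      rwa [zpow_neg, zpow_natCast, ← inv_pow])
    have hx1 : scaleNorm α β (τ (-(m : ℤ))) x ≤ 1 := hx
    have hx2 : scaleNorm α β 1 x ≤ δ := by
      refine (hle _ 1 (hτ _) (hτt.le.trans (min_le_left _ _)) x).trans (le_trans ?_ htε)
      have h3 : (τ (-(m : ℤ)) / 1) ^ ε ≤ t ^ ε := by
        rw [div_one]; exact Real.rpow_le_rpow (hτ _).le hτt.le hε.le
      have h4 : 0 ≤ t ^ ε := by positivity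
      nlinarith [scaleNorm_nonneg (α := α) (β := β) (τ (-(m : ℤ))) x]
    have := hδU (show (ATilde α β 1)⁻¹ *ᵥ x ∈ Metric.closedBall (0 : Fin 3 → ℝ) δ by
      simpa [scaleNorm] using hx2)
    rwa [mem_preimage, hΓ.mulVec_inv_mulVec one_pos] at this
  · intro k
    refine ⟨fun i => {x | scaleNorm α β (τ k) x ≤ 21 ∧
      (ATilde α β (τ k))⁻¹ *ᵥ x ∈ Metric.ball ((e.symm i : hSfin.toFinset) : Fin 3 → ℝ) (1 / 440)},
      ?_, ?_⟩
    · intro x hx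
      have hx' : scaleNorm α β (τ k) x ≤ 21 := by
        refine le_trans hx ?_; norm_num
      have h1 := hScov (show (ATilde α β (τ k))⁻¹ *ᵥ x ∈ Metric.closedBall (0 : Fin 3 → ℝ) 21 by
        simpa [scaleNorm] using hx')
      obtain ⟨v, hv, hxv⟩ := mem_iUnion₂.1 h1
      exact mem_iUnion.2 ⟨e ⟨v, by simpa using hv⟩, hx', by simpa using hxv⟩
    · rintro i x ⟨hx1, hx2⟩ y ⟨hy1, hy2⟩
      refine (hN k (k + 1) _ (by omega)).trans ?_
      have h1 : scaleNorm α β (τ k) (heisDiff x y)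
          ≤ ‖(ATilde α β (τ k))⁻¹ *ᵥ y - (ATilde α β (τ k))⁻¹ *ᵥ x‖
            + scaleNorm α β (τ k) x * ‖(ATilde α β (τ k))⁻¹ *ᵥ y - (ATilde α β (τ k))⁻¹ *ᵥ x‖ := by
        rw [scaleNorm, heisDiff, hΓ.inv_mulVec_heisMul (hτ k), heisInv_eq_neg, Matrix.mulVec_neg]
        exact norm_twist_neg_le (hΓ.abs_kappa_le (hτ k)) _ _
      have h2 : ‖(ATilde α β (τ k))⁻¹ *ᵥ y - (ATilde α β (τ k))⁻¹ *ᵥ x‖ ≤ 1 / 220 := by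
        rw [← dist_eq_norm]
        have h3 := dist_triangle_right ((ATilde α β (τ k))⁻¹ *ᵥ y) ((ATilde α β (τ k))⁻¹ *ᵥ x)
          ((e.symm i : hSfin.toFinset) : Fin 3 → ℝ)
        have h4 := Metric.mem_ball.1 hx2
        have h5 := Metric.mem_ball.1 hy2
        linarith
      nlinarith [norm_nonneg ((ATilde α β (τ k))⁻¹ *ᵥ y - (ATilde α β (τ k))⁻¹ *ᵥ x),
        scaleNorm_nonneg (α := α) (β := β) (τ k) x]

end IsAdmissibleCurve

end Ladder

/-! ### The Hörmander condition -/

/-- A geometric sum dominated by its largest term, which is at most `1`. -/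
theorem sum_indicator_rpow_le {ε q s : ℝ} (hε : 0 < ε) (hq : q = (2 : ℝ)⁻¹ ^ ε) (hs : 0 < s)
    (n : ℕ) :
    ∑ j ∈ Finset.range n, (if s < (2 : ℝ)⁻¹ ^ j then (s / (2 : ℝ)⁻¹ ^ j) ^ ε else 0)
      ≤ 1 / (1 - q) := by
  have hq0 : 0 < q := by rw [hq]; positivity
  have hq1 : q < 1 := by rw [hq]; exact Real.rpow_lt_one (by norm_num) (by norm_num) hε
  induction n with
  | zero => simpa using hq1.le
  | succ n ih =>
    by_cases h : s < (2 : ℝ)⁻¹ ^ n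
    · calc ∑ j ∈ Finset.range (n + 1), (if s < (2 : ℝ)⁻¹ ^ j then (s / (2 : ℝ)⁻¹ ^ j) ^ ε else 0)
          ≤ ∑ j ∈ Finset.range (n + 1), q ^ (n + 1 - 1 - j) := by
            refine Finset.sum_le_sum fun j hj => ?_
            have hjn : j ≤ n := Nat.lt_succ_iff.1 (Finset.mem_range.1 hj)
            split_ifs
            · have e : q ^ (n + 1 - 1 - j) = ((2 : ℝ)⁻¹ ^ n / (2 : ℝ)⁻¹ ^ j) ^ ε := by
                obtain ⟨d, rfl⟩ := Nat.exists_eq_add_of_le hjn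
                rw [pow_add, mul_div_cancel_left₀ _ (two_inv_pow_pos j).ne', hq,
                  ← Real.rpow_natCast_mul (by norm_num), mul_comm,
                  Real.rpow_mul_natCast (by norm_num)]
                congr 1
                omega
              rw [e]
              gcongr
            · positivity
        _ = ∑ j ∈ Finset.range (n + 1), q ^ j := Finset.sum_range_reflect (fun i => q ^ i) (n + 1)
        _ ≤ 1 / (1 - q) := by
            rw [le_div_iff₀ (by linarith), geom_sum_mul_neg]
            linarith [pow_nonneg hq0.le (n + 1)]
    · rw [Finset.sum_range_succ, if_neg h, add_zero]
      exact ih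

section Hormander

variable {α β : ℝ → ℝ} {ς : (Fin 3 → ℝ) → ℂ} {L : ℝ≥0}

/-- The sum of the kernels satisfies Hörmander's condition at every scale `s`, absolutely and with
bounds independent of the number of terms. Bumps at scales below `s` do not reach the domain of
integration; those at larger scales are smooth at scale `s`. -/
theorem IsBump.exists_hormander (hς : IsBump ς L) (hΓ : IsAdmissibleCurve α β) :
    ∃ C : ℝ≥0, ∀ s, 0 < s → ∀ y, scaleNorm α β s y ≤ 21 → ∀ n : ℕ,
      ∑ j ∈ Finset.range n, ∫⁻ x in {x | 241 < scaleNorm α β s x},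
        ‖kernelD α β ς j (heisDiff y x) - kernelD α β ς j x‖ₑ ≤ C := by
  obtain ⟨C, hC⟩ := hς.exists_bump_modulus hΓ
  obtain ⟨ε, hε, hle⟩ := hΓ.exists_scaleNorm_le
  set q : ℝ := (2 : ℝ)⁻¹ ^ ε with hq
  refine ⟨2 * (C * Real.toNNReal (210 * (1 / (1 - q)))), fun s hs y hy n => ?_⟩
  set A := {x | 241 < scaleNorm α β s x} with hA
  have hAm : MeasurableSet A :=
    measurableSet_lt measurable_const (continuous_scaleNorm s).measurable
  set J : ℕ → ℝ≥0∞ := fun j => ∫⁻ x in A,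
    ‖bump α β ς ((2 : ℝ)⁻¹ ^ j) (heisDiff y x) - bump α β ς ((2 : ℝ)⁻¹ ^ j) x‖ₑ with hJ
  have hJle : ∀ j, J j ≤ C * ENNReal.ofReal
      (210 * if s < (2 : ℝ)⁻¹ ^ j then (s / (2 : ℝ)⁻¹ ^ j) ^ ε else 0) := by
    intro j
    split_ifs with h
    · refine (setLIntegral_le_lintegral _ _).trans ((hC _ (two_inv_pow_pos j) y).1.trans ?_)
      gcongr
      have h1 := hle s _ hs h.le y
      have h2 : 0 ≤ (s / (2 : ℝ)⁻¹ ^ j) ^ ε := by positivity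
      nlinarith
    · refine le_of_eq_of_le ?_ zero_le
      have hsup : ∀ z, 10 < scaleNorm α β s z → bump α β ς ((2 : ℝ)⁻¹ ^ j) z = 0 := by
        intro z hz
        refine hς.bump_eq_zero ?_
        have h1 := hle _ s (two_inv_pow_pos j) (not_lt.1 h) z
        have h2 : ((2 : ℝ)⁻¹ ^ j / s) ^ ε ≤ 1 :=
          Real.rpow_le_one (by positivity) (div_le_one_of_le₀ (not_lt.1 h) hs.le) hε.le
        nlinarith [scaleNorm_nonneg (α := α) (β := β) ((2 : ℝ)⁻¹ ^ j) z]
      calc J j = ∫⁻ x in A, 0 := by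
            refine setLIntegral_congr_fun hAm fun x hx => ?_
            have hx' : 241 < scaleNorm α β s x := hx
            -- `241 = 21 + 10 + 21 * 10`
            have h1 : 10 < scaleNorm α β s (heisDiff y x) := by
              have h2 := hΓ.scaleNorm_heisMul_le hs y (heisDiff y x)
              rw [heisMul_heisDiff] at h2
              by_contra! h3
              nlinarith [scaleNorm_nonneg (α := α) (β := β) s y,
                scaleNorm_nonneg (α := α) (β := β) s (heisDiff y x)]
            rw [hsup _ h1, hsup x (by linarith), sub_zero, enorm_zero]
        _ = 0 := lintegral_zero
  have hJsum : ∀ m, ∑ j ∈ Finset.range m, J j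
      ≤ C * ENNReal.ofReal (210 * (1 / (1 - q))) := by
    intro m
    refine (Finset.sum_le_sum fun j _ => hJle j).trans ?_
    rw [← Finset.mul_sum, ← ENNReal.ofReal_sum_of_nonneg, ← Finset.mul_sum]
    · gcongr
      exact sum_indicator_rpow_le hε hq hs m
    · intro j _
      split_ifs <;> positivity
  have hK : ∑ j ∈ Finset.range n, ∫⁻ x in A, ‖kernelD α β ς j (heisDiff y x) - kernelD α β ς j x‖ₑ
      ≤ ∑ j ∈ Finset.range n, J j + ∑ j ∈ Finset.range n, J j := by
    have hstep : ∀ m, ∑ j ∈ Finset.range (m + 1),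
        ∫⁻ x in A, ‖kernelD α β ς j (heisDiff y x) - kernelD α β ς j x‖ₑ
          ≤ ∑ j ∈ Finset.range (m + 1), J j + ∑ j ∈ Finset.range m, J j := by
      intro m
      induction m with
      | zero => simp [hJ, kernelD_zero_eq]
      | succ m ih =>
        rw [Finset.sum_range_succ, Finset.sum_range_succ J (m + 1)]
        nth_rewrite 3 [Finset.sum_range_succ]
        have h1 : ∫⁻ x in A, ‖kernelD α β ς (m + 1) (heisDiff y x) - kernelD α β ς (m + 1) x‖ₑ
            ≤ J (m + 1) + J m := by
          have hm : Measurable fun x => ‖bump α β ς ((2 : ℝ)⁻¹ ^ m) (heisDiff y x)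
              - bump α β ς ((2 : ℝ)⁻¹ ^ m) x‖ₑ :=
            (((hς.continuous_bump _).measurable.comp
              (measurePreserving_heisDiff_left y).measurable).sub
                (hς.continuous_bump _).measurable).enorm
          simp only [hJ]
          rw [← lintegral_add_right _ hm]
          refine lintegral_mono fun x => ?_
          rw [kernelD_succ hΓ, kernelD_succ hΓ]
          refine le_trans (le_of_eq ?_) enorm_sub_le
          congr 1
          ring
        refine (add_le_add ih h1).trans (le_of_eq ?_)
        ring
    cases n with
    | zero => simp
    | succ m =>
      refine (hstep m).trans (add_le_add le_rfl ?_)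
      exact Finset.sum_le_sum_of_subset (Finset.range_mono (Nat.le_succ m))
  refine hK.trans ((add_le_add (hJsum n) (hJsum n)).trans (le_of_eq ?_))
  rw [← two_mul]
  rfl

end Hormander

/-! ### Calderón–Zygmund theory for operator-valued kernels -/

/-- An operator that is bounded on `L²` and whose kernel satisfies Hörmander's condition along a
ladder of quasi-norms is bounded on `L^p` for `1 < p < 2`, with a constant depending only on the data. -/
theorem NormLadder.eLpNorm_opConv_le {E F : Type*} [NormedAddCommGroup E] [NormedSpace ℝ E]
    [NormedAddCommGroup F] [NormedSpace ℝ F] [CompleteSpace E] [CompleteSpace F]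
    {N : ℤ → (Fin 3 → ℝ) → ℝ} {B : ℝ} {M : ℕ} (hN : NormLadder N B M)
    {k : (Fin 3 → ℝ) → E →L[ℝ] F} (hk : Continuous k) (hkc : HasCompactSupport k)
    {R' : ℝ} (hR' : 0 ≤ R') {CH A : ℝ≥0}
    (hH : ∀ l y, N l y ≤ 1 + 2 * B →
      ∫⁻ x in {x | R' < N l x}, ‖k (heisDiff y x) - k x‖ₑ ≤ CH)
    (h2 : ∀ g, AEStronglyMeasurable g → ∫⁻ x, ‖opConv k g x‖ₑ ^ 2 ≤ A * ∫⁻ x, ‖g x‖ₑ ^ 2)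
    {p : ℝ≥0∞} (hp : 1 < p) (hp2 : p < 2) {f : (Fin 3 → ℝ) → E} (hf : MemLp f p) :
    eLpNorm (opConv k f) p
      ≤ interpConst p.toReal (A * (1 + 2 * M) + ENNReal.ofReal (R' ^ 3) + 2 * CH) A
          ^ (1 / p.toReal) * eLpNorm f p := by
  have hpt : p ≠ ∞ := (hp2.trans ENNReal.ofNat_lt_top).ne
  have h1p : 1 < p.toReal := by
    rw [← ENNReal.toReal_one]
    exact (ENNReal.toReal_lt_toReal ENNReal.one_ne_top hpt).2 hp
  have hp2' : p.toReal < 2 := by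
    rw [← ENNReal.toReal_ofNat 2]
    exact (ENNReal.toReal_lt_toReal hpt ENNReal.ofNat_ne_top).2 hp2
  refine eLpNorm_opConv_le_of_dense hk hkc hp.le hpt (interpConst_ne_top (by finiteness)
    ENNReal.coe_ne_top) (fun g hg hgc => ?_) hf
  exact lintegral_opConv_rpow_le_of_weak_type hk hkc
    (fun u hu huc a ha ha' => hN.weak_type hk hkc hR' hH h2 hu huc ha ha') h2 h1p hp2' hg hgc

/-! ### Finitely many convolution kernels as one operator-valued kernel -/

section Vector

/-- The kernel of `f ↦ (K_j-convolution of f)_{j < n}`, with values in `ℓ²_n`. -/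
def analysisKernel (n : ℕ) (K : ℕ → (Fin 3 → ℝ) → ℂ) (y : Fin 3 → ℝ) :
    ℂ →L[ℝ] EuclideanSpace ℂ (Fin n) :=
  (ContinuousLinearMap.lsmul ℝ ℂ).flip (WithLp.toLp 2 fun j : Fin n => K j y)

/-- The kernel of `(g_j)_{j < n} ↦ ∑_j (K_j-convolution of g_j)`, defined on `ℓ²_n`. -/
def synthesisKernel (n : ℕ) (K : ℕ → (Fin 3 → ℝ) → ℂ) (y : Fin 3 → ℝ) :
    EuclideanSpace ℂ (Fin n) →L[ℝ] ℂ :=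
  ∑ j : Fin n, (ContinuousLinearMap.mul ℝ ℂ (K j y)).comp
    ((EuclideanSpace.proj j : EuclideanSpace ℂ (Fin n) →L[ℂ] ℂ).restrictScalars ℝ)

variable {n : ℕ} {K : ℕ → (Fin 3 → ℝ) → ℂ}

theorem analysisKernel_apply (y : Fin 3 → ℝ) (c : ℂ) (j : Fin n) :
    analysisKernel n K y c j = K j y * c := by
  simp [analysisKernel, mul_comm]

theorem synthesisKernel_apply (y : Fin 3 → ℝ) (g : EuclideanSpace ℂ (Fin n)) :
    synthesisKernel n K y g = ∑ j : Fin n, K j y * g j := by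
  simp [synthesisKernel]

theorem continuous_analysisKernel (hK : ∀ j, Continuous (K j)) :
    Continuous (analysisKernel n K) :=
  (ContinuousLinearMap.lsmul ℝ ℂ).flip.continuous.comp
    ((PiLp.continuous_toLp 2 _).comp (continuous_pi fun j : Fin n => hK j))

theorem continuous_synthesisKernel (hK : ∀ j, Continuous (K j)) :
    Continuous (synthesisKernel n K) := by
  refine continuous_finsetSum _ fun j _ => ?_
  exact (continuous_mulKernel (hK j)).clm_comp continuous_const

theorem hasCompactSupport_of_forall_eq_zero {V : Type*} [TopologicalSpace V] [Zero V]
    {k : (Fin 3 → ℝ) → V} (hKc : ∀ j, HasCompactSupport (K j))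
    (h : ∀ y, (∀ j < n, K j y = 0) → k y = 0) : HasCompactSupport k := by
  have hc : IsCompact (⋃ j ∈ Finset.range n, tsupport (K j)) :=
    (Finset.range n).isCompact_biUnion fun j _ => hKc j
  refine HasCompactSupport.intro hc fun y hy => h y fun j hj => ?_
  refine image_eq_zero_of_notMem_tsupport fun hmem => hy ?_
  exact mem_iUnion₂.2 ⟨j, Finset.mem_range.2 hj, hmem⟩

theorem hasCompactSupport_analysisKernel (hKc : ∀ j, HasCompactSupport (K j)) :
    HasCompactSupport (analysisKernel n K) :=
  hasCompactSupport_of_forall_eq_zero (n := n) hKc fun y hy => by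
    ext c j
    simp [analysisKernel_apply, hy j j.2]

theorem hasCompactSupport_synthesisKernel (hKc : ∀ j, HasCompactSupport (K j)) :
    HasCompactSupport (synthesisKernel n K) :=
  hasCompactSupport_of_forall_eq_zero (n := n) hKc fun y hy => by
    ext g
    simp [synthesisKernel_apply, fun j : Fin n => hy j j.2]

theorem enorm_analysisKernel_sub_le (x y : Fin 3 → ℝ) :
    ‖analysisKernel n K x - analysisKernel n K y‖ₑ
      ≤ ∑ j ∈ Finset.range n, ‖K j x - K j y‖ₑ := by
  have h : ‖analysisKernel n K x - analysisKernel n K y‖ ≤ ∑ j : Fin n, ‖K j x - K j y‖ := by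
    refine ContinuousLinearMap.opNorm_le_bound _ (by positivity) fun c => ?_
    rw [EuclideanSpace.norm_eq, Real.sqrt_le_left (by positivity), Finset.sum_mul]
    refine (Finset.sum_le_sum fun j _ => ?_).trans
      (Finset.sum_sq_le_sq_sum_of_nonneg (s := Finset.univ)
        (f := fun j : Fin n => ‖K j x - K j y‖ * ‖c‖) fun j _ => by positivity)
    rw [sub_apply, PiLp.sub_apply, analysisKernel_apply, analysisKernel_apply, ← sub_mul, norm_mul]
  rw [Finset.sum_range fun j => ‖K j x - K j y‖ₑ]
  simp only [← ofReal_norm]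
  rw [← ENNReal.ofReal_sum_of_nonneg fun _ _ => norm_nonneg _]
  exact ENNReal.ofReal_le_ofReal h

theorem enorm_synthesisKernel_sub_le (x y : Fin 3 → ℝ) :
    ‖synthesisKernel n K x - synthesisKernel n K y‖ₑ
      ≤ ∑ j ∈ Finset.range n, ‖K j x - K j y‖ₑ := by
  have h : ‖synthesisKernel n K x - synthesisKernel n K y‖ ≤ ∑ j : Fin n, ‖K j x - K j y‖ := by
    refine ContinuousLinearMap.opNorm_le_bound _ (by positivity) fun g => ?_
    rw [sub_apply, synthesisKernel_apply, synthesisKernel_apply,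
      ← Finset.sum_sub_distrib, Finset.sum_mul]
    refine (norm_sum_le _ _).trans (Finset.sum_le_sum fun j _ => ?_)
    rw [← sub_mul, norm_mul]
    exact mul_le_mul_of_nonneg_left (PiLp.norm_apply_le g j) (norm_nonneg _)
  rw [Finset.sum_range fun j => ‖K j x - K j y‖ₑ]
  simp only [← ofReal_norm]
  rw [← ENNReal.ofReal_sum_of_nonneg fun _ _ => norm_nonneg _]
  exact ENNReal.ofReal_le_ofReal h

theorem opConv_analysisKernel_apply (hK : ∀ j, Continuous (K j))
    (hKc : ∀ j, HasCompactSupport (K j)) {p : ℝ≥0∞} (hp : 1 ≤ p) {f : (Fin 3 → ℝ) → ℂ}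
    (hf : MemLp f p) (x : Fin 3 → ℝ) (j : Fin n) :
    opConv (analysisKernel n K) f x j = heisConv (K j) f x := by
  have hi := integrable_opConv_kernel (continuous_analysisKernel (n := n) hK)
    (hasCompactSupport_analysisKernel hKc) hp hf x
  have h := (EuclideanSpace.proj j : EuclideanSpace ℂ (Fin n) →L[ℂ] ℂ).integral_comp_comm hi
  rw [heisConv_eq_opConv, opConv, opConv]
  simpa [analysisKernel_apply] using h.symm

theorem opConv_synthesisKernel (hK : ∀ j, Continuous (K j))
    (hKc : ∀ j, HasCompactSupport (K j)) {p : ℝ≥0∞} (hp : 1 ≤ p)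
    {g : (Fin 3 → ℝ) → EuclideanSpace ℂ (Fin n)} (hg : ∀ j, MemLp (fun x => g x j) p)
    (x : Fin 3 → ℝ) :
    opConv (synthesisKernel n K) g x = ∑ j : Fin n, heisConv (K j) (fun z => g z j) x := by
  simp only [heisConv_eq_opConv, opConv, synthesisKernel_apply]
  rw [integral_finsetSum]
  · rfl
  · intro j _
    exact integrable_opConv_kernel (continuous_mulKernel (hK j))
      (hasCompactSupport_mulKernel (hKc j)) hp (hg j) x

end Vector

/-! ### Duality between analysis and synthesis -/

theorem continuous_adjKernel {K : (Fin 3 → ℝ) → ℂ} (hK : Continuous K) :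
    Continuous (adjKernel K) :=
  Complex.continuous_conj.comp (hK.comp continuous_heisInv)

theorem hasCompactSupport_adjKernel {K : (Fin 3 → ℝ) → ℂ} (hK : HasCompactSupport K) :
    HasCompactSupport (adjKernel K) := by
  have h : HasCompactSupport (K ∘ Homeomorph.neg (Fin 3 → ℝ)) := hK.comp_homeomorph _
  have e : adjKernel K = conj ∘ (K ∘ Homeomorph.neg (Fin 3 → ℝ)) := by
    ext x; simp [adjKernel, heisInv_eq_neg]
  rw [e]
  exact h.comp_left (map_zero _)

theorem memLp_apply {n : ℕ} {p : ℝ≥0∞} {g : (Fin 3 → ℝ) → EuclideanSpace ℂ (Fin n)}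
    (hg : MemLp g p) (j : Fin n) : MemLp (fun x => g x j) p :=
  ((EuclideanSpace.proj j : EuclideanSpace ℂ (Fin n) →L[ℂ] ℂ).comp_memLp' hg)

theorem toReal_eLpNorm_rpow {V : Type*} [NormedAddCommGroup V] {f : (Fin 3 → ℝ) → V} {p : ℝ≥0∞}
    (hp : 1 < p) (hp' : p ≠ ∞) (hf : MemLp f p) :
    (eLpNorm f p).toReal ^ p.toReal = ∫ x, ‖f x‖ ^ p.toReal := by
  have hp0 : p ≠ 0 := (zero_lt_one.trans hp).ne'
  have h := ENNReal.toReal_pos hp0 hp'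
  rw [hf.eLpNorm_eq_integral_rpow_norm hp0 hp', ENNReal.toReal_ofReal (by positivity),
    ← Real.rpow_mul (by positivity), inv_mul_cancel₀ h.ne', Real.rpow_one]

/-- Duality: a bound on `L^q` for synthesis with the adjoint kernels gives the same bound on `L^p`,
`1/p + 1/q = 1`, for analysis. The test function is the one for which Hölder's inequality is an
equality. -/
theorem eLpNorm_analysis_le_of_synthesis {n : ℕ} {K : ℕ → (Fin 3 → ℝ) → ℂ}
    (hK : ∀ j, Continuous (K j)) (hKc : ∀ j, HasCompactSupport (K j)) {p q : ℝ≥0∞}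
    [hpq : ENNReal.HolderConjugate p q] (hp : 1 < p) (hp' : p ≠ ∞) (hq : 1 < q) (hq' : q ≠ ∞)
    {D : ℝ≥0}
    (H : ∀ g : (Fin 3 → ℝ) → EuclideanSpace ℂ (Fin n), MemLp g q →
      eLpNorm (opConv (synthesisKernel n fun j => adjKernel (K j)) g) q ≤ D * eLpNorm g q)
    {f : (Fin 3 → ℝ) → ℂ} (hf : MemLp f p)
    (hTf : MemLp (opConv (analysisKernel n K) f) p) :
    eLpNorm (opConv (analysisKernel n K) f) p ≤ D * eLpNorm f p := by
  set r := p.toReal with hr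
  set r' := q.toReal with hr'
  have h1r : 1 < r := by
    rw [hr, ← ENNReal.toReal_one]; exact (ENNReal.toReal_lt_toReal ENNReal.one_ne_top hp').2 hp
  have hrr : r.HolderConjugate r' := ENNReal.HolderConjugate.toReal_of_ne_top hp' hq'
  set F := opConv (analysisKernel n K) f with hF
  set G : (Fin 3 → ℝ) → EuclideanSpace ℂ (Fin n) := fun x => ‖F x‖ ^ (r - 2) • F x with hG
  have hGnorm : ∀ x, ‖G x‖ = ‖F x‖ ^ (r - 1) := fun x => by
    rw [hG]
    simp only [norm_smul, Real.norm_of_nonneg (Real.rpow_nonneg (norm_nonneg (F x)) _)]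
    rcases (norm_nonneg (F x)).eq_or_lt with h | h
    · rw [← h, mul_zero, Real.zero_rpow (by linarith)]
    · nth_rewrite 2 [← Real.rpow_one ‖F x‖]
      rw [← Real.rpow_add h]
      ring_nf
  have hGpow : ∀ x, ‖G x‖ ^ r' = ‖F x‖ ^ r := fun x => by
    rw [hGnorm, ← Real.rpow_mul (norm_nonneg _), hrr.sub_one_mul_conj]
  have hGm : AEStronglyMeasurable G :=
    ((hTf.1.norm.aemeasurable.pow_const (r - 2)).aestronglyMeasurable).smul hTf.1
  have hGq : MemLp G q := by
    have hq0 : q ≠ 0 := (zero_lt_one.trans hq).ne'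
    have hp0 : p ≠ 0 := (zero_lt_one.trans hp).ne'
    rw [← memLp_norm_rpow_iff hGm hq0 hq', ENNReal.div_self hq0 hq']
    simp only [← hr', hGpow]
    have := hTf.norm_rpow_div p
    rwa [ENNReal.div_self hp0 hp'] at this
  have hconj : ∀ x, ((‖F x‖ ^ r : ℝ) : ℂ) = ∑ j : Fin n, heisConv (K j) f x * conj (G x j) := by
    intro x
    have e1 : ∀ j : Fin n, heisConv (K j) f x * conj (G x j)
        = ((‖F x‖ ^ (r - 2) * ‖F x j‖ ^ 2 : ℝ) : ℂ) := fun j => by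
      rw [← opConv_analysisKernel_apply hK hKc hp.le hf x j, hG]
      simp only [PiLp.smul_apply, Complex.real_smul, map_mul, Complex.conj_ofReal, ← hF]
      rw [mul_left_comm, Complex.mul_conj']
      push_cast
      ring
    simp only [e1]
    rw [← Complex.ofReal_sum, ← Finset.mul_sum, ← EuclideanSpace.norm_sq_eq]
    congr 1
    rcases (norm_nonneg (F x)).eq_or_lt with h | h
    · rw [← h, Real.zero_rpow (by linarith)]; simp
    · rw [← Real.rpow_natCast, ← Real.rpow_add h]
      norm_num
  have hint : ∀ j : Fin n, Integrable fun x => heisConv (K j) f x * conj (G x j) := fun j =>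
    (memLp_heisConv (hK j) (hKc j) hp.le hp' hf).integrable_mul (memLp_apply hGq j).star
  have hdual : ((∫ x, ‖F x‖ ^ r : ℝ) : ℂ)
      = ∫ x, f x * conj (opConv (synthesisKernel n fun j => adjKernel (K j)) G x) := by
    have hKi : ∀ j, Integrable (K j) := fun j => (hK j).integrable_of_hasCompactSupport (hKc j)
    rw [← integral_complex_ofReal]
    simp only [hconj]
    rw [integral_finsetSum _ fun j _ => hint j]
    simp only [opConv_synthesisKernel (fun j => continuous_adjKernel (hK j))
      (fun j => hasCompactSupport_adjKernel (hKc j)) hq.le (fun j => memLp_apply hGq j), map_sum,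
      Finset.mul_sum]
    rw [integral_finsetSum]
    · exact Finset.sum_congr rfl fun j _ =>
        integral_heisConv_mul_conj (hKi j) hf (memLp_apply hGq j)
    · intro j _
      exact hf.integrable_mul (memLp_heisConv (continuous_adjKernel (hK j))
        (hasCompactSupport_adjKernel (hKc j)) hq.le hq' (memLp_apply hGq j)).star
  set a := (eLpNorm F p).toReal with ha
  have hak : a ^ r = ∫ x, ‖F x‖ ^ r := toReal_eLpNorm_rpow hp hp' hTf
  have hbk : (eLpNorm G q).toReal ^ r' = a ^ r := by
    rw [hak, toReal_eLpNorm_rpow hq hq' hGq]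
    simp only [← hr', hGpow]
  have hTG : MemLp (opConv (synthesisKernel n fun j => adjKernel (K j)) G) q :=
    ⟨aestronglyMeasurable_opConv (continuous_synthesisKernel fun j => continuous_adjKernel (hK j))
      hGm, (H G hGq).trans_lt (ENNReal.mul_lt_top ENNReal.coe_lt_top hGq.2)⟩
  have hH := integral_norm_mul_conj_le hf hTG 0
  have h0 : ∀ x, heisMul x 0 = x := fun x => by
    ext i; fin_cases i <;> simp [heisMul]
  simp only [h0] at hH
  have hmain : a ^ r ≤ (eLpNorm f p).toReal * (D * (eLpNorm G q).toReal) := by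
    have h1 : a ^ r = ‖((∫ x, ‖F x‖ ^ r : ℝ) : ℂ)‖ := by
      rw [← hak, Complex.norm_real, Real.norm_of_nonneg (by positivity)]
    rw [h1, hdual]
    refine (norm_integral_le_integral_norm _).trans (hH.trans ?_)
    gcongr
    have h2 := ENNReal.toReal_mono (ENNReal.mul_ne_top ENNReal.coe_ne_top hGq.2.ne) (H G hGq)
    simpa [ENNReal.toReal_mul] using h2
  have hfin : a ≤ D * (eLpNorm f p).toReal := by
    rcases (show 0 ≤ a from ENNReal.toReal_nonneg).eq_or_lt with h | h
    · rw [← h]; positivity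
    · have e : (eLpNorm G q).toReal = a ^ (r - 1) := by
        have h2 : ((eLpNorm G q).toReal ^ r') ^ (1 / r') = (a ^ r) ^ (1 / r') := by rw [hbk]
        rw [← Real.rpow_mul ENNReal.toReal_nonneg, mul_one_div_cancel hrr.symm.ne_zero,
          Real.rpow_one, ← Real.rpow_mul h.le] at h2
        rw [h2]
        congr 1
        rw [mul_one_div, div_eq_iff hrr.symm.ne_zero, hrr.sub_one_mul_conj]
      rw [e] at hmain
      have h3 : a ^ r = a * a ^ (r - 1) := by
        nth_rewrite 2 [← Real.rpow_one a]
        rw [← Real.rpow_add h]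
        ring_nf
      have h4 : 0 < a ^ (r - 1) := Real.rpow_pos_of_pos h _
      rw [h3] at hmain
      refine le_of_mul_le_mul_right ?_ h4
      linarith
  rw [← ENNReal.toReal_le_toReal hTf.2.ne (ENNReal.mul_ne_top ENNReal.coe_ne_top hf.2.ne),
    ENNReal.toReal_mul]
  exact hfin

/-! ### Bounds for finitely many kernels, uniform in their number -/

theorem enorm_sq_eq_sum {n : ℕ} (v : EuclideanSpace ℂ (Fin n)) :
    ‖v‖ₑ ^ 2 = ∑ j : Fin n, ‖v j‖ₑ ^ 2 := by
  simp only [← ofReal_norm]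
  rw [← ENNReal.ofReal_pow (norm_nonneg _), EuclideanSpace.norm_sq_eq,
    ENNReal.ofReal_sum_of_nonneg fun _ _ => by positivity]
  exact Finset.sum_congr rfl fun j _ => ENNReal.ofReal_pow (norm_nonneg _) 2

theorem memLp_two_of_lintegral_ne_top {V : Type*} [NormedAddCommGroup V] {g : (Fin 3 → ℝ) → V}
    (hg : AEStronglyMeasurable g) (h : ∫⁻ x, ‖g x‖ₑ ^ 2 ≠ ∞) : MemLp g 2 := by
  refine ⟨hg, ?_⟩
  rw [← eLpNorm_two_sq] at h
  exact lt_top_iff_ne_top.2 fun h' => h (by rw [h']; simp)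

/-- It suffices to prove an `L²` bound for functions in `L²`: for all others the right side is
infinite, as soon as the constant is positive. -/
theorem lintegral_opConv_sq_le {V W : Type*} [NormedAddCommGroup V] [NormedAddCommGroup W]
    [NormedSpace ℝ V] [NormedSpace ℝ W] {k : (Fin 3 → ℝ) → V →L[ℝ] W} {A : ℝ≥0}
    (h : ∀ g, MemLp g 2 → ∫⁻ x, ‖opConv k g x‖ₑ ^ 2 ≤ A * ∫⁻ x, ‖g x‖ₑ ^ 2)
    (g : (Fin 3 → ℝ) → V) (hg : AEStronglyMeasurable g) :
    ∫⁻ x, ‖opConv k g x‖ₑ ^ 2 ≤ ((A + 1 : ℝ≥0) : ℝ≥0∞) * ∫⁻ x, ‖g x‖ₑ ^ 2 := by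
  by_cases hfin : ∫⁻ x, ‖g x‖ₑ ^ 2 = ∞
  · rw [hfin, ENNReal.mul_top (by simp)]
    exact le_top
  · refine (h g (memLp_two_of_lintegral_ne_top hg hfin)).trans ?_
    gcongr
    simp

namespace IsBump

variable {α β : ℝ → ℝ} {ς : (Fin 3 → ℝ) → ℂ} {L : ℝ≥0}

/-- The `L²` bound for the adjoint operator, in terms of the operator-valued kernel. -/
theorem exists_lintegral_synthesis_sq_le (hς : IsBump ς L) (hΓ : IsAdmissibleCurve α β) :
    ∃ A : ℝ≥0, ∀ n : ℕ, ∀ g : (Fin 3 → ℝ) → EuclideanSpace ℂ (Fin n), MemLp g 2 →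
      ∫⁻ x, ‖opConv (synthesisKernel n fun j => adjKernel (kernelD α β ς j)) g x‖ₑ ^ 2
        ≤ A * ∫⁻ x, ‖g x‖ₑ ^ 2 := by
  obtain ⟨A, hA⟩ := hς.exists_lintegral_sum_adjoint_le hΓ
  refine ⟨A, fun n g hg => ?_⟩
  set F : ℕ → (Fin 3 → ℝ) → ℂ := fun j => if h : j < n then fun x => g x ⟨j, h⟩ else 0 with hF
  have hFj : ∀ j : Fin n, F j = fun x => g x j := fun j => by simp [hF]
  have hFm : ∀ j, MemLp (F j) 2 := fun j => by
    by_cases h : j < n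
    · simpa only [hF, h, dif_pos] using memLp_apply hg ⟨j, h⟩
    · simp [hF, h]
  have h := hA n F hFm
  rw [Finset.sum_range fun j => ∫⁻ x, ‖F j x‖ₑ ^ 2] at h
  simp only [Finset.sum_range fun j => heisConv (adjKernel (kernelD α β ς j)) (F j) _, hFj] at h
  simp only [opConv_synthesisKernel (fun j => continuous_adjKernel (hς.continuous_kernelD hΓ j))
    (fun j => hasCompactSupport_adjKernel (hς.hasCompactSupport_kernelD hΓ j)) one_le_two
    fun j => memLp_apply hg j]
  refine h.trans (le_of_eq ?_)
  congr 1
  simp only [enorm_sq_eq_sum]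
  rw [lintegral_finsetSum' _ fun j _ => (memLp_apply hg j).1.enorm.pow_const 2]

theorem memLp_analysis (hς : IsBump ς L) (hΓ : IsAdmissibleCurve α β) (n : ℕ) {p : ℝ≥0∞}
    (hp : 1 ≤ p) (hp' : p ≠ ∞) {f : (Fin 3 → ℝ) → ℂ} (hf : MemLp f p) :
    MemLp (opConv (analysisKernel n (kernelD α β ς)) f) p :=
  memLp_opConv (continuous_analysisKernel (hς.continuous_kernelD hΓ))
    (hasCompactSupport_analysisKernel (hς.hasCompactSupport_kernelD hΓ)) hp hp' hf

theorem exists_eLpNorm_analysis_two_le (hς : IsBump ς L) (hΓ : IsAdmissibleCurve α β) :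
    ∃ D : ℝ≥0, ∀ n : ℕ, ∀ f : (Fin 3 → ℝ) → ℂ, MemLp f 2 →
      eLpNorm (opConv (analysisKernel n (kernelD α β ς)) f) 2 ≤ D * eLpNorm f 2 := by
  obtain ⟨A, hA⟩ := hς.exists_lintegral_synthesis_sq_le hΓ
  refine ⟨A + 1, fun n f hf => ?_⟩
  refine eLpNorm_analysis_le_of_synthesis (hς.continuous_kernelD hΓ)
    (hς.hasCompactSupport_kernelD hΓ) (p := 2) (q := 2) (by norm_num) ENNReal.ofNat_ne_top
    (by norm_num) ENNReal.ofNat_ne_top (fun g hg => ?_) hf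
    (hς.memLp_analysis hΓ n one_le_two ENNReal.ofNat_ne_top hf)
  have h := hA n g hg
  rw [← eLpNorm_two_sq, ← eLpNorm_two_sq] at h
  rw [← ENNReal.pow_le_pow_left_iff two_ne_zero, mul_pow]
  refine h.trans ?_
  gcongr
  have h1 : A ≤ (A + 1) ^ 2 := by nlinarith [zero_le (a := A)]
  exact_mod_cast h1

/-- Hörmander's condition for a vector-valued kernel built from the kernels of the `𝒟_j`. -/
theorem exists_hormander_of_le (hς : IsBump ς L) (hΓ : IsAdmissibleCurve α β) :
    ∃ C : ℝ≥0, ∀ s, 0 < s → ∀ y, scaleNorm α β s y ≤ 21 → ∀ n : ℕ,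
      ∀ Φ : (Fin 3 → ℝ) → (Fin 3 → ℝ) → ℝ≥0∞,
      (∀ x z, Φ x z ≤ ∑ j ∈ Finset.range n, ‖kernelD α β ς j x - kernelD α β ς j z‖ₑ) →
      ∫⁻ x in {x | 241 < scaleNorm α β s x}, Φ (heisDiff y x) x ≤ C := by
  obtain ⟨C, hC⟩ := hς.exists_hormander hΓ
  refine ⟨C, fun s hs y hy n Φ hΦ => ?_⟩
  refine (lintegral_mono fun x => hΦ _ _).trans ?_
  rw [lintegral_finsetSum]
  · exact hC s hs y hy n
  · intro j _
    exact (((hς.continuous_kernelD hΓ j).measurable.comp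
      (measurePreserving_heisDiff_left y).measurable).sub
        (hς.continuous_kernelD hΓ j).measurable).enorm

theorem exists_eLpNorm_analysis_le_of_lt_two (hς : IsBump ς L) (hΓ : IsAdmissibleCurve α β)
    {p : ℝ≥0∞} (hp : 1 < p) (hp2 : p < 2) :
    ∃ D : ℝ≥0, ∀ n : ℕ, ∀ f : (Fin 3 → ℝ) → ℂ, MemLp f p →
      eLpNorm (opConv (analysisKernel n (kernelD α β ς)) f) p ≤ D * eLpNorm f p := by
  obtain ⟨τ, hτ, M, hN⟩ := hΓ.exists_normLadder
  obtain ⟨C, hC⟩ := hς.exists_hormander_of_le hΓ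
  obtain ⟨D₂, hD₂⟩ := hς.exists_eLpNorm_analysis_two_le hΓ
  have hA : ∀ n : ℕ, ∀ g : (Fin 3 → ℝ) → ℂ, MemLp g 2 →
      ∫⁻ x, ‖opConv (analysisKernel n (kernelD α β ς)) g x‖ₑ ^ 2
        ≤ ((D₂ ^ 2 : ℝ≥0) : ℝ≥0∞) * ∫⁻ x, ‖g x‖ₑ ^ 2 := fun n g hg => by
    rw [← eLpNorm_two_sq, ← eLpNorm_two_sq, ENNReal.coe_pow, ← mul_pow]
    gcongr
    exact hD₂ n g hg
  set D := interpConst p.toReal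
    (((D₂ ^ 2 + 1 : ℝ≥0) : ℝ≥0∞) * (1 + 2 * M) + ENNReal.ofReal (241 ^ 3) + 2 * C)
    ((D₂ ^ 2 + 1 : ℝ≥0) : ℝ≥0∞) ^ (1 / p.toReal) with hD
  have hDfin : D ≠ ∞ := ENNReal.rpow_ne_top_of_nonneg (by positivity)
    (interpConst_ne_top (by finiteness) ENNReal.coe_ne_top)
  refine ⟨D.toNNReal, fun n f hf => ?_⟩
  rw [ENNReal.coe_toNNReal hDfin]
  refine hN.eLpNorm_opConv_le (continuous_analysisKernel (hς.continuous_kernelD hΓ))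
    (hasCompactSupport_analysisKernel (hς.hasCompactSupport_kernelD hΓ)) (by norm_num)
    (fun l y hy => ?_) (lintegral_opConv_sq_le (hA n)) hp hp2 hf
  exact hC (τ l) (hτ l) y (hy.trans (by norm_num)) n
    (fun x z => ‖analysisKernel n (kernelD α β ς) x - analysisKernel n (kernelD α β ς) z‖ₑ)
    enorm_analysisKernel_sub_le

theorem exists_eLpNorm_synthesis_le_of_lt_two (hς : IsBump ς L) (hΓ : IsAdmissibleCurve α β)
    {p : ℝ≥0∞} (hp : 1 < p) (hp2 : p < 2) :
    ∃ D : ℝ≥0, ∀ n : ℕ, ∀ g : (Fin 3 → ℝ) → EuclideanSpace ℂ (Fin n), MemLp g p →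
      eLpNorm (opConv (synthesisKernel n fun j => adjKernel (kernelD α β ς j)) g) p
        ≤ D * eLpNorm g p := by
  obtain ⟨τ, hτ, M, hN⟩ := hΓ.exists_normLadder
  obtain ⟨C, hC⟩ := hς.conj_neg.exists_hormander_of_le hΓ
  obtain ⟨A, hA⟩ := hς.exists_lintegral_synthesis_sq_le hΓ
  simp only [adjKernel_kernelD hΓ] at hA ⊢
  set D := interpConst p.toReal
    (((A + 1 : ℝ≥0) : ℝ≥0∞) * (1 + 2 * M) + ENNReal.ofReal (241 ^ 3) + 2 * C)
    ((A + 1 : ℝ≥0) : ℝ≥0∞) ^ (1 / p.toReal) with hD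
  have hDfin : D ≠ ∞ := ENNReal.rpow_ne_top_of_nonneg (by positivity)
    (interpConst_ne_top (by finiteness) ENNReal.coe_ne_top)
  refine ⟨D.toNNReal, fun n f hf => ?_⟩
  rw [ENNReal.coe_toNNReal hDfin]
  refine hN.eLpNorm_opConv_le (continuous_synthesisKernel (hς.conj_neg.continuous_kernelD hΓ))
    (hasCompactSupport_synthesisKernel (hς.conj_neg.hasCompactSupport_kernelD hΓ)) (by norm_num)
    (fun l y hy => ?_) (lintegral_opConv_sq_le (hA n)) hp hp2 hf
  exact hC (τ l) (hτ l) y (hy.trans (by norm_num)) n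
    (fun x z => ‖synthesisKernel n (fun j => kernelD α β (fun u => conj (ς (-u))) j) x
      - synthesisKernel n (fun j => kernelD α β (fun u => conj (ς (-u))) j) z‖ₑ)
    enorm_synthesisKernel_sub_le

/-- The vector-valued operator of finitely many `𝒟_j` is bounded on `L^p`, uniformly in their number. -/
theorem exists_eLpNorm_analysis_le (hς : IsBump ς L) (hΓ : IsAdmissibleCurve α β)
    {p : ℝ≥0∞} (hp : 1 < p) (hp' : p ≠ ∞) :
    ∃ D : ℝ≥0, ∀ n : ℕ, ∀ f : (Fin 3 → ℝ) → ℂ, MemLp f p →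
      eLpNorm (opConv (analysisKernel n (kernelD α β ς)) f) p ≤ D * eLpNorm f p := by
  rcases lt_trichotomy p 2 with h | rfl | h
  · exact hς.exists_eLpNorm_analysis_le_of_lt_two hΓ hp h
  · exact hς.exists_eLpNorm_analysis_two_le hΓ
  · obtain ⟨q, hpq⟩ : ∃ q, ENNReal.HolderConjugate p q :=
      ⟨_, ENNReal.HolderConjugate.conjExponent hp.le⟩
    have hsum : p⁻¹ + q⁻¹ = 1 := by
      have := ENNReal.HolderConjugate.inv_add_inv_eq_one p q
      simpa using this
    have hpinv : p⁻¹ < 2⁻¹ := ENNReal.inv_lt_inv.2 h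
    have hq2 : q < 2 := by
      by_contra! hq
      have h1 : p⁻¹ + q⁻¹ < 2⁻¹ + 2⁻¹ :=
        ENNReal.add_lt_add_of_lt_of_le (by simp [(zero_lt_two.trans_le hq).ne']) hpinv
          (ENNReal.inv_le_inv.2 hq)
      rw [hsum, ENNReal.inv_two_add_inv_two] at h1
      exact lt_irrefl _ h1
    have hq1 : 1 < q := by
      by_contra! hq
      have h1 : 1 ≤ q⁻¹ := ENNReal.one_le_inv.2 hq
      have h2 : 0 < p⁻¹ := ENNReal.inv_pos.2 hp'
      have h3 : 1 < p⁻¹ + q⁻¹ := by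
        calc (1 : ℝ≥0∞) < p⁻¹ + 1 := by
              rw [add_comm]; exact ENNReal.lt_add_right ENNReal.one_ne_top h2.ne'
          _ ≤ _ := by gcongr
      exact h3.ne' hsum
    obtain ⟨D, hD⟩ := hς.exists_eLpNorm_synthesis_le_of_lt_two hΓ hq1 hq2
    exact ⟨D, fun n f hf => eLpNorm_analysis_le_of_synthesis (hς.continuous_kernelD hΓ)
      (hς.hasCompactSupport_kernelD hΓ) hp hp' hq1 (hq2.trans ENNReal.ofNat_lt_top).ne (hD n) hf
      (hς.memLp_analysis hΓ n hp.le hp' hf)⟩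

/-! ### Square functions -/

theorem exists_eLpNorm_squareFn_le (hς : IsBump ς L) (hΓ : IsAdmissibleCurve α β)
    {p : ℝ≥0∞} (hp : 1 < p) (hp' : p ≠ ∞) :
    ∃ D : ℝ≥0, ∀ f : (Fin 3 → ℝ) → ℂ, MemLp f p →
      MemLp (squareFn fun j => opD α β ς j f) p ∧
        eLpNorm (squareFn fun j => opD α β ς j f) p ≤ D * eLpNorm f p := by
  obtain ⟨D, hD⟩ := hς.exists_eLpNorm_analysis_le hΓ hp hp'
  refine ⟨D, fun f hf => ?_⟩
  have hp0 : p ≠ 0 := (zero_lt_one.trans hp).ne'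
  have hr : 0 < p.toReal := ENNReal.toReal_pos hp0 hp'
  have hm : ∀ j, AEStronglyMeasurable (opD α β ς j f) := fun j =>
    aestronglyMeasurable_heisConv (hς.continuous_kernelD hΓ j) hf.1
  set S : ℕ → (Fin 3 → ℝ) → ℝ≥0∞ := fun n x =>
    ∑ j ∈ Finset.range n, ‖opD α β ς j f x‖ₑ ^ 2 with hS
  have hSm : ∀ n, AEMeasurable (S n) := fun n =>
    Finset.aemeasurable_fun_sum _ fun j _ => (hm j).enorm.pow_const 2
  have hSF : ∀ n x, S n x ^ (p.toReal / 2)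
      = ‖opConv (analysisKernel n (kernelD α β ς)) f x‖ₑ ^ p.toReal := fun n x => by
    have e : S n x = ‖opConv (analysisKernel n (kernelD α β ς)) f x‖ₑ ^ (2 : ℝ) := by
      rw [ENNReal.rpow_two, enorm_sq_eq_sum, hS]
      simp only [opConv_analysisKernel_apply (hς.continuous_kernelD hΓ)
        (hς.hasCompactSupport_kernelD hΓ) hp.le hf]
      exact Finset.sum_range fun j => ‖opD α β ς j f x‖ₑ ^ 2
    rw [e, ← ENNReal.rpow_mul]
    congr 1
    ring
  have hlim : Filter.Tendsto (fun n => ∫⁻ x, S n x ^ (p.toReal / 2)) Filter.atTop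
      (nhds (∫⁻ x, squareFn (fun j => opD α β ς j f) x ^ p.toReal)) := by
    refine lintegral_tendsto_of_tendsto_of_monotone (fun n => (hSm n).pow_const _)
      (ae_of_all _ fun x => ?_) (ae_of_all _ fun x => ?_)
    · intro m n hmn
      refine ENNReal.rpow_le_rpow ?_ (by positivity)
      exact Finset.sum_le_sum_of_subset (Finset.range_mono hmn)
    · have e : squareFn (fun j => opD α β ς j f) x ^ p.toReal
          = (∑' j, ‖opD α β ς j f x‖ₑ ^ 2) ^ (p.toReal / 2) := by
        rw [squareFn, ← ENNReal.rpow_mul]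
        congr 1
        ring
      rw [e]
      exact (ENNReal.continuous_rpow_const.tendsto _).comp ENNReal.summable.hasSum.tendsto_sum_nat
  have hbound : ∫⁻ x, squareFn (fun j => opD α β ς j f) x ^ p.toReal
      ≤ (D * eLpNorm f p) ^ p.toReal := by
    refine le_of_tendsto' hlim fun n => ?_
    simp only [hSF]
    have h := hD n f hf
    rw [eLpNorm_eq_lintegral_rpow_enorm_toReal hp0 hp', one_div, ENNReal.rpow_inv_le_iff hr] at h
    exact h
  have hnorm : eLpNorm (squareFn fun j => opD α β ς j f) p ≤ D * eLpNorm f p := by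
    rw [eLpNorm_eq_lintegral_rpow_enorm_toReal hp0 hp', one_div, ENNReal.rpow_inv_le_iff hr]
    simpa only [enorm_eq_self] using hbound
  refine ⟨⟨?_, hnorm.trans_lt (ENNReal.mul_lt_top ENNReal.coe_lt_top hf.2)⟩, hnorm⟩
  have h : AEMeasurable (squareFn fun j => opD α β ς j f) :=
    (AEMeasurable.tsum fun j => (hm j).enorm.pow_const 2).pow_const _
  exact h.aestronglyMeasurable

end IsBump

theorem exists_isBump {ς : (Fin 3 → ℝ) → ℂ} (hς : ContDiff ℝ (⊤ : ℕ∞) ς)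
    (hsupp : tsupport ς ⊆ Set.Icc (-1) 1) : ∃ L, IsBump ς L := by
  have hc : HasCompactSupport ς := isCompact_Icc.of_isClosed_subset (isClosed_tsupport ς) hsupp
  obtain ⟨L, hL⟩ := ContDiff.lipschitzWith_of_hasCompactSupport hc hς (by simp)
  refine ⟨L, hL, fun u hu => image_eq_zero_of_notMem_tsupport fun h => hu.not_ge ?_⟩
  have h' := hsupp h
  rw [pi_norm_le_iff_of_nonneg zero_le_one]
  intro i
  rw [Real.norm_eq_abs, abs_le]
  exact ⟨h'.1 i, h'.2 i⟩

end HeisenbergLP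
end

theorem mainTheorem5 (α β : ℝ → ℝ) (hΓ : HeisenbergLP.IsAdmissibleCurve α β)
    (ς : (Fin 3 → ℝ) → ℂ) (hς_smooth : ContDiff ℝ (⊤ : ℕ∞) ς)
    (hς_supp : tsupport ς ⊆ Set.Icc (-1) 1) (hς_int : ∫ y, ς y = 1)
    (p : ℝ≥0∞) (hp_one : 1 < p) (hp_top : p < ⊤) :
    ∃ C : ℝ≥0, ∀ f : (Fin 3 → ℝ) → ℂ, MemLp f p volume →
      (MemLp (HeisenbergLP.squareFn fun j => HeisenbergLP.opD α β ς j f) p volume ∧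
        eLpNorm (HeisenbergLP.squareFn fun j => HeisenbergLP.opD α β ς j f) p volume
          ≤ C * eLpNorm f p volume) ∧
      (MemLp (HeisenbergLP.squareFn fun j => HeisenbergLP.opDAdj α β ς j f) p volume ∧
        eLpNorm (HeisenbergLP.squareFn fun j => HeisenbergLP.opDAdj α β ς j f) p volume
          ≤ C * eLpNorm f p volume) := by
  obtain ⟨L, hς⟩ := HeisenbergLP.exists_isBump hς_smooth hς_supp
  obtain ⟨C₁, h₁⟩ := hς.exists_eLpNorm_squareFn_le hΓ hp_one hp_top.ne
  obtain ⟨C₂, h₂⟩ := hς.conj_neg.exists_eLpNorm_squareFn_le hΓ hp_one hp_top.ne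
  -- the adjoint operators are the operators `𝒟_j` for the reflected conjugate of `ς`
  have hadj : ∀ j f, HeisenbergLP.opDAdj α β ς j f
      = HeisenbergLP.opD α β (fun u => conj (ς (-u))) j f := fun j f => by
    rw [HeisenbergLP.opDAdj, HeisenbergLP.opD, HeisenbergLP.adjKernel_kernelD hΓ]
  simp only [hadj]
  refine ⟨max C₁ C₂, fun f hf => ⟨⟨(h₁ f hf).1, (h₁ f hf).2.trans ?_⟩,
    (h₂ f hf).1, (h₂ f hf).2.trans ?_⟩⟩ <;> gcongr
  · exact le_max_left _ _
  · exact le_max_right _ _
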